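/- **Theorem.** *Setting.* Let $0<q<1$. For $g\ge 0$, $n\ge 1$ let $\omega_{g,n}$ be the correlation differentials of the Chekhov–Eynard–Orantin topological recursion (kernel $K_\alpha(z_1,p)=\frac12\,\frac{\int_p^{\sigma_\alpha(p)}\omega_{0,2}(z_1,\cdot)}{\omega_{0,1}(p)-\omega_{0,1}(\sigma_\alpha(p))}$, $\omega_{0,1}=y\,\mathrm dx$, $\omega_{0,2}=\frac{\mathrm dz_1\,\mathrm dz_2}{(z_1-z_2)^2}$) on the spectral curve $$x(z)=z+z^{-1},\qquad y(z)=\tfrac12(z-z^{-1})\prod_{k\ge1}\frac{(1-q^kz^2)(1-q^kz^{-2})}{(1-q^k)^2},$$ with branch points $z=\pm1$ and involution $\sigma(z)=z^{-1}$. For $(g,n)\ne(0,1),(0,2)$, Okuyama's discrete volumes $N^q_{g,n}(b_1,\dots,b_n)$, for positive integers $b_i$, are defined by the expansion at $z_i=0$ $$\omega_{g,n}(z_1,\dots,z_n)=\sum_{b_1,\dots,b_n\ge1}N^q_{g,n}(b_1,\dots,b_n)\prod_{i=1}^n b_iz_i^{b_i-1}\,\mathrm dz_i .$$ Let $\zeta_q(s)=\sum_{m\ge1}\frac{q^{ms/2}}{(1-q^m)^s}$.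 The $q$-deformed Weil–Petersson volumes $V^q_{g,n}(L_1,\dots,L_n)$ of Do–Norbury are defined by $V^q_{0,1}=V^q_{0,2}=0$, $V^q_{0,3}=1$, $V^q_{1,1}(L_1)=\frac1{48}L_1^2+\frac12\zeta_q(2)$, and, for all other $(g,n)$ with $n\ge1$, with $S=\{2,\dots,n\}$, by Mirzakhani's recursion $$\begin{aligned}\frac{\partial}{\partial L_1}L_1V^q_{g,n}(L_1,L_S)&=\tfrac12\int_0^\infty\!\!\int_0^\infty xy\,H_q(x+y,L_1)\,V^q_{g-1,n+1}(x,y,L_S)\,\mathrm dx\,\mathrm dy\\&+\tfrac12\sum_{\substack{g_1+g_2=g\\I\sqcup J=S}}\int_0^\infty\!\!\int_0^\infty xy\,H_q(x+y,L_1)\,V^q_{g_1,|I|+1}(x,L_I)\,V^q_{g_2,|J|+1}(y,L_J)\,\mathrm dx\,\mathrm dy\\&+\tfrac12\sum_{k=2}^n\int_0^\infty x\big[H_q(x,L_1+L_k)+H_q(x,L_1-L_k)\big]V^q_{g,n-1}(x,L_{S\setminus\{k\}})\,\mathrm dx\end{aligned}$$ (the first term is absent for $g=0$; $V^q_{g,n}$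 is the solution regular at $L_1=0$) with $$H_q(x,y)=\tfrac12\sum_{m\ge1}(-1)^{m-1}q^{m^2/2}(q^{m/2}+q^{-m/2})\Big(e^{\frac12(x+y)(q^{m/2}-q^{-m/2})}+e^{\frac12(x-y)(q^{m/2}-q^{-m/2})}\Big),$$ understood as a series in $y^2$, integrated term by term. *Degree.* In polynomials over $\mathbb Q$ in formal variables $b_1^2,\dots,b_n^2$ and $\zeta_q(2),\zeta_q(4),\dots$, put $\deg b_i^2=2$ and $\deg\zeta_q(2k)=2k$. *Claim.* Let $g\ge0$, $n\ge1$, $(g,n)\ne(0,1),(0,2)$. There are such polynomials $T$ and $R_\varepsilon$ ($\varepsilon\in(\mathbb Z/2)^n$), depending only on $g,n$ and not on $q$, where $T$ is homogeneous of degree $6g-6+2n$ and every monomial of every $R_\varepsilon$ has degree less than $6g-6+2n$, such that for every $0<q<1$: * $V^q_{g,n}(L_1,\dots,L_n)$ is the value of $T$ at $(L_1^2,\dots,L_n^2;\zeta_q(2),\zeta_q(4),\dots)$ for all real $L_i$; * for all positive integers $b_1,\dots,b_n$ with $b_1+\cdots+b_n$ even and parities $\varepsilon$, $$N^q_{g,n}(b_1,\dots,b_n)=2^{3-2g-n}\,V^q_{g,n}(b_1,\dots,b_n)+R_\varepsilon\big(b_1^2,\dots,b_n^2;\zeta_q(2),\zeta_q(4),\dots\big);$$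 * $N^q_{g,n}(b_1,\dots,b_n)=0$ if $b_1+\cdots+b_n$ is odd. In particular the top-degree part of the quasi-polynomial $N^q_{g,n}$, on the tuples with $b_1+\cdots+b_n$ even, is the genuine polynomial $2^{3-2g-n}V^q_{g,n}$, the same for all parity classes. -/

import Mathlib

open Filter Topology MeasureTheory
open scoped Real

/-! ### Topological recursion on a rational spectral curve -/

/-- The residue at `α` of the differential `f(p) dp`, for `f` holomorphic in a punctured
neighbourhood of `α`: the common value of `(1/2πi) ∮ f(p) dp` over small circles around `α`. -/
noncomputable def residueAt (f : ℂ → ℂ) (α : ℂ) : ℂ :=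
  limUnder (𝓝[>] (0 : ℝ)) fun r : ℝ => (2 * (π : ℂ) * Complex.I)⁻¹ * ∮ p in C(α, r), f p

/-- The subtuple `z_I` of `z`, for a set `I` of indices, listed in increasing order. -/
def subtuple {A : Type*} {n : ℕ} (z : Fin n → A) (I : Finset (Fin n)) : Fin I.card → A :=
  fun i => z (I.orderEmbOfFin rfl i)

/-- The recursion kernel of the curve with functions `x`, `y`, local involution `σ` and
`ω_{0,2}(z₁, z₂) = dz₁ dz₂ / (z₁ - z₂)²`, as a coefficient of `dz₁ / dp`:
`(1/2) (∫_p^{σ(p)} ω_{0,2}(z₁, ·)) / (ω_{0,1}(p) - ω_{0,1}(σ(p)))`.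
The integral is `1 / (z₁ - σ(p)) - 1 / (z₁ - p)`, and `ω_{0,1}(σ(p)) = y(σ(p)) dx(p)`, because
`x ∘ σ = x`. -/
noncomputable def recursionKernel (x y σ : ℂ → ℂ) (z₁ p : ℂ) : ℂ :=
  1 / 2 * (1 / (z₁ - σ p) - 1 / (z₁ - p)) / ((y p - y (σ p)) * deriv x p)

/-- The correlation differentials of the topological recursion on the rational spectral curve with
functions `x`, `y`, set of branch points `branch`, and the involution `σ` (which serves at each
branch point). The value is the coefficient of `dz₁ ⋯ dzₙ` in `ω_{g,n}(z₁, …, zₙ)`; the factor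
`deriv σ p` comes from `d(σ(p)) = σ'(p) dp`. There is no differential for `n = 0`. The inner sum
runs over `g₁ + g₂ = g` and `I ⊔ J = S`, without the terms that involve `ω_{0,1}`. -/
noncomputable def correlator (x y σ : ℂ → ℂ) (branch : Finset ℂ) :
    (g n : ℕ) → (Fin n → ℂ) → ℂ
  | _, 0, _ => 0
  | g, n + 1, z =>
    if g = 0 ∧ n = 0 then y (z 0) * deriv x (z 0)
    else if g = 0 ∧ n = 1 then 1 / (z 0 - z (Fin.last n)) ^ 2
    else ∑ α ∈ branch, residueAt (fun p =>
      recursionKernel x y σ (z 0) p * deriv σ p *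
        ((if _h : 0 < g then
            correlator x y σ branch (g - 1) (n + 2) (Fin.cons p (Fin.cons (σ p) (Fin.tail z)))
          else 0) +
        ∑ g₁ : Fin (g + 1), ∑ I : Finset (Fin n),
          if _h : (g₁.1 = 0 ∧ I = ∅) ∨ (g₁.1 = g ∧ I = Finset.univ) then 0
          else
            correlator x y σ branch g₁.1 (I.card + 1) (Fin.cons p (subtuple (Fin.tail z) I)) *
            correlator x y σ branch (g - g₁.1) (Iᶜ.card + 1)
              (Fin.cons (σ p) (subtuple (Fin.tail z) Iᶜ)))) α
termination_by g n => (g, n)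
decreasing_by
  · exact Prod.Lex.left _ _ (by omega)
  · rcases Nat.lt_or_ge g₁.1 g with h | h
    · exact Prod.Lex.left _ _ h
    · have hg : g₁.1 = g := by omega
      have hI : I ≠ Finset.univ := fun hI => _h (Or.inr ⟨hg, hI⟩)
      have := (Finset.card_lt_iff_ne_univ I).2 hI
      rw [Fintype.card_fin] at this
      rw [hg]
      exact Prod.Lex.right _ (by omega)
  · rcases Nat.eq_zero_or_pos g₁.1 with h | h
    · have hI : I ≠ ∅ := fun hI => _h (Or.inl ⟨h, hI⟩)
      have := (Finset.card_lt_iff_ne_univ Iᶜ).2 (by simpa using hI)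
      rw [Fintype.card_fin] at this
      rw [h, Nat.sub_zero]
      exact Prod.Lex.right _ (by omega)
    · exact Prod.Lex.left _ _ (by omega)

/-! ### Okuyama's spectral curve and discrete volumes -/

/-- `x(z) = z + z⁻¹`. Its differential vanishes exactly at `z = 1` and `z = -1`, and its
involution is `z ↦ z⁻¹`. -/
noncomputable def okuyamaX (z : ℂ) : ℂ := z + z⁻¹

/-- `y(z) = (1/2) (z - z⁻¹) ∏_{k ≥ 1} (1 - q^k z²) (1 - q^k z⁻²) / (1 - q^k)²`. -/
noncomputable def okuyamaY (q : ℝ) (z : ℂ) : ℂ :=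
  1 / 2 * (z - z⁻¹) *
    ∏' k : ℕ, (1 - (q : ℂ) ^ (k + 1) * z ^ 2) * (1 - (q : ℂ) ^ (k + 1) * (z⁻¹) ^ 2) /
      (1 - (q : ℂ) ^ (k + 1)) ^ 2

/-- The correlation differentials `ω_{g,n}` of Okuyama's spectral curve. -/
noncomputable def okuyamaCorrelator (q : ℝ) (g n : ℕ) (z : Fin n → ℂ) : ℂ :=
  correlator okuyamaX (okuyamaY q) (fun z => z⁻¹) {1, -1} g n z

/-- The coefficient of `∏ zᵢ ^ (k i)` in the Taylor expansion of `f` at `0`, by expanding in the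
last variables first. -/
noncomputable def taylorCoeff : (n : ℕ) → ((Fin n → ℂ) → ℂ) → (Fin n → ℕ) → ℂ
  | 0, f, _ => f Fin.elim0
  | n + 1, f, k =>
    iteratedDeriv (k 0) (fun t => taylorCoeff n (fun w => f (Fin.cons t w)) (Fin.tail k)) 0 /
      ((k 0).factorial : ℂ)

/-- Okuyama's discrete volume `N^q_{g,n}(b₁, …, bₙ)`, for positive integers `bᵢ`: the numbers with
`ω_{g,n} = ∑_{b₁, …, bₙ ≥ 1} N^q_{g,n}(b₁, …, bₙ) ∏ bᵢ zᵢ^(bᵢ - 1) dzᵢ` near `z = 0`. -/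
noncomputable def discreteVolume (q : ℝ) (g n : ℕ) (b : Fin n → ℕ) : ℂ :=
  taylorCoeff n (okuyamaCorrelator q g n) (fun i => b i - 1) / ∏ i, (b i : ℂ)

/-! ### The `q`-deformed Weil–Petersson volumes -/

/-- The `q`-zeta value `ζ_q(s) = ∑_{m ≥ 1} q^(ms/2) / (1 - q^m)^s`. -/
noncomputable def qZeta (q : ℝ) (s : ℕ) : ℝ :=
  ∑' m : ℕ, q ^ (((m : ℝ) + 1) * s / 2) / (1 - q ^ (m + 1)) ^ s

/-- `q^(m/2) - q^(-m/2)`. -/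
noncomputable def qDiff (q : ℝ) (m : ℕ) : ℝ := q ^ ((m : ℝ) / 2) - q ^ (-(m : ℝ) / 2)

/-- `(-1)^(m-1) q^(m²/2) (q^(m/2) + q^(-m/2))`, for `m ≥ 1`. -/
noncomputable def qWeight (q : ℝ) (m : ℕ) : ℝ :=
  (-1) ^ (m - 1) * q ^ ((m : ℝ) ^ 2 / 2) * (q ^ ((m : ℝ) / 2) + q ^ (-(m : ℝ) / 2))

/-- The `m`-th summand, `m ≥ 1`, of the kernel
`H_q(x, y) = (1/2) ∑_{m ≥ 1} (-1)^(m-1) q^(m²/2) (q^(m/2) + q^(-m/2))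
  (exp((x + y)(q^(m/2) - q^(-m/2))/2) + exp((x - y)(q^(m/2) - q^(-m/2))/2))`. -/
noncomputable def qKernelTerm (q : ℝ) (m : ℕ) (x y : ℝ) : ℝ :=
  1 / 2 * (qWeight q m *
    (Real.exp (1 / 2 * (x + y) * qDiff q m) + Real.exp (1 / 2 * (x - y) * qDiff q m)))

/-- The coefficient of `y^(2j)` in the `m`-th summand of `H_q(x, y)`, see `hasSum_qKernelTerm`. -/
noncomputable def qKernelTermCoeff (q : ℝ) (m j : ℕ) (x : ℝ) : ℝ :=
  qWeight q m * Real.exp (1 / 2 * x * qDiff q m) *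
    ((qDiff q m / 2) ^ (2 * j) / ((2 * j).factorial : ℝ))

theorem hasSum_qKernelTerm (q : ℝ) (m : ℕ) (x y : ℝ) :
    HasSum (fun j => qKernelTermCoeff q m j x * y ^ (2 * j)) (qKernelTerm q m x y) := by
  have h := (Real.hasSum_cosh (qDiff q m / 2 * y)).mul_left
    (qWeight q m * Real.exp (1 / 2 * x * qDiff q m))
  have e : qKernelTerm q m x y =
      qWeight q m * Real.exp (1 / 2 * x * qDiff q m) * Real.cosh (qDiff q m / 2 * y) := by
    rw [Real.cosh_eq, qKernelTerm,
      show 1 / 2 * (x + y) * qDiff q m = 1 / 2 * x * qDiff q m + qDiff q m / 2 * y by ring,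
      show 1 / 2 * (x - y) * qDiff q m = 1 / 2 * x * qDiff q m + -(qDiff q m / 2 * y) by ring,
      Real.exp_add, Real.exp_add]
    ring
  rw [e]
  refine h.congr_fun ?_
  intro j
  rw [qKernelTermCoeff, mul_pow]
  ring

/-- The coefficient of `y^(2j)` in `H_q(x, y)`, understood as a series in `y²`. -/
noncomputable def qKernelCoeff (q : ℝ) (j : ℕ) (x : ℝ) : ℝ :=
  ∑' m : ℕ, qKernelTermCoeff q (m + 1) j x

/-- `∫_0^∞ f(x) H_q(x, t) dx`, where `H_q(x, t)` is understood as a series in `t²`. -/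
noncomputable def qKernelIntegral (q : ℝ) (f : ℝ → ℝ) (t : ℝ) : ℝ :=
  ∑' j : ℕ, (∫ x in Set.Ioi (0 : ℝ), f x * qKernelCoeff q j x) * t ^ (2 * j)

/-- `∫_0^∞ ∫_0^∞ f(x, y) H_q(x + y, t) dx dy`, where `H_q(x + y, t)` is understood as a series
in `t²`. -/
noncomputable def qKernelIntegral₂ (q : ℝ) (f : ℝ → ℝ → ℝ) (t : ℝ) : ℝ :=
  ∑' j : ℕ, (∫ x in Set.Ioi (0 : ℝ), ∫ y in Set.Ioi (0 : ℝ), f x y * qKernelCoeff q j (x + y)) *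
    t ^ (2 * j)

/-- The `q`-deformed Weil–Petersson volumes `V^q_{g,n}(L₁, …, Lₙ)`, defined for `n ≥ 1` by
Mirzakhani's recursion with the kernel `H_q`. The initial values are `V_{0,1} = V_{0,2} = 0`,
`V_{0,3} = 1`, `V_{1,1} = L₁²/48 + ζ_q(2)/2`. The recursion reads `∂/∂L₁ (L₁ V) = R(L₁)`, and its
solution `V = (1/L₁) ∫_0^{L₁} R(t) dt` is written here as `∫_0^1 R(s L₁) ds`, which makes sense at
`L₁ = 0` too. The terms of the middle sum that contain `V_{0,1} = 0` are left out. -/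
noncomputable def qVolume (q : ℝ) : (g n : ℕ) → (Fin n → ℝ) → ℝ
  | _, 0, _ => 0
  | g, n + 1, L =>
    if g = 0 ∧ n ≤ 1 then 0
    else if g = 0 ∧ n = 2 then 1
    else if g = 1 ∧ n = 0 then 1 / 48 * L 0 ^ 2 + 1 / 2 * qZeta q 2
    else ∫ s in (0 : ℝ)..1,
      (1 / 2 * (if _h : 0 < g then
          qKernelIntegral₂ q (fun x y => x * y *
            qVolume q (g - 1) (n + 2) (Fin.cons x (Fin.cons y (Fin.tail L)))) (s * L 0)
        else 0) +
      1 / 2 * (∑ g₁ : Fin (g + 1), ∑ I : Finset (Fin n),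
        if _h : (g₁.1 = 0 ∧ I = ∅) ∨ (g₁.1 = g ∧ I = Finset.univ) then 0
        else
          qKernelIntegral₂ q (fun x y => x * y *
            (qVolume q g₁.1 (I.card + 1) (Fin.cons x (subtuple (Fin.tail L) I)) *
            qVolume q (g - g₁.1) (Iᶜ.card + 1) (Fin.cons y (subtuple (Fin.tail L) Iᶜ))))
            (s * L 0)) +
      1 / 2 * ∑ k : Fin n,
        (qKernelIntegral q (fun x => x * qVolume q g ((Finset.univ.erase k).card + 1)
            (Fin.cons x (subtuple (Fin.tail L) (Finset.univ.erase k)))) (s * L 0 + Fin.tail L k) +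
          qKernelIntegral q (fun x => x * qVolume q g ((Finset.univ.erase k).card + 1)
            (Fin.cons x (subtuple (Fin.tail L) (Finset.univ.erase k)))) (s * L 0 - Fin.tail L k)))
termination_by g n => (g, n)
decreasing_by
  · exact Prod.Lex.left _ _ (by omega)
  · rcases Nat.lt_or_ge g₁.1 g with h | h
    · exact Prod.Lex.left _ _ h
    · have hg : g₁.1 = g := by omega
      have hI : I ≠ Finset.univ := fun hI => _h (Or.inr ⟨hg, hI⟩)
      have := (Finset.card_lt_iff_ne_univ I).2 hI
      rw [Fintype.card_fin] at this
      rw [hg]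
      exact Prod.Lex.right _ (by omega)
  · rcases Nat.eq_zero_or_pos g₁.1 with h | h
    · have hI : I ≠ ∅ := fun hI => _h (Or.inl ⟨h, hI⟩)
      have := (Finset.card_lt_iff_ne_univ Iᶜ).2 (by simpa using hI)
      rw [Fintype.card_fin] at this
      rw [h, Nat.sub_zero]
      exact Prod.Lex.right _ (by omega)
    · exact Prod.Lex.left _ _ (by omega)
  all_goals
    have h : (Finset.univ.erase k).card < n := by
      have h1 := Finset.card_erase_lt_of_mem (Finset.mem_univ k)
      rwa [Finset.card_univ, Fintype.card_fin] at h1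
    exact Prod.Lex.right _ (by omega)

/-! ### Polynomials in `b₁², …, bₙ²` and `ζ_q(2), ζ_q(4), …`, and their degree -/

/-- Polynomials with rational coefficients in formal variables for `b₁², …, bₙ²` (`Sum.inl i`) and
for `ζ_q(2), ζ_q(4), …` (`Sum.inr k` stands for `ζ_q(2k + 2)`). -/
abbrev ZetaPoly (n : ℕ) : Type := MvPolynomial (Fin n ⊕ ℕ) ℚ

/-- The degrees of the variables: `deg bᵢ² = 2` and `deg ζ_q(2k + 2) = 2k + 2`. -/
def zetaDegree (n : ℕ) : Fin n ⊕ ℕ → ℕ := Sum.elim (fun _ => 2) (fun k => 2 * k + 2)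

/-- The value of a polynomial at real numbers `bᵢ` and at the actual `q`-zeta values. -/
noncomputable def ZetaPoly.value {n : ℕ} (P : ZetaPoly n) (q : ℝ) (b : Fin n → ℝ) : ℝ :=
  MvPolynomial.aeval (Sum.elim (fun i => b i ^ 2) (fun k => qZeta q (2 * k + 2))) P

/-- All monomials of `P` have degree less than `d`. -/
def ZetaPoly.DegreeLT {n : ℕ} (P : ZetaPoly n) (d : ℕ) : Prop :=
  ∀ m ∈ P.support, Finsupp.weight (zetaDegree n) m < d

/-!
The topological recursion and Mirzakhani's recursion become, on coefficients, two recursions over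
the polynomial ring `ZetaRing` in the `q`-zeta values, and these agree in top degree.

Put `a_m = q^m / (1 - q^m)²`. The power sums of the `a_m` are the values `ζ_q(2k)`, and
`y(z) = (1/2) (z - z⁻¹) ∏ (1 - a_m (z - z⁻¹)²)`. The partial fraction expansion
`∏ (1 - a_m u)⁻¹ = ∑ w_m / (1 - a_m u)` has as its coefficients exactly the weights `w_m` of the
kernel `H_q` (`tendsto_lagrangeZero`, `invProd_mul_tprod`). So the moments `∑ w_m a_m^j` are the
complete symmetric functions `h_j` of the `a_m`, polynomials in the `q`-zeta values by Newton's
identities (`zetaEval_completeSymm`), while `∑ w_m a_m^(-j) = 0` for `j > 0`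
(`tsum_qWeight_mul_qNode_pow`). Hence the integral of `x^(2k+1) H_q(x, t)` is a polynomial in `t²`
with coefficients multiples of `h_j`, and Mirzakhani's recursion acts on even polynomials
(`qVolume_eq_multiSum_volumeStep`).

On the other side, the `ω_{g,n}` are combinations of products of the differentials
`η_{ε,k} = ∑_{b ≡ ε} b^(2k+1) z^(b-1) dz`, with `b` of parity `ε` (`etaBasis`). At the branch point
`α = ±1`, in the coordinate `p = α e^t`, the operator `p d/dp` is `d/dt`, the factor of the recursion
kernel that depends on `z₁` expands in the `η_{ε,i}(z₁)`, and the denominator of the kernel is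
inverted by `∏ (1 - 4 a_m (sinh t)²)⁻¹ = ∑ h_j (4 (sinh t)²)^j` (`eventually_recursionKernel_eq`).
The residues are therefore explicit polynomials in the `h_j` (`isResidue_pair`,
`isResidue_single`, `okuyamaCorrelator_eq_multiSum_etaStep`).

In top degree, `sinh t` may be replaced by `t`, and `η_{ε,k}` by its leading term at the branch
point, which does not depend on `ε`. What remains is Mirzakhani's recursion, except for the sums over
branch points and over parities of the inner indices; these produce the factor `2^(3-2g-n)` for even
total parity, and `0` for odd total parity (`hasVolumeTop_step`). Induction on `2g + n`, starting
from the types `(0, 3)` and `(1, 1)`, gives expansions with coefficients independent of `q`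
(`exists_hasExpansion`). The Taylor coefficients of the `η_{ε,k}` at `0` turn the expansion of
`ω_{g,n}` into one of the discrete volume in powers of the `bᵢ²`
(`HasExpansion.discreteVolume_eq`).
-/

/-! ### Partial fractions at the nodes `(q^(m/2) - q^(-m/2))²` -/

/-- The node `x_m = (q^((m+1)/2) - q^(-(m+1)/2))²`, with `m` counted from `0`; its inverse is the
number `q^(m+1) / (1 - q^(m+1))²` whose power sums are the `q`-zeta values. -/
noncomputable def qNode (q : ℝ) (m : ℕ) : ℝ := qDiff q (m + 1) ^ 2

theorem qNode_eq {q : ℝ} (hq : 0 < q) (m : ℕ) :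
    qNode q m = (1 - q ^ (m + 1)) ^ 2 / q ^ (m + 1) := by
  have h1 : (q ^ (((m + 1 : ℕ) : ℝ) / 2)) ^ 2 = q ^ (m + 1) := by
    rw [← Real.rpow_natCast, ← Real.rpow_mul hq.le, ← Real.rpow_natCast]
    congr 1; push_cast; ring
  have h2 : q ^ (-((m + 1 : ℕ) : ℝ) / 2) = (q ^ (((m + 1 : ℕ) : ℝ) / 2))⁻¹ := by
    rw [← Real.rpow_neg hq.le]; congr 1; ring
  have h3 : 0 < q ^ (((m + 1 : ℕ) : ℝ) / 2) := Real.rpow_pos_of_pos hq _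
  rw [qNode, qDiff, h2, ← h1]
  field_simp
  ring

theorem qNode_pos {q : ℝ} (hq : 0 < q) (hq1 : q < 1) (m : ℕ) : 0 < qNode q m := by
  rw [qNode_eq hq]
  have : q ^ (m + 1) < 1 := pow_lt_one₀ hq.le hq1 (by omega)
  have h2 : 0 < q ^ (m + 1) := by positivity
  have : 0 < 1 - q ^ (m + 1) := by linarith
  positivity

theorem qNode_sub_qNode {q : ℝ} (hq : 0 < q) (k d : ℕ) :
    qNode q k - qNode q (k + d) =
      -((1 - q ^ d) * (1 - q ^ (2 * k + d + 2)) / q ^ (k + d + 1)) := by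
  rw [qNode_eq hq, qNode_eq hq]
  have : q ≠ 0 := hq.ne'
  field_simp
  ring

theorem qNode_strictMono {q : ℝ} (hq : 0 < q) (hq1 : q < 1) : StrictMono (qNode q) := by
  refine strictMono_nat_of_lt_succ fun n => ?_
  have h := qNode_sub_qNode hq n 1
  have h1 : q ^ (2 * n + 1 + 2) < 1 := pow_lt_one₀ hq.le hq1 (by omega)
  have : 0 < (1 - q ^ 1) * (1 - q ^ (2 * n + 1 + 2)) / q ^ (n + 1 + 1) :=
    div_pos (mul_pos (by rw [pow_one]; linarith) (by linarith)) (by positivity)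
  linarith

theorem qWeight_eq {q : ℝ} (hq : 0 < q) (m : ℕ) :
    qWeight q (m + 1) = (-1) ^ m * q ^ (m * (m + 1) / 2) * (1 + q ^ (m + 1)) := by
  have h2 : ((m * (m + 1) / 2 : ℕ) : ℝ) = (m * (m + 1) : ℝ) / 2 := by
    rw [Nat.cast_div (Nat.even_mul_succ_self m).two_dvd (by norm_num)]; push_cast; ring
  rw [qWeight, Nat.add_sub_cancel, mul_assoc, mul_assoc, mul_add, mul_add, ← Real.rpow_add hq,
    ← Real.rpow_add hq, ← mul_add, mul_add (q ^ (m * (m + 1) / 2)), mul_one, ← pow_add,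
    ← Real.rpow_natCast q (m * (m + 1) / 2),
    ← Real.rpow_natCast q (m * (m + 1) / 2 + (m + 1)), Nat.cast_add (m * (m + 1) / 2), h2, add_comm]
  congr 3 <;> (push_cast; ring)

/-- `∏_{i=1}^n (1 - q^i)`. -/
noncomputable def qPoch (q : ℝ) (n : ℕ) : ℝ := ∏ i ∈ Finset.range n, (1 - q ^ (i + 1))

theorem one_sub_qpow_pos {q : ℝ} (hq : 0 < q) (hq1 : q < 1) {n : ℕ} (hn : n ≠ 0) :
    0 < 1 - q ^ n := sub_pos.2 (pow_lt_one₀ hq.le hq1 hn)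

theorem qPoch_pos {q : ℝ} (hq : 0 < q) (hq1 : q < 1) (n : ℕ) : 0 < qPoch q n :=
  Finset.prod_pos fun i _ => one_sub_qpow_pos hq hq1 (by omega)

/-- The value at `0` of the Lagrange basis polynomial of the node `x_m` for the nodes
`x_0, …, x_(N-1)`. -/
noncomputable def lagrangeZero (q : ℝ) (N m : ℕ) : ℝ :=
  ∏ k ∈ (Finset.range N).erase m, qNode q k / (qNode q k - qNode q m)

/-- The value for the first set of nodes that contains `x_m`; the general case follows by adding one
node at a time. -/
theorem lagrangeZero_self {q : ℝ} (hq : 0 < q) (hq1 : q < 1) (m : ℕ) :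
    lagrangeZero q (m + 1) m =
      qWeight q (m + 1) * (qPoch q (m + 1) ^ 2 / (qPoch q 0 * qPoch q (2 * m + 2))) := by
  have e1 : (Finset.range (m + 1)).erase m = Finset.range m := by
    rw [Finset.range_add_one, Finset.erase_insert Finset.notMem_range_self]
  have e2 : ∀ k ∈ Finset.range m, qNode q k / (qNode q k - qNode q m) =
      (-1) * (1 - q ^ (k + 1)) * (1 - q ^ (k + 1)) * q ^ (m + 1) /
        (q ^ (k + 1) * (1 - q ^ (m - 1 - k + 1)) * (1 - q ^ (m + 1 + k + 1))) := by
    intro k hk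
    obtain ⟨d, rfl⟩ := Nat.exists_eq_add_of_lt (Finset.mem_range.1 hk)
    have h := qNode_sub_qNode hq k (d + 1)
    rw [show k + d + 1 = k + (d + 1) by ring, h, qNode_eq hq,
      show k + (d + 1) - 1 - k + 1 = d + 1 by omega,
      show k + (d + 1) + 1 + k + 1 = 2 * k + (d + 1) + 2 by ring]
    have := (one_sub_qpow_pos hq hq1 (Nat.succ_ne_zero d)).ne'
    have := (one_sub_qpow_pos hq hq1 (show 2 * k + (d + 1) + 2 ≠ 0 by omega)).ne'
    simp only [Nat.succ_eq_add_one] at *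
    field_simp
  have e3 : ∏ k ∈ Finset.range m, q ^ (k + 1) = q ^ (m * (m + 1) / 2) := by
    rw [Finset.prod_pow_eq_pow_sum]
    congr 1
    have := Finset.sum_range_succ' (fun i => i) m
    rw [add_zero] at this
    rw [← this, Finset.sum_range_id, Nat.add_sub_cancel, mul_comm]
  have e4 : ∏ k ∈ Finset.range m, (1 - q ^ (m - 1 - k + 1)) = qPoch q m :=
    Finset.prod_range_reflect (fun i => 1 - q ^ (i + 1)) m
  have e5 : qPoch q (m + 1) * ∏ k ∈ Finset.range m, (1 - q ^ (m + 1 + k + 1)) =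
      qPoch q (2 * m + 1) := by
    rw [show 2 * m + 1 = m + 1 + m by ring]
    exact (Finset.prod_range_add _ _ _).symm
  have e6 : q ^ ((m + 1) * m) = q ^ (m * (m + 1) / 2) * q ^ (m * (m + 1) / 2) := by
    rw [← pow_add]; congr 1
    have := Nat.div_mul_cancel (Nat.even_mul_succ_self m).two_dvd
    nlinarith
  have e7 : qPoch q (2 * m + 2) = qPoch q (2 * m + 1) * ((1 - q ^ (m + 1)) * (1 + q ^ (m + 1))) := by
    rw [qPoch, Finset.prod_range_succ, ← qPoch]; ring
  have e8 : qPoch q (m + 1) = qPoch q m * (1 - q ^ (m + 1)) := Finset.prod_range_succ _ _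
  have e0 : qPoch q 0 = 1 := Finset.prod_range_zero _
  rw [lagrangeZero, e1, Finset.prod_congr rfl e2, Finset.prod_div_distrib]
  simp only [Finset.prod_mul_distrib, Finset.prod_const, Finset.card_range]
  rw [e3, e4, ← pow_mul, e6, e7, e8, ← e5, qWeight_eq hq, e0, e8]
  have h1 := (qPoch_pos hq hq1 m).ne'
  have h2 := (one_sub_qpow_pos hq hq1 (Nat.succ_ne_zero m)).ne'
  have h3 : (∏ k ∈ Finset.range m, (1 - q ^ (m + 1 + k + 1))) ≠ 0 := by
    refine Finset.prod_ne_zero_iff.2 fun k _ => (one_sub_qpow_pos hq hq1 (by omega)).ne'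
  have h4 : ∏ i ∈ Finset.range m, (1 - q ^ (i + 1)) = qPoch q m := rfl
  have h5 : 1 + q ^ (m + 1) ≠ 0 := by positivity
  rw [h4]
  simp only [Nat.succ_eq_add_one] at *
  field_simp

theorem lagrangeZero_eq {q : ℝ} (hq : 0 < q) (hq1 : q < 1) (m n : ℕ) :
    lagrangeZero q (m + 1 + n) m =
      qWeight q (m + 1) * (qPoch q (m + 1 + n) ^ 2 / (qPoch q n * qPoch q (2 * m + 2 + n))) := by
  induction n with
  | zero => exact lagrangeZero_self hq hq1 m
  | succ n ih =>
    have e1 : (Finset.range (m + 1 + (n + 1))).erase m =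
        insert (m + 1 + n) ((Finset.range (m + 1 + n)).erase m) := by
      rw [← add_assoc, Finset.range_add_one, Finset.erase_insert_of_ne (by omega)]
    have h := qNode_sub_qNode hq m (n + 1)
    have h' : qNode q (m + 1 + n) - qNode q m =
        (1 - q ^ (n + 1)) * (1 - q ^ (2 * m + (n + 1) + 2)) / q ^ (m + (n + 1) + 1) := by
      rw [show m + 1 + n = m + (n + 1) by ring]; linarith
    rw [lagrangeZero, e1, Finset.prod_insert (by simp), ← lagrangeZero, ih, h', qNode_eq hq]
    have e2 : qPoch q (m + 1 + (n + 1)) = qPoch q (m + 1 + n) * (1 - q ^ (m + 1 + n + 1)) :=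
      Finset.prod_range_succ _ _
    have e3 : qPoch q (2 * m + 2 + (n + 1)) =
        qPoch q (2 * m + 2 + n) * (1 - q ^ (2 * m + 2 + n + 1)) := Finset.prod_range_succ _ _
    have e4 : qPoch q (n + 1) = qPoch q n * (1 - q ^ (n + 1)) := Finset.prod_range_succ _ _
    rw [e2, e3, e4, show 2 * m + (n + 1) + 2 = 2 * m + 2 + n + 1 by ring,
      show m + (n + 1) + 1 = m + 1 + n + 1 by ring]
    have := (one_sub_qpow_pos hq hq1 (Nat.succ_ne_zero n)).ne'
    have := (one_sub_qpow_pos hq hq1 (show 2 * m + 2 + n + 1 ≠ 0 by omega)).ne'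
    have := (qPoch_pos hq hq1 (2 * m + 2 + n)).ne'
    have := (qPoch_pos hq hq1 n).ne'
    simp only [Nat.succ_eq_add_one] at *
    field_simp

/-- Each factor of the product is at most `1` and tends to `1` as `n` grows, so that `qWeight` is
both a bound and the limit. -/
theorem lagrangeZero_eq_prod {q : ℝ} (hq : 0 < q) (hq1 : q < 1) (m n : ℕ) :
    lagrangeZero q (m + 1 + n) m = qWeight q (m + 1) *
      ∏ i ∈ Finset.range (m + 1), (1 - q ^ (n + i + 1)) / (1 - q ^ (m + 1 + n + i + 1)) := by
  rw [lagrangeZero_eq hq hq1, Finset.prod_div_distrib]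
  have e1 : qPoch q (m + 1 + n) =
      qPoch q n * ∏ i ∈ Finset.range (m + 1), (1 - q ^ (n + i + 1)) := by
    rw [add_comm]; exact Finset.prod_range_add _ _ _
  have e2 : qPoch q (2 * m + 2 + n) =
      qPoch q (m + 1 + n) * ∏ i ∈ Finset.range (m + 1), (1 - q ^ (m + 1 + n + i + 1)) := by
    rw [show 2 * m + 2 + n = m + 1 + n + (m + 1) by ring]; exact Finset.prod_range_add _ _ _
  have h1 := (qPoch_pos hq hq1 n).ne'
  have h2 := (qPoch_pos hq hq1 (m + 1 + n)).ne'
  have h3 : (∏ i ∈ Finset.range (m + 1), (1 - q ^ (m + 1 + n + i + 1))) ≠ 0 :=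
    Finset.prod_ne_zero_iff.2 fun k _ => (one_sub_qpow_pos hq hq1 (by omega)).ne'
  rw [e2, sq, mul_div_mul_comm]
  nth_rewrite 1 [e1]
  field_simp

theorem abs_lagrangeZero_le {q : ℝ} (hq : 0 < q) (hq1 : q < 1) {m N : ℕ} (h : m < N) :
    |lagrangeZero q N m| ≤ |qWeight q (m + 1)| := by
  obtain ⟨n, rfl⟩ := Nat.exists_eq_add_of_le (Nat.succ_le_of_lt h)
  rw [Nat.succ_eq_add_one, lagrangeZero_eq_prod hq hq1, abs_mul]
  refine mul_le_of_le_one_right (abs_nonneg _) ?_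
  rw [Finset.abs_prod]
  refine Finset.prod_le_one (fun _ _ => abs_nonneg _) fun i _ => ?_
  have h1 := one_sub_qpow_pos hq hq1 (show n + i + 1 ≠ 0 by omega)
  have h2 := one_sub_qpow_pos hq hq1 (show m + 1 + n + i + 1 ≠ 0 by omega)
  rw [abs_of_pos (div_pos h1 h2), div_le_one h2]
  have : q ^ (m + 1 + n + i + 1) ≤ q ^ (n + i + 1) :=
    pow_le_pow_of_le_one hq.le hq1.le (by omega)
  linarith

theorem tendsto_lagrangeZero {q : ℝ} (hq : 0 < q) (hq1 : q < 1) (m : ℕ) :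
    Tendsto (fun N => lagrangeZero q N m) atTop (𝓝 (qWeight q (m + 1))) := by
  rw [← tendsto_add_atTop_iff_nat (m + 1)]
  have h0 : ∀ c : ℕ, Tendsto (fun n : ℕ => 1 - q ^ (n + c)) atTop (𝓝 (1 - 0)) := fun c =>
    tendsto_const_nhds.sub
      ((tendsto_add_atTop_iff_nat c).2 (tendsto_pow_atTop_nhds_zero_of_lt_one hq.le hq1))
  have h : Tendsto (fun n => qWeight q (m + 1) *
      ∏ i ∈ Finset.range (m + 1), (1 - q ^ (n + i + 1)) / (1 - q ^ (m + 1 + n + i + 1)))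
      atTop (𝓝 (qWeight q (m + 1) * ∏ i ∈ Finset.range (m + 1), ((1 - 0) / (1 - 0)))) := by
    refine tendsto_const_nhds.mul (tendsto_finsetProd _ fun i _ => ?_)
    refine Tendsto.div ?_ ?_ (by norm_num)
    · simpa only [add_assoc] using h0 (i + 1)
    · refine (h0 (m + 1 + i + 1)).congr fun n => ?_
      rw [show n + (m + 1 + i + 1) = m + 1 + n + i + 1 by ring]
  simp only [sub_zero, div_one, Finset.prod_const_one, mul_one] at h
  refine h.congr fun n => ?_
  rw [add_comm n, lagrangeZero_eq_prod hq hq1]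

/-- The factor `q^(m²/2)` of the weight beats every power of the nodes. -/
theorem summable_abs_qWeight_mul_qNode_pow {q : ℝ} (hq : 0 < q) (hq1 : q < 1) (i : ℕ) :
    Summable fun m => |qWeight q (m + 1)| * qNode q m ^ i := by
  have hs : Summable fun m : ℕ => 2 * (q ^ ((i + 1) ^ 2))⁻¹ * (q ^ i)⁻¹ * q ^ m :=
    (summable_geometric_of_lt_one hq.le hq1).mul_left _
  refine Summable.of_nonneg_of_le
    (fun m => mul_nonneg (abs_nonneg _) (pow_nonneg (qNode_pos hq hq1 m).le _)) (fun m => ?_) hs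
  have h1 : |qWeight q (m + 1)| ≤ q ^ (m * (m + 1) / 2) * 2 := by
    rw [qWeight_eq hq, abs_mul, abs_mul, abs_pow, abs_neg, abs_one, one_pow, one_mul,
      abs_of_pos (by positivity), abs_of_pos (by positivity)]
    have : q ^ (m + 1) ≤ 1 := pow_le_one₀ hq.le hq1.le
    gcongr; linarith
  have h2 : qNode q m ≤ (q ^ (m + 1))⁻¹ := by
    rw [qNode_eq hq, div_eq_mul_inv]
    refine mul_le_of_le_one_left (by positivity) ?_
    have : 0 < q ^ (m + 1) := by positivity
    have := one_sub_qpow_pos hq hq1 (Nat.succ_ne_zero m)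
    exact pow_le_one₀ this.le (by linarith)
  have h3 : qNode q m ^ i ≤ ((q ^ (m + 1))⁻¹) ^ i := pow_le_pow_left₀ (qNode_pos hq hq1 m).le h2 i
  have h4 : q ^ (m * (m + 1) / 2) * q ^ ((i + 1) ^ 2) ≤ q ^ ((m + 1) * i) * (q ^ m * (q ^ i)⁻¹) := by
    rw [← div_eq_mul_inv, ← mul_div_assoc, le_div_iff₀ (by positivity), ← pow_add, ← pow_add,
      ← pow_add]
    -- in terms of exponents: `m (i + 1) ≤ m (m + 1) / 2 + (i + 1)²`
    refine pow_le_pow_of_le_one hq.le hq1.le ?_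
    have := Nat.div_mul_cancel (Nat.even_mul_succ_self m).two_dvd
    zify at this ⊢
    nlinarith [sq_nonneg ((m : ℤ) - (i + 1)), sq_nonneg (m : ℤ), sq_nonneg (i : ℤ)]
  calc |qWeight q (m + 1)| * qNode q m ^ i
      ≤ (q ^ (m * (m + 1) / 2) * 2) * ((q ^ (m + 1))⁻¹) ^ i :=
        mul_le_mul h1 h3 (pow_nonneg (qNode_pos hq hq1 m).le _) (by positivity)
    _ = 2 * (q ^ ((m + 1) * i))⁻¹ * (q ^ ((i + 1) ^ 2))⁻¹ *
          (q ^ (m * (m + 1) / 2) * q ^ ((i + 1) ^ 2)) := by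
        rw [inv_pow, ← pow_mul]; field_simp
    _ ≤ 2 * (q ^ ((m + 1) * i))⁻¹ * (q ^ ((i + 1) ^ 2))⁻¹ *
          (q ^ ((m + 1) * i) * (q ^ m * (q ^ i)⁻¹)) := by gcongr
    _ = _ := by field_simp

theorem summable_abs_qWeight {q : ℝ} (hq : 0 < q) (hq1 : q < 1) :
    Summable fun m => |qWeight q (m + 1)| := by
  simpa using summable_abs_qWeight_mul_qNode_pow hq hq1 0

theorem inv_qNode_le {q : ℝ} (hq : 0 < q) (hq1 : q < 1) (m : ℕ) :
    (qNode q m)⁻¹ ≤ (qNode q 0)⁻¹ :=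
  inv_anti₀ (qNode_pos hq hq1 0) ((qNode_strictMono hq hq1).monotone (Nat.zero_le m))

theorem summable_abs_qWeight_mul_inv_pow {q : ℝ} (hq : 0 < q) (hq1 : q < 1) (j : ℕ) :
    Summable fun m => |qWeight q (m + 1)| * ((qNode q m)⁻¹) ^ j := by
  refine Summable.of_nonneg_of_le (fun m => mul_nonneg (abs_nonneg _)
    (pow_nonneg (inv_nonneg.2 (qNode_pos hq hq1 m).le) _)) (fun m => ?_)
    ((summable_abs_qWeight hq hq1).mul_right (((qNode q 0)⁻¹) ^ j))
  have := qNode_pos hq hq1 m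
  have := inv_qNode_le hq hq1 m
  gcongr

/-- Passage to the limit in the finite partial fraction expansions, by dominated convergence. -/
theorem tendsto_sum_lagrangeZero_smul {E : Type*} [NormedAddCommGroup E] [NormedSpace ℝ E]
    [CompleteSpace E] {q : ℝ} (hq : 0 < q) (hq1 : q < 1) {y : ℕ → E}
    (hy : Summable fun m => |qWeight q (m + 1)| * ‖y m‖) :
    Tendsto (fun N => ∑ m ∈ Finset.range N, lagrangeZero q N m • y m) atTop
      (𝓝 (∑' m, qWeight q (m + 1) • y m)) := by
  have h := tendsto_tsum_of_dominated_convergence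
    (f := fun N m => if m < N then lagrangeZero q N m • y m else 0)
    (g := fun m => qWeight q (m + 1) • y m) (𝓕 := atTop) hy ?_ ?_
  · refine h.congr fun N => ?_
    rw [tsum_eq_sum (s := Finset.range N) (fun m hm => if_neg (by simpa using hm))]
    exact Finset.sum_congr rfl fun m hm => if_pos (Finset.mem_range.1 hm)
  · intro m
    refine ((tendsto_lagrangeZero hq hq1 m).smul_const (y m)).congr' ?_
    filter_upwards [eventually_gt_atTop m] with N hN
    rw [if_pos hN]
  · refine Eventually.of_forall fun N m => ?_
    split_ifs with hm
    · rw [norm_smul, Real.norm_eq_abs]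
      exact mul_le_mul_of_nonneg_right (abs_lagrangeZero_le hq hq1 hm) (norm_nonneg _)
    · rw [norm_zero]; positivity

/-- Lagrange interpolation of the monomial `u^i`, evaluated at `0`. -/
theorem sum_lagrangeZero_mul_qNode_pow {q : ℝ} (hq : 0 < q) (hq1 : q < 1) {i N : ℕ} (h : i < N) :
    ∑ m ∈ Finset.range N, lagrangeZero q N m * qNode q m ^ i = 0 ^ i := by
  have hinj : Set.InjOn (qNode q) (Finset.range N : Set ℕ) :=
    (qNode_strictMono hq hq1).injective.injOn
  have := Lagrange.eq_interpolate (s := Finset.range N) (v := qNode q)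
    (f := (Polynomial.X : Polynomial ℝ) ^ i) hinj (by
      rw [Polynomial.degree_X_pow, Finset.card_range]; exact_mod_cast h)
  have h2 := congrArg (Polynomial.eval 0) this
  rw [Lagrange.interpolate_apply, Polynomial.eval_finsetSum, Polynomial.eval_pow,
    Polynomial.eval_X] at h2
  rw [h2]
  refine Finset.sum_congr rfl fun m _ => ?_
  simp only [Polynomial.eval_mul, Polynomial.eval_C, Polynomial.eval_pow, Polynomial.eval_X]
  rw [mul_comm, lagrangeZero, Lagrange.basis, Polynomial.eval_prod]
  congr 1
  refine Finset.prod_congr rfl fun k _ => ?_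
  simp only [Lagrange.basisDivisor, Polynomial.eval_mul, Polynomial.eval_C, Polynomial.eval_sub,
    Polynomial.eval_X]
  rw [zero_sub, ← neg_sub (qNode q k) (qNode q m), inv_neg, neg_mul_neg, mul_comm, div_eq_mul_inv]

/-- The orthogonality that makes the moments of the kernel `H_q` polynomials. -/
theorem tsum_qWeight_mul_qNode_pow {q : ℝ} (hq : 0 < q) (hq1 : q < 1) (i : ℕ) :
    ∑' m, qWeight q (m + 1) * qNode q m ^ i = 0 ^ i := by
  have h := tendsto_sum_lagrangeZero_smul hq hq1 (y := fun m => qNode q m ^ i) (by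
    refine (summable_abs_qWeight_mul_qNode_pow hq hq1 i).congr fun m => ?_
    rw [Real.norm_eq_abs, abs_of_pos (pow_pos (qNode_pos hq hq1 m) i)])
  refine tendsto_nhds_unique h (tendsto_const_nhds.congr' ?_)
  filter_upwards [eventually_gt_atTop i] with N hN
  exact (sum_lagrangeZero_mul_qNode_pow hq hq1 hN).symm

/-! ### Complete symmetric functions as polynomials in the `q`-zeta values -/

/-- Polynomials in formal variables for `ζ_q(2), ζ_q(4), …`. -/
abbrev ZetaRing : Type := MvPolynomial ℕ ℚ

/-- Evaluation at the actual `q`-zeta values. -/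
noncomputable def zetaEval (q : ℝ) : ZetaRing →ₐ[ℚ] ℝ :=
  MvPolynomial.aeval fun k => qZeta q (2 * k + 2)

/-- The complete symmetric functions, written as polynomials in the power sums
`ζ_q(2), ζ_q(4), …` by Newton's identities. -/
noncomputable def completeSymm : ℕ → ZetaRing
  | 0 => 1
  | j + 1 => MvPolynomial.C (1 / ((j : ℚ) + 1)) *
      ∑ i : Fin (j + 1), MvPolynomial.X (j - i : ℕ) * completeSymm i

theorem completeSymm_succ (j : ℕ) : completeSymm (j + 1) = MvPolynomial.C (1 / ((j : ℚ) + 1)) *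
      ∑ i ∈ Finset.range (j + 1), MvPolynomial.X (j - i) * completeSymm i := by
  rw [completeSymm, Finset.sum_range (fun i => MvPolynomial.X (j - i) * completeSymm i)]

theorem inv_qNode_eq {q : ℝ} (hq : 0 < q) (m : ℕ) :
    (qNode q m)⁻¹ = q ^ (m + 1) / (1 - q ^ (m + 1)) ^ 2 := by
  rw [qNode_eq hq, inv_div]

theorem qZeta_eq_tsum {q : ℝ} (hq : 0 < q) (k : ℕ) :
    qZeta q (2 * k + 2) = ∑' m, ((qNode q m)⁻¹) ^ (k + 1) := by
  rw [qZeta]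
  refine tsum_congr fun m => ?_
  rw [inv_qNode_eq hq, div_pow, ← pow_mul, ← pow_mul, ← Real.rpow_natCast q ((m + 1) * (k + 1))]
  congr 2
  push_cast; ring

theorem summable_inv_qNode_pow {q : ℝ} (hq : 0 < q) (hq1 : q < 1) (k : ℕ) :
    Summable fun m => ((qNode q m)⁻¹) ^ (k + 1) := by
  have hs : Summable fun m : ℕ => ((1 - q) ^ 2)⁻¹ * ((qNode q 0)⁻¹) ^ k * q ^ m :=
    (summable_geometric_of_lt_one hq.le hq1).mul_left _
  refine Summable.of_nonneg_of_le (fun m => pow_nonneg (inv_nonneg.2 (qNode_pos hq hq1 m).le) _)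
    (fun m => ?_) hs
  have h1 : (qNode q m)⁻¹ ≤ ((1 - q) ^ 2)⁻¹ * q ^ m := by
    rw [inv_qNode_eq hq, div_eq_inv_mul]
    have h2 : q ^ (m + 1) ≤ q := pow_le_of_le_one hq.le hq1.le (by omega)
    have h3 : q ^ (m + 1) ≤ q ^ m := pow_le_pow_of_le_one hq.le hq1.le (by omega)
    have : 0 < 1 - q := by linarith
    gcongr
  have h0 := (qNode_pos hq hq1 m).le
  calc ((qNode q m)⁻¹) ^ (k + 1) = ((qNode q m)⁻¹) ^ k * (qNode q m)⁻¹ := pow_succ _ _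
    _ ≤ ((qNode q 0)⁻¹) ^ k * (((1 - q) ^ 2)⁻¹ * q ^ m) :=
        mul_le_mul (pow_le_pow_left₀ (inv_nonneg.2 h0) (inv_qNode_le hq hq1 m) k) h1
          (inv_nonneg.2 h0) (pow_nonneg (inv_nonneg.2 (qNode_pos hq hq1 0).le) _)
    _ = _ := by ring

open Polynomial in
/-- The partial fraction expansion of `∏ (1 - a_k u)⁻¹`, cleared of denominators. -/
theorem sum_lagrangeZero_mul_prod {q : ℝ} (hq : 0 < q) (hq1 : q < 1) {N : ℕ} (hN : 0 < N) :
    ∑ m ∈ Finset.range N, C (lagrangeZero q N m) *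
      ∏ k ∈ (Finset.range N).erase m, (1 - C (qNode q k)⁻¹ * X) = (1 : ℝ[X]) := by
  have hinj : Set.InjOn (qNode q) (Finset.range N : Set ℕ) :=
    (qNode_strictMono hq hq1).injective.injOn
  refine Eq.trans ?_ (Lagrange.sum_basis hinj ⟨0, Finset.mem_range.2 hN⟩)
  refine Finset.sum_congr rfl fun m _ => ?_
  rw [lagrangeZero, map_prod, ← Finset.prod_mul_distrib, Lagrange.basis]
  refine Finset.prod_congr rfl fun k hk => ?_
  have h1 : qNode q k - qNode q m ≠ 0 :=
    sub_ne_zero.2 ((qNode_strictMono hq hq1).injective.ne (Finset.ne_of_mem_erase hk))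
  have h2 := (qNode_pos hq hq1 k).ne'
  have h3 : qNode q m - qNode q k ≠ 0 := by rwa [← neg_sub, neg_ne_zero]
  have e1 : qNode q k / (qNode q k - qNode q m) * (qNode q k)⁻¹ = -(qNode q m - qNode q k)⁻¹ := by
    rw [← neg_sub (qNode q k), inv_neg, neg_neg]; field_simp
  have e2 : qNode q k / (qNode q k - qNode q m) = -((qNode q m - qNode q k)⁻¹ * qNode q k) := by
    rw [← neg_sub (qNode q k), inv_neg, neg_mul, neg_neg, div_eq_inv_mul]
  rw [Lagrange.basisDivisor, mul_sub, mul_one, ← mul_assoc, ← C_mul, e1, e2, C_neg, C_neg, C_mul]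
  ring

/-- The geometric series `(1 - a u)⁻¹`. -/
noncomputable def geomSeries (a : ℝ) : PowerSeries ℝ := PowerSeries.mk fun j => a ^ j

theorem one_sub_mul_geomSeries (a : ℝ) :
    (1 - PowerSeries.C a * PowerSeries.X) * geomSeries a = 1 := by
  ext j
  rw [sub_mul, one_mul, map_sub, mul_assoc, PowerSeries.coeff_C_mul]
  cases j with
  | zero => simp [geomSeries]
  | succ j => simp [geomSeries, PowerSeries.coeff_succ_X_mul, PowerSeries.coeff_one, pow_succ']

theorem derivative_geomSeries (a : ℝ) : PowerSeries.derivative ℝ (geomSeries a) =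
    geomSeries a * (PowerSeries.C a * geomSeries a) := by
  have h := congrArg (PowerSeries.derivative ℝ) (one_sub_mul_geomSeries a)
  have h0 : PowerSeries.derivative ℝ (PowerSeries.C a * PowerSeries.X) = PowerSeries.C a := by
    ext j
    simp [PowerSeries.coeff_C]
  rw [Derivation.leibniz, map_sub, h0, Derivation.map_one_eq_zero, zero_sub, smul_eq_mul, smul_eq_mul] at h
  have h1 := one_sub_mul_geomSeries a
  linear_combination (geomSeries a) * h - (PowerSeries.derivative ℝ (geomSeries a)) * h1

/-- The logarithmic derivative of `∏ (1 - a_m u)⁻¹`. -/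
theorem derivative_prod_geomSeries (a : ℕ → ℝ) (N : ℕ) :
    PowerSeries.derivative ℝ (∏ m ∈ Finset.range N, geomSeries (a m)) =
      (∏ m ∈ Finset.range N, geomSeries (a m)) *
        ∑ m ∈ Finset.range N, PowerSeries.C (a m) * geomSeries (a m) := by
  induction N with
  | zero => simp
  | succ N ih =>
    rw [Finset.prod_range_succ, Finset.sum_range_succ, Derivation.leibniz, ih,
      derivative_geomSeries, smul_eq_mul, smul_eq_mul]
    ring

/-- The partial fraction expansion of `∏ (1 - a_k u)⁻¹`, as an identity of power series. -/
theorem sum_lagrangeZero_geomSeries {q : ℝ} (hq : 0 < q) (hq1 : q < 1) {N : ℕ} (hN : 0 < N) :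
    ∑ m ∈ Finset.range N, PowerSeries.C (lagrangeZero q N m) * geomSeries (qNode q m)⁻¹ =
      ∏ m ∈ Finset.range N, geomSeries (qNode q m)⁻¹ := by
  have h := congrArg (fun p : Polynomial ℝ => (p : PowerSeries ℝ) *
    ∏ m ∈ Finset.range N, geomSeries (qNode q m)⁻¹) (sum_lagrangeZero_mul_prod hq hq1 hN)
  simp only [Polynomial.coe_one, one_mul] at h
  rw [← h, ← Polynomial.coeToPowerSeries.ringHom_apply, map_sum, Finset.sum_mul]
  refine Finset.sum_congr rfl fun m hm => ?_
  rw [map_mul, map_prod, ← Finset.mul_prod_erase _ _ hm]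
  simp only [map_sub, map_one, map_mul, Polynomial.coeToPowerSeries.ringHom_apply,
    Polynomial.coe_C, Polynomial.coe_X]
  have h2 : (∏ k ∈ (Finset.range N).erase m,
      (1 - PowerSeries.C (qNode q k)⁻¹ * PowerSeries.X)) *
      ∏ k ∈ (Finset.range N).erase m, geomSeries (qNode q k)⁻¹ = 1 := by
    rw [← Finset.prod_mul_distrib]
    exact Finset.prod_eq_one fun k _ => one_sub_mul_geomSeries _
  linear_combination (- PowerSeries.C (lagrangeZero q N m) * geomSeries (qNode q m)⁻¹) * h2

/-- Newton's identity for the coefficients of `∏ (1 - a_k u)⁻¹`, with these coefficients in the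
form that the partial fraction expansion gives. -/
theorem newton_lagrangeZero {q : ℝ} (hq : 0 < q) (hq1 : q < 1) {N : ℕ} (hN : 0 < N) (j : ℕ) :
    (∑ m ∈ Finset.range N, lagrangeZero q N m * ((qNode q m)⁻¹) ^ (j + 1)) * (j + 1) =
      ∑ i ∈ Finset.range (j + 1),
        (∑ m ∈ Finset.range N, ((qNode q m)⁻¹) ^ (j - i + 1)) *
        ∑ m ∈ Finset.range N, lagrangeZero q N m * ((qNode q m)⁻¹) ^ i := by
  have h := derivative_prod_geomSeries (fun m => (qNode q m)⁻¹) N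
  rw [← sum_lagrangeZero_geomSeries hq hq1 hN] at h
  have h2 := congrArg (PowerSeries.coeff j) h
  rw [PowerSeries.coeff_derivative, PowerSeries.coeff_mul,
    Finset.Nat.sum_antidiagonal_eq_sum_range_succ_mk] at h2
  simp only [map_sum, PowerSeries.coeff_C_mul, geomSeries, PowerSeries.coeff_mk] at h2
  rw [h2]
  refine Finset.sum_congr rfl fun i _ => ?_
  rw [mul_comm]
  simp only [pow_succ']

/-- The complete symmetric functions of the `a_m` are the moments `∑ w_m a_m^j` of the weights of
the kernel `H_q`. Both recursions contain the `q`-zeta values through these numbers only. -/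
theorem zetaEval_completeSymm {q : ℝ} (hq : 0 < q) (hq1 : q < 1) (j : ℕ) :
    zetaEval q (completeSymm j) = ∑' m, qWeight q (m + 1) * ((qNode q m)⁻¹) ^ j := by
  have hlim : ∀ j, Tendsto (fun N => ∑ m ∈ Finset.range N,
      lagrangeZero q N m * ((qNode q m)⁻¹) ^ j) atTop
      (𝓝 (∑' m, qWeight q (m + 1) * ((qNode q m)⁻¹) ^ j)) := fun j =>
    tendsto_sum_lagrangeZero_smul hq hq1 (y := fun m => ((qNode q m)⁻¹) ^ j) (by
      refine (summable_abs_qWeight_mul_inv_pow hq hq1 j).congr fun m => ?_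
      rw [Real.norm_eq_abs, abs_of_pos (pow_pos (inv_pos.2 (qNode_pos hq hq1 m)) j)])
  induction j using Nat.strong_induction_on with
  | _ j ih =>
    cases j with
    | zero => simpa [completeSymm] using (tsum_qWeight_mul_qNode_pow hq hq1 0).symm
    | succ j =>
      have hp : ∀ k, Tendsto (fun N => ∑ m ∈ Finset.range N, ((qNode q m)⁻¹) ^ (k + 1)) atTop
          (𝓝 (zetaEval q (MvPolynomial.X k))) := fun k => by
        rw [zetaEval, MvPolynomial.aeval_X, qZeta_eq_tsum hq]
        exact (summable_inv_qNode_pow hq hq1 k).hasSum.tendsto_sum_nat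
      have h1 : Tendsto (fun N => (∑ m ∈ Finset.range N,
          lagrangeZero q N m * ((qNode q m)⁻¹) ^ (j + 1)) * ((j : ℝ) + 1)) atTop
          (𝓝 (∑ i ∈ Finset.range (j + 1), zetaEval q (MvPolynomial.X (j - i)) *
            zetaEval q (completeSymm i))) := by
        have h2 := tendsto_finsetSum (Finset.range (j + 1)) fun i hi =>
          (hp (j - i)).mul (hlim i)
        rw [Finset.sum_congr rfl fun i hi => by rw [ih i (Finset.mem_range.1 hi)]]
        refine h2.congr' ?_
        filter_upwards [eventually_gt_atTop 0] with N hN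
        rw [newton_lagrangeZero hq hq1 hN]
      have h3 := tendsto_nhds_unique h1 ((hlim (j + 1)).mul_const _)
      have h4 : (j : ℝ) + 1 ≠ 0 := by positivity
      rw [completeSymm_succ, map_mul, map_sum]
      simp only [map_mul]
      rw [h3, zetaEval, MvPolynomial.aeval_C]
      simp only [one_div, map_inv₀, map_add, map_natCast, map_one]
      field_simp

/-! ### The inverse of the infinite product -/

/-- `F(u) = ∑ w_m / (1 - a_m u)`, the partial fraction expansion of `∏ (1 - a_m u)⁻¹`. -/
noncomputable def invProd (q : ℝ) (u : ℂ) : ℂ :=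
  ∑' m, qWeight q (m + 1) • (1 - ((qNode q m)⁻¹ : ℝ) * u)⁻¹

theorem norm_inv_qNode_mul_le {q : ℝ} (hq : 0 < q) (hq1 : q < 1) {u : ℂ}
    (hu : ‖u‖ ≤ qNode q 0 / 2) (m : ℕ) : ‖(((qNode q m)⁻¹ : ℝ) : ℂ) * u‖ ≤ 1 / 2 := by
  have h0 := qNode_pos hq hq1 0
  have hm := qNode_pos hq hq1 m
  rw [norm_mul, Complex.norm_real, Real.norm_eq_abs, abs_of_pos (inv_pos.2 hm)]
  calc (qNode q m)⁻¹ * ‖u‖ ≤ (qNode q 0)⁻¹ * (qNode q 0 / 2) := by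
        have := inv_qNode_le hq hq1 m
        gcongr
    _ = 1 / 2 := by field_simp

theorem half_le_norm_one_sub {q : ℝ} (hq : 0 < q) (hq1 : q < 1) {u : ℂ}
    (hu : ‖u‖ ≤ qNode q 0 / 2) (m : ℕ) : 1 / 2 ≤ ‖1 - (((qNode q m)⁻¹ : ℝ) : ℂ) * u‖ := by
  have h := norm_sub_norm_le (1 : ℂ) ((((qNode q m)⁻¹ : ℝ) : ℂ) * u)
  have h2 := norm_inv_qNode_mul_le hq hq1 hu m
  rw [norm_one] at h
  linarith

theorem norm_inv_one_sub_le {q : ℝ} (hq : 0 < q) (hq1 : q < 1) {u : ℂ}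
    (hu : ‖u‖ ≤ qNode q 0 / 2) (m : ℕ) : ‖(1 - (((qNode q m)⁻¹ : ℝ) : ℂ) * u)⁻¹‖ ≤ 2 := by
  rw [norm_inv]
  exact inv_le_of_inv_le₀ (by norm_num) (by simpa using half_le_norm_one_sub hq hq1 hu m)

/-- The product in `y(z)` and the weights of `H_q` are related by partial fractions. -/
theorem invProd_mul_tprod {q : ℝ} (hq : 0 < q) (hq1 : q < 1) {u : ℂ}
    (hu : ‖u‖ ≤ qNode q 0 / 2) :
    invProd q u * ∏' m, (1 - (((qNode q m)⁻¹ : ℝ) : ℂ) * u) = 1 := by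
  have h1 := tendsto_sum_lagrangeZero_smul hq hq1
    (y := fun m => (1 - (((qNode q m)⁻¹ : ℝ) : ℂ) * u)⁻¹) (by
      refine Summable.of_nonneg_of_le (fun m => by positivity) (fun m => ?_)
        ((summable_abs_qWeight hq hq1).mul_right 2)
      exact mul_le_mul_of_nonneg_left (norm_inv_one_sub_le hq hq1 hu m) (abs_nonneg _))
  have hmul : Multipliable fun m => (1 - (((qNode q m)⁻¹ : ℝ) : ℂ) * u) := by
    simp only [sub_eq_add_neg]
    refine multipliable_one_add_of_summable ?_
    simp only [norm_neg, norm_mul, Complex.norm_real]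
    refine Summable.mul_right _ ?_
    simpa using (summable_inv_qNode_pow hq hq1 0).norm
  have h2 := h1.mul hmul.hasProd.tendsto_prod_nat
  refine tendsto_nhds_unique h2 (tendsto_const_nhds.congr' ?_)
  filter_upwards [eventually_gt_atTop 0] with N hN
  have h3 := congrArg (Polynomial.eval₂ Complex.ofRealHom u)
    (sum_lagrangeZero_mul_prod hq hq1 hN)
  rw [Polynomial.eval₂_one, Polynomial.eval₂_finsetSum] at h3
  refine h3.symm.trans ?_
  rw [Finset.sum_mul]
  refine Finset.sum_congr rfl fun m hm => ?_
  rw [Polynomial.eval₂_mul, Polynomial.eval₂_finsetProd, Polynomial.eval₂_C,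
    ← Finset.mul_prod_erase _ _ hm]
  simp only [Polynomial.eval₂_sub, Polynomial.eval₂_one, Polynomial.eval₂_mul, Polynomial.eval₂_C,
    Polynomial.eval₂_X, Complex.ofRealHom_eq_coe, Complex.real_smul]
  have h4 : 1 - (((qNode q m)⁻¹ : ℝ) : ℂ) * u ≠ 0 := fun h => by
    have := half_le_norm_one_sub hq hq1 hu m
    rw [h, norm_zero] at this
    norm_num at this
  rw [← mul_assoc, mul_assoc _ _ (1 - (((qNode q m)⁻¹ : ℝ) : ℂ) * u), inv_mul_cancel₀ h4, mul_one]

/-- The tail `∑ w_m a_m^J / (1 - a_m u)` of the Taylor expansion of `F`. -/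
noncomputable def invProdTail (q : ℝ) (J : ℕ) (u : ℂ) : ℂ :=
  ∑' m, qWeight q (m + 1) • ((((qNode q m)⁻¹ : ℝ) : ℂ) ^ J * (1 - ((qNode q m)⁻¹ : ℝ) * u)⁻¹)

theorem analyticAt_invProdTail {q : ℝ} (hq : 0 < q) (hq1 : q < 1) (J : ℕ) :
    AnalyticAt ℂ (invProdTail q J) 0 := by
  have h0 := qNode_pos hq hq1 0
  have hd : DifferentiableOn ℂ (invProdTail q J) (Metric.ball 0 (qNode q 0 / 2)) := by
    refine Complex.differentiableOn_tsum_of_summable_norm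
      (u := fun m => |qWeight q (m + 1)| * ((qNode q m)⁻¹) ^ J * 2)
      ((summable_abs_qWeight_mul_inv_pow hq hq1 J).mul_right 2) (fun m => ?_) Metric.isOpen_ball ?_
    · intro u hu
      have hu' : ‖u‖ ≤ qNode q 0 / 2 := (mem_ball_zero_iff.1 hu).le
      have h4 : 1 - (((qNode q m)⁻¹ : ℝ) : ℂ) * u ≠ 0 := fun h => by
        have := half_le_norm_one_sub hq hq1 hu' m
        rw [h, norm_zero] at this
        norm_num at this
      refine DifferentiableAt.differentiableWithinAt ?_
      simp only [Complex.real_smul]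
      fun_prop (disch := exact h4)
    · intro m u hu
      have hu' : ‖u‖ ≤ qNode q 0 / 2 := (mem_ball_zero_iff.1 hu).le
      rw [norm_smul, norm_mul, norm_pow, Complex.norm_real, Real.norm_eq_abs, Real.norm_eq_abs,
        abs_of_pos (inv_pos.2 (qNode_pos hq hq1 m)), mul_assoc]
      have := norm_inv_one_sub_le hq hq1 hu' m
      have := (inv_pos.2 (qNode_pos hq hq1 m)).le
      gcongr
  exact hd.analyticAt (Metric.ball_mem_nhds 0 (half_pos h0))

/-- The Taylor expansion of `∏ (1 - a_m u)⁻¹`, with coefficients the complete symmetric functions. -/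
theorem invProd_eq_sum_add {q : ℝ} (hq : 0 < q) (hq1 : q < 1) {u : ℂ}
    (hu : ‖u‖ ≤ qNode q 0 / 2) (J : ℕ) :
    invProd q u = ∑ j ∈ Finset.range J, (zetaEval q (completeSymm j) : ℂ) * u ^ j +
      u ^ J * invProdTail q J u := by
  have hs : ∀ j, Summable fun m => qWeight q (m + 1) * ((qNode q m)⁻¹) ^ j := fun j => by
    refine Summable.of_norm ?_
    refine (summable_abs_qWeight_mul_inv_pow hq hq1 j).congr fun m => ?_
    rw [norm_mul, Real.norm_eq_abs, Real.norm_eq_abs,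
      abs_of_pos (pow_pos (inv_pos.2 (qNode_pos hq hq1 m)) j)]
  have hs' : ∀ j, HasSum (fun m => ((qWeight q (m + 1) * ((qNode q m)⁻¹) ^ j : ℝ) : ℂ) * u ^ j)
      ((zetaEval q (completeSymm j) : ℂ) * u ^ j) := fun j => by
    rw [zetaEval_completeSymm hq hq1]
    exact (Complex.hasSum_ofReal.2 (hs j).hasSum).mul_right _
  have ht : Summable fun m => qWeight q (m + 1) •
      ((((qNode q m)⁻¹ : ℝ) : ℂ) ^ J * (1 - ((qNode q m)⁻¹ : ℝ) * u)⁻¹) := by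
    refine Summable.of_norm_bounded ((summable_abs_qWeight_mul_inv_pow hq hq1 J).mul_right 2)
      fun m => ?_
    rw [norm_smul, norm_mul, norm_pow, Complex.norm_real, Real.norm_eq_abs, Real.norm_eq_abs,
      abs_of_pos (inv_pos.2 (qNode_pos hq hq1 m)), mul_assoc]
    have := norm_inv_one_sub_le hq hq1 hu m
    have := (inv_pos.2 (qNode_pos hq hq1 m)).le
    gcongr
  have h := (hasSum_sum fun j (_ : j ∈ Finset.range J) => hs' j).add
    (ht.hasSum.mul_left (u ^ J))
  rw [invProd, invProdTail]
  refine (HasSum.tsum_eq ?_)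
  refine h.congr_fun fun m => ?_
  have h4 : 1 - (((qNode q m)⁻¹ : ℝ) : ℂ) * u ≠ 0 := fun h => by
    have := half_le_norm_one_sub hq hq1 hu m
    rw [h, norm_zero] at this
    norm_num at this
  have h5 := geom_sum_mul_neg ((((qNode q m)⁻¹ : ℝ) : ℂ) * u) J
  simp only [Complex.real_smul, Complex.ofReal_mul, Complex.ofReal_pow] at h5 ⊢
  have h6 : ∑ i ∈ Finset.range J, (qWeight q (m + 1) : ℂ) * ((((qNode q m)⁻¹ : ℝ) : ℂ)) ^ i * u ^ i =
      (qWeight q (m + 1) : ℂ) * ∑ i ∈ Finset.range J, ((((qNode q m)⁻¹ : ℝ) : ℂ) * u) ^ i := by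
    rw [Finset.mul_sum]
    exact Finset.sum_congr rfl fun i _ => by rw [mul_pow]; ring
  rw [h6, eq_div_of_mul_eq h4 h5, mul_pow]
  field_simp
  ring

/-! ### Moments of the Mirzakhani kernel -/

/-- `∑ W_m exp(-r_m x)`. -/
noncomputable def expSeries (r W : ℕ → ℝ) (x : ℝ) : ℝ := ∑' m, W m * Real.exp (-(r m * x))

theorem integrableOn_pow_mul_exp_neg (p : ℕ) {r : ℝ} (hr : 0 < r) :
    IntegrableOn (fun x : ℝ => x ^ p * Real.exp (-(r * x))) (Set.Ioi 0) := by
  have h := integrableOn_rpow_mul_exp_neg_mul_rpow (p := 1) (s := p) (b := r)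
    (by have : (0 : ℝ) ≤ p := p.cast_nonneg
        linarith) one_pos hr
  refine h.congr_fun (fun x _ => ?_) measurableSet_Ioi
  simp only [Real.rpow_natCast, Real.rpow_one, neg_mul]

theorem integral_pow_mul_exp_neg (p : ℕ) {r : ℝ} (hr : 0 < r) :
    ∫ x in Set.Ioi (0 : ℝ), x ^ p * Real.exp (-(r * x)) = p.factorial * (r⁻¹) ^ (p + 1) := by
  have h := Real.integral_rpow_mul_exp_neg_mul_Ioi (a := (p : ℝ) + 1) (by positivity) hr
  rw [Real.Gamma_nat_eq_factorial, one_div, ← Nat.cast_succ, Real.rpow_natCast, mul_comm] at h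
  rw [← Nat.succ_eq_add_one, ← h]
  refine setIntegral_congr_fun measurableSet_Ioi fun x _ => ?_
  rw [Nat.cast_succ, add_sub_cancel_right, Real.rpow_natCast]

section
variable {r W : ℕ → ℝ} (h0 : 0 < r 0) (hr : ∀ m, r 0 ≤ r m) (hW : Summable fun m => |W m|)
include h0 hr hW

omit h0 in
theorem norm_expSeries_le {x : ℝ} (hx : 0 ≤ x) :
    ‖expSeries r W x‖ ≤ (∑' m, |W m|) * Real.exp (-(r 0 * x)) := by
  rw [expSeries, ← tsum_mul_right]
  refine tsum_of_norm_bounded (hW.mul_right _).hasSum fun m => ?_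
  rw [norm_mul, Real.norm_eq_abs, Real.norm_eq_abs, Real.abs_exp]
  have := hr m
  gcongr

theorem integrableOn_pow_mul_expSeries (p : ℕ) :
    IntegrableOn (fun x => x ^ p * expSeries r W x) (Set.Ioi 0) := by
  have hc : ContinuousOn (expSeries r W) (Set.Ioi 0) := by
    refine continuousOn_tsum (fun m => by fun_prop) hW fun m x hx => ?_
    rw [norm_mul, Real.norm_eq_abs, Real.norm_eq_abs, Real.abs_exp]
    refine mul_le_of_le_one_right (abs_nonneg _) (Real.exp_le_one_iff.2 ?_)
    have := mul_nonneg (h0.le.trans (hr m)) (le_of_lt hx)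
    linarith
  refine Integrable.mono'
    ((integrableOn_pow_mul_exp_neg p h0).mul_const (∑' m, |W m|))
    (((by fun_prop : ContinuousOn (fun x : ℝ => x ^ p) (Set.Ioi 0)).mul
      hc).aestronglyMeasurable measurableSet_Ioi) ?_
  refine (ae_restrict_mem measurableSet_Ioi).mono fun x hx => ?_
  have hx0 : (0 : ℝ) ≤ x := le_of_lt hx
  have h := norm_expSeries_le hr hW hx0
  rw [norm_mul, norm_pow, Real.norm_eq_abs x, abs_of_nonneg hx0]
  calc x ^ p * ‖expSeries r W x‖ ≤ x ^ p * ((∑' m, |W m|) * Real.exp (-(r 0 * x))) := by gcongr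
    _ = _ := by ring

theorem summable_abs_mul_inv_pow (n : ℕ) : Summable fun m => |W m * (r m)⁻¹ ^ n| := by
  refine Summable.of_nonneg_of_le (fun m => abs_nonneg _) (fun m => ?_)
    (hW.mul_right ((r 0)⁻¹ ^ n))
  have hm : 0 < r m := h0.trans_le (hr m)
  rw [abs_mul, abs_of_nonneg (pow_nonneg (inv_nonneg.2 hm.le) n)]
  have := inv_anti₀ h0 (hr m)
  gcongr

/-- Termwise integration, by absolute convergence. -/
theorem integral_pow_mul_expSeries (p : ℕ) :
    ∫ x in Set.Ioi (0 : ℝ), x ^ p * expSeries r W x =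
      p.factorial * ∑' m, W m * (r m)⁻¹ ^ (p + 1) := by
  have hpos : ∀ m, 0 < r m := fun m => h0.trans_le (hr m)
  have h := hasSum_integral_of_summable_integral_norm
    (F := fun m x => W m * (x ^ p * Real.exp (-(r m * x)))) (μ := volume.restrict (Set.Ioi (0 : ℝ)))
    (fun m => (integrableOn_pow_mul_exp_neg p (hpos m)).const_mul _) ?_
  · simp only [integral_const_mul, integral_pow_mul_exp_neg p (hpos _)] at h
    rw [← tsum_mul_left]
    have e : (fun x => x ^ p * expSeries r W x) =
        fun x => ∑' m, W m * (x ^ p * Real.exp (-(r m * x))) := by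
      ext x
      rw [expSeries, ← tsum_mul_left]
      exact tsum_congr fun m => by ring
    rw [e, ← h.tsum_eq]
    exact tsum_congr fun m => by ring
  · refine ((summable_abs_mul_inv_pow h0 hr hW (p + 1)).mul_left (p.factorial : ℝ)).congr
      fun m => ?_
    have e : ∫ x in Set.Ioi (0 : ℝ), ‖W m * (x ^ p * Real.exp (-(r m * x)))‖ =
        ∫ x in Set.Ioi (0 : ℝ), |W m| * (x ^ p * Real.exp (-(r m * x))) := by
      refine setIntegral_congr_fun measurableSet_Ioi fun x hx => ?_
      have hx0 : (0 : ℝ) ≤ x := le_of_lt hx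
      simp only [Real.norm_eq_abs, abs_mul, Real.abs_exp, abs_pow, abs_of_nonneg hx0]
    rw [e, integral_const_mul, integral_pow_mul_exp_neg p (hpos m), abs_mul,
      abs_of_nonneg (pow_nonneg (inv_nonneg.2 (hpos m).le) _)]
    ring

end

/-- The decay rate `(q^(-m/2) - q^(m/2)) / 2` of the summands of the kernel, counted from `0`. -/
noncomputable def qRate (q : ℝ) (m : ℕ) : ℝ := -(qDiff q (m + 1) / 2)

theorem qRate_sq (q : ℝ) (m : ℕ) : qRate q m ^ 2 = qNode q m / 4 := by
  rw [qRate, qNode]; ring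

theorem qRate_pos {q : ℝ} (hq : 0 < q) (hq1 : q < 1) (m : ℕ) : 0 < qRate q m := by
  rw [qRate, qDiff, neg_pos]
  refine div_neg_of_neg_of_pos (sub_neg.2 ?_) two_pos
  refine Real.rpow_lt_rpow_of_exponent_gt hq hq1 ?_
  have : (0 : ℝ) < (m + 1 : ℕ) := by positivity
  linarith

theorem qRate_zero_le {q : ℝ} (hq : 0 < q) (hq1 : q < 1) (m : ℕ) : qRate q 0 ≤ qRate q m := by
  refine le_of_sq_le_sq ?_ (qRate_pos hq hq1 m).le
  rw [qRate_sq, qRate_sq]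
  have := (qNode_strictMono hq hq1).monotone (Nat.zero_le m)
  linarith

/-- The coefficients of the exponential series of `qKernelCoeff q j`. -/
noncomputable def qKernelWeight (q : ℝ) (j m : ℕ) : ℝ :=
  qWeight q (m + 1) * (qNode q m / 4) ^ j / ((2 * j).factorial : ℝ)

theorem qKernelCoeff_eq_expSeries (q : ℝ) (j : ℕ) (x : ℝ) :
    qKernelCoeff q j x = expSeries (qRate q) (qKernelWeight q j) x := by
  refine tsum_congr fun m => ?_
  have e : (qDiff q (m + 1) / 2) ^ (2 * j) = (qNode q m / 4) ^ j := by
    rw [pow_mul, qNode]; congr 1; ring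
  rw [qKernelTermCoeff, qKernelWeight, e, qRate, show 1 / 2 * x * qDiff q (m + 1) =
    -(-(qDiff q (m + 1) / 2) * x) by ring]
  ring

theorem summable_abs_qKernelWeight {q : ℝ} (hq : 0 < q) (hq1 : q < 1) (j : ℕ) :
    Summable fun m => |qKernelWeight q j m| := by
  refine ((summable_abs_qWeight_mul_qNode_pow hq hq1 j).mul_right
    (((4 : ℝ) ^ j)⁻¹ / ((2 * j).factorial : ℝ))).congr fun m => ?_
  rw [qKernelWeight, abs_div, abs_mul, abs_of_nonneg (pow_nonneg
    (div_nonneg (qNode_pos hq hq1 m).le (by norm_num)) j), Nat.abs_cast, div_pow]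
  ring

/-- The coefficient of `t^(2j)` in `∫_0^∞ x^(2M-1) / (2M-1)! H_q(x, t) dx`. -/
noncomputable def kernelMomentCoeff (q : ℝ) (M j : ℕ) : ℝ :=
  if j ≤ M then 4 ^ (M - j) * zetaEval q (completeSymm (M - j)) / ((2 * j).factorial : ℝ) else 0

/-- For `j ≤ M` the sum is a complete symmetric function; for `j > M` it vanishes by
orthogonality. -/
theorem tsum_qKernelWeight_mul_inv_pow {q : ℝ} (hq : 0 < q) (hq1 : q < 1) (j M : ℕ) :
    ∑' m, qKernelWeight q j m * (qRate q m)⁻¹ ^ (2 * M) = kernelMomentCoeff q M j := by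
  have e : ∀ m, qKernelWeight q j m * (qRate q m)⁻¹ ^ (2 * M) =
      qWeight q (m + 1) * ((qNode q m / 4) ^ j * (qNode q m / 4)⁻¹ ^ M) *
        ((2 * j).factorial : ℝ)⁻¹ := fun m => by
    rw [qKernelWeight, pow_mul, inv_pow, qRate_sq]; ring
  rw [tsum_congr e, tsum_mul_right, kernelMomentCoeff]
  split_ifs with h
  · obtain ⟨i, rfl⟩ := Nat.exists_eq_add_of_le h
    rw [Nat.add_sub_cancel_left, zetaEval_completeSymm hq hq1, ← tsum_mul_left, div_eq_mul_inv]
    congr 1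
    refine tsum_congr fun m => ?_
    have := (qNode_pos hq hq1 m).ne'
    rw [pow_add, inv_pow, inv_pow, div_pow, div_pow, inv_pow]
    field_simp
  · obtain ⟨i, rfl⟩ := Nat.exists_eq_add_of_le (not_le.1 h).le
    have hi : i ≠ 0 := by omega
    have e2 : ∀ m, qWeight q (m + 1) * ((qNode q m / 4) ^ (M + i) * (qNode q m / 4)⁻¹ ^ M) =
        qWeight q (m + 1) * qNode q m ^ i * ((4 : ℝ) ^ i)⁻¹ := fun m => by
      have := (qNode_pos hq hq1 m).ne'
      rw [pow_add, inv_pow, div_pow, div_pow]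
      field_simp
    rw [tsum_congr e2, tsum_mul_right, tsum_qWeight_mul_qNode_pow hq hq1, zero_pow hi, zero_mul,
      zero_mul]

/-- `∫_0^∞ x^(2M-1) / (2M-1)! H_q(x, t) dx`. -/
noncomputable def kernelMoment (q : ℝ) (M : ℕ) (t : ℝ) : ℝ :=
  ∑ j ∈ Finset.range (M + 1),
    4 ^ (M - j) * zetaEval q (completeSymm (M - j)) / ((2 * j).factorial : ℝ) * t ^ (2 * j)

theorem hasSum_kernelMoment (q : ℝ) (M : ℕ) (t : ℝ) :
    HasSum (fun j => kernelMomentCoeff q M j * t ^ (2 * j)) (kernelMoment q M t) := by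
  have : kernelMoment q M t =
      ∑ j ∈ Finset.range (M + 1), kernelMomentCoeff q M j * t ^ (2 * j) := by
    refine Finset.sum_congr rfl fun j hj => ?_
    rw [kernelMomentCoeff, if_pos (Nat.lt_succ_iff.1 (Finset.mem_range.1 hj))]
  rw [this]
  refine hasSum_sum_of_ne_finset_zero fun j hj => ?_
  rw [kernelMomentCoeff, if_neg (by simpa [Nat.lt_succ_iff] using hj), zero_mul]

/-- Odd polynomials are integrated against `H_q` monomial by monomial. -/
theorem qKernelIntegral_odd_sum {q : ℝ} (hq : 0 < q) (hq1 : q < 1) {ι : Type*} (s : Finset ι)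
    (c : ι → ℝ) (k : ι → ℕ) (t : ℝ) :
    qKernelIntegral q (fun x => ∑ i ∈ s, c i * x ^ (2 * k i + 1)) t =
      ∑ i ∈ s, c i * ((2 * k i + 1).factorial * kernelMoment q (k i + 1) t) := by
  have h0 := qRate_pos hq hq1 0
  have hr := qRate_zero_le hq hq1
  have h1 : ∀ j, ∫ x in Set.Ioi (0 : ℝ),
      (∑ i ∈ s, c i * x ^ (2 * k i + 1)) * qKernelCoeff q j x =
      ∑ i ∈ s, c i * ((2 * k i + 1).factorial * kernelMomentCoeff q (k i + 1) j) := fun j => by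
    have hW := summable_abs_qKernelWeight hq hq1 j
    simp only [Finset.sum_mul, qKernelCoeff_eq_expSeries, mul_assoc]
    rw [integral_finsetSum s fun i _ =>
      (integrableOn_pow_mul_expSeries h0 hr hW (2 * k i + 1)).const_mul (c i)]
    refine Finset.sum_congr rfl fun i _ => ?_
    rw [integral_const_mul, integral_pow_mul_expSeries h0 hr hW,
      show 2 * k i + 1 + 1 = 2 * (k i + 1) by ring, tsum_qKernelWeight_mul_inv_pow hq hq1]
  rw [qKernelIntegral, tsum_congr fun j => by rw [h1 j, Finset.sum_mul]]
  refine HasSum.tsum_eq (hasSum_sum fun i _ => ?_)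
  have := ((hasSum_kernelMoment q (k i + 1) t).mul_left ((2 * k i + 1).factorial : ℝ)).mul_left (c i)
  refine this.congr_fun fun j => by ring

/-- The two-variable form: integrating over `y` replaces the weights by `W_m r_m^(-2l-2)`, and
the factorials multiply. -/
theorem qKernelIntegral₂_odd_sum {q : ℝ} (hq : 0 < q) (hq1 : q < 1) {ι : Type*} (s : Finset ι)
    (c : ι → ℝ) (k l : ι → ℕ) (t : ℝ) :
    qKernelIntegral₂ q (fun x y => ∑ i ∈ s, c i * (x ^ (2 * k i + 1) * y ^ (2 * l i + 1))) t =
      ∑ i ∈ s, c i * ((2 * k i + 1).factorial * (2 * l i + 1).factorial *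
        kernelMoment q (k i + l i + 2) t) := by
  have h0 := qRate_pos hq hq1 0
  have hr := qRate_zero_le hq hq1
  have h1 : ∀ j, ∀ x ∈ Set.Ioi (0 : ℝ), ∫ y in Set.Ioi (0 : ℝ),
      (∑ i ∈ s, c i * (x ^ (2 * k i + 1) * y ^ (2 * l i + 1))) * qKernelCoeff q j (x + y) =
      ∑ i ∈ s, c i * (2 * l i + 1).factorial * (x ^ (2 * k i + 1) * expSeries (qRate q)
        (fun m => qKernelWeight q j m * (qRate q m)⁻¹ ^ (2 * l i + 1 + 1)) x) := by
    intro j x hx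
    have hW := summable_abs_qKernelWeight hq hq1 j
    have hW' : Summable fun m => |qKernelWeight q j m * Real.exp (-(qRate q m * x))| := by
      refine Summable.of_nonneg_of_le (fun m => abs_nonneg _) (fun m => ?_) hW
      rw [abs_mul, Real.abs_exp]
      refine mul_le_of_le_one_right (abs_nonneg _) (Real.exp_le_one_iff.2 ?_)
      have := mul_nonneg (qRate_pos hq hq1 m).le (le_of_lt hx)
      linarith
    have e : ∀ y, expSeries (qRate q) (qKernelWeight q j) (x + y) = expSeries (qRate q)
        (fun m => qKernelWeight q j m * Real.exp (-(qRate q m * x))) y := fun y => by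
      refine tsum_congr fun m => ?_
      rw [mul_assoc, ← Real.exp_add]
      congr 2; ring
    simp only [Finset.sum_mul, qKernelCoeff_eq_expSeries, e]
    have e2 : ∀ y i, c i * (x ^ (2 * k i + 1) * y ^ (2 * l i + 1)) * expSeries (qRate q)
        (fun m => qKernelWeight q j m * Real.exp (-(qRate q m * x))) y =
        c i * x ^ (2 * k i + 1) * (y ^ (2 * l i + 1) * expSeries (qRate q)
        (fun m => qKernelWeight q j m * Real.exp (-(qRate q m * x))) y) := fun y i => by ring
    simp only [e2]
    rw [integral_finsetSum s fun i _ =>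
      (integrableOn_pow_mul_expSeries h0 hr hW' (2 * l i + 1)).const_mul _]
    refine Finset.sum_congr rfl fun i _ => ?_
    rw [integral_const_mul, integral_pow_mul_expSeries h0 hr hW', expSeries]
    have e3 : ∀ m, qKernelWeight q j m * Real.exp (-(qRate q m * x)) *
        (qRate q m)⁻¹ ^ (2 * l i + 1 + 1) = qKernelWeight q j m *
        (qRate q m)⁻¹ ^ (2 * l i + 1 + 1) * Real.exp (-(qRate q m * x)) := fun m => by ring
    rw [tsum_congr e3]
    ring
  have h2 : ∀ j, ∫ x in Set.Ioi (0 : ℝ), ∫ y in Set.Ioi (0 : ℝ),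
      (∑ i ∈ s, c i * (x ^ (2 * k i + 1) * y ^ (2 * l i + 1))) * qKernelCoeff q j (x + y) =
      ∑ i ∈ s, c i * ((2 * k i + 1).factorial * (2 * l i + 1).factorial *
        kernelMomentCoeff q (k i + l i + 2) j) := fun j => by
    have hW := fun i => summable_abs_mul_inv_pow h0 hr (summable_abs_qKernelWeight hq hq1 j)
      (2 * l i + 1 + 1)
    rw [setIntegral_congr_fun measurableSet_Ioi (h1 j), integral_finsetSum s fun i _ =>
      (integrableOn_pow_mul_expSeries h0 hr (hW i) (2 * k i + 1)).const_mul _]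
    refine Finset.sum_congr rfl fun i _ => ?_
    rw [integral_const_mul, integral_pow_mul_expSeries h0 hr (hW i)]
    simp only [mul_assoc, ← pow_add]
    rw [show 2 * l i + 1 + 1 + (2 * k i + 1 + 1) = 2 * (k i + l i + 2) by ring,
      tsum_qKernelWeight_mul_inv_pow hq hq1]
    ring
  rw [qKernelIntegral₂, tsum_congr fun j => by rw [h2 j, Finset.sum_mul]]
  refine HasSum.tsum_eq (hasSum_sum fun i _ => ?_)
  have := ((hasSum_kernelMoment q (k i + l i + 2) t).mul_left
    ((2 * k i + 1).factorial * (2 * l i + 1).factorial : ℝ)).mul_left (c i)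
  refine this.congr_fun fun j => by ring

theorem sum_range_even_add_odd {A : Type*} [AddCommMonoid A] (f : ℕ → A) (M : ℕ) :
    ∑ k ∈ Finset.range (2 * M + 1), f k = ∑ i ∈ Finset.range (M + 1), f (2 * i) +
      ∑ i ∈ Finset.range M, f (2 * i + 1) := by
  induction M with
  | zero => simp
  | succ M ih =>
    rw [show 2 * (M + 1) + 1 = 2 * M + 1 + 1 + 1 by ring, Finset.sum_range_succ,
      Finset.sum_range_succ, ih, Finset.sum_range_succ _ (M + 1), Finset.sum_range_succ _ M,
      Finset.sum_range_succ _ M]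
    rw [show 2 * (M + 1) = 2 * M + 1 + 1 by ring]
    abel

/-- The even part of the expansion of `(x + y)^(2M) / (2M)!`. -/
theorem add_pow_add_sub_pow_div_factorial (x y : ℝ) (M : ℕ) :
    ((x + y) ^ (2 * M) + (x - y) ^ (2 * M)) / ((2 * M).factorial : ℝ) =
      ∑ i ∈ Finset.range (M + 1), 2 * (x ^ (2 * i) / ((2 * i).factorial : ℝ)) *
        (y ^ (2 * (M - i)) / ((2 * (M - i)).factorial : ℝ)) := by
  rw [sub_eq_add_neg, add_pow, add_pow, ← Finset.sum_add_distrib, sum_range_even_add_odd,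
    add_div, Finset.sum_div]
  have h0 : ∑ i ∈ Finset.range M,
      (x ^ (2 * i + 1) * y ^ (2 * M - (2 * i + 1)) * ((2 * M).choose (2 * i + 1) : ℝ) +
      x ^ (2 * i + 1) * (-y) ^ (2 * M - (2 * i + 1)) * ((2 * M).choose (2 * i + 1) : ℝ)) = 0 := by
    refine Finset.sum_eq_zero fun i hi => ?_
    have hi := Finset.mem_range.1 hi
    rw [Odd.neg_pow ⟨M - i - 1, by omega⟩]
    ring
  rw [h0, zero_div, add_zero]
  refine Finset.sum_congr rfl fun i hi => ?_
  have hi := Nat.lt_succ_iff.1 (Finset.mem_range.1 hi)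
  rw [← Nat.mul_sub, Even.neg_pow (even_two_mul _), Nat.cast_choose ℝ (by omega), ← Nat.mul_sub]
  have := Nat.factorial_ne_zero (2 * M)
  field_simp
  ring

/-! ### Power series expansions at a puncture -/

/-- On a punctured neighbourhood of `0`, the function `f` is the sum of the power series `a`.
The value `f 0` does not matter. -/
def HasJet (f : ℂ → ℂ) (a : PowerSeries ℂ) : Prop :=
  ∀ᶠ t in 𝓝[≠] (0 : ℂ), HasSum (fun n => PowerSeries.coeff n a * t ^ n) (f t)

namespace HasJet

variable {f g : ℂ → ℂ} {a b : PowerSeries ℂ}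

theorem congr (hf : HasJet f a) (h : ∀ᶠ t in 𝓝[≠] (0 : ℂ), g t = f t) : HasJet g a := by
  filter_upwards [hf, h] with t h1 h2
  rwa [h2]

theorem add (hf : HasJet f a) (hg : HasJet g b) : HasJet (fun t => f t + g t) (a + b) := by
  filter_upwards [hf, hg] with t h1 h2
  refine (h1.add h2).congr_fun fun n => ?_
  rw [map_add]; ring

theorem const_mul (c : ℂ) (hf : HasJet f a) : HasJet (fun t => c * f t) (PowerSeries.C c * a) := by
  filter_upwards [hf] with t h1
  refine (h1.mul_left c).congr_fun fun n => ?_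
  rw [PowerSeries.coeff_C_mul]; ring

theorem sum {ι : Type*} (s : Finset ι) {f : ι → ℂ → ℂ} {a : ι → PowerSeries ℂ}
    (h : ∀ i ∈ s, HasJet (f i) (a i)) : HasJet (fun t => ∑ i ∈ s, f i t) (∑ i ∈ s, a i) := by
  have h' := (Filter.eventually_all_finset s).2 h
  filter_upwards [h'] with t ht
  refine (hasSum_sum ht).congr_fun fun n => ?_
  rw [map_sum, Finset.sum_mul]

theorem mul (hf : HasJet f a) (hg : HasJet g b) : HasJet (fun t => f t * g t) (a * b) := by
  filter_upwards [hf, hg] with t h1 h2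
  have e : ∀ n, PowerSeries.coeff n (a * b) * t ^ n = ∑ p ∈ Finset.HasAntidiagonal.antidiagonal n,
      (PowerSeries.coeff p.1 a * t ^ p.1) * (PowerSeries.coeff p.2 b * t ^ p.2) := fun n => by
    rw [PowerSeries.coeff_mul, Finset.sum_mul]
    refine Finset.sum_congr rfl fun p hp => ?_
    rw [← Finset.HasAntidiagonal.mem_antidiagonal.1 hp, pow_add]; ring
  simp only [e]
  rw [← h1.tsum_eq, ← h2.tsum_eq, tsum_mul_tsum_eq_tsum_sum_antidiagonal_of_summable_norm
    h1.summable.norm h2.summable.norm]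
  exact (summable_norm_sum_mul_antidiagonal_of_summable_norm
    h1.summable.norm h2.summable.norm).of_norm.hasSum

theorem one : HasJet (fun _ => 1) 1 := by
  refine Eventually.of_forall fun t => ?_
  have := hasSum_single (f := fun n => PowerSeries.coeff n (1 : PowerSeries ℂ) * t ^ n) 0
    fun n hn => by rw [PowerSeries.coeff_one, if_neg hn, zero_mul]
  simpa using this

theorem pow (hf : HasJet f a) (n : ℕ) : HasJet (fun t => f t ^ n) (a ^ n) := by
  induction n with
  | zero => simpa using one
  | succ n ih => simpa only [pow_succ] using ih.mul hf

theorem id : HasJet (fun t => t) PowerSeries.X := by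
  refine Eventually.of_forall fun t => ?_
  have := hasSum_single (f := fun n => PowerSeries.coeff n (PowerSeries.X : PowerSeries ℂ) * t ^ n) 1
    fun n hn => by rw [PowerSeries.coeff_X, if_neg hn, zero_mul]
  simpa using this

/-- The function agrees, away from `0`, with one that is analytic at `0`. -/
theorem exists_hasFPowerSeriesAt (hf : HasJet f a) : ∃ F : ℂ → ℂ,
    HasFPowerSeriesAt F (FormalMultilinearSeries.ofScalars ℂ fun n => PowerSeries.coeff n a) 0 ∧
      ∀ᶠ t in 𝓝[≠] (0 : ℂ), f t = F t := by
  refine ⟨Function.update f 0 (PowerSeries.coeff 0 a), ?_, ?_⟩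
  · rw [hasFPowerSeriesAt_iff]
    filter_upwards [eventually_nhdsWithin_iff.1 hf] with t ht
    simp only [FormalMultilinearSeries.coeff_ofScalars, zero_add, smul_eq_mul]
    by_cases h0 : t = 0
    · subst h0
      rw [Function.update_self]
      have := hasSum_single (f := fun n => (0 : ℂ) ^ n * PowerSeries.coeff n a) 0
        fun n hn => by rw [zero_pow hn, zero_mul]
      simpa using this
    · rw [Function.update_of_ne h0]
      exact (ht h0).congr_fun fun n => mul_comm _ _
  · filter_upwards [self_mem_nhdsWithin] with t ht
    rw [Function.update_of_ne ht]

theorem of_hasFPowerSeriesAt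
    (h : HasFPowerSeriesAt f (FormalMultilinearSeries.ofScalars ℂ fun n => PowerSeries.coeff n a) 0) :
    HasJet f a := by
  rw [hasFPowerSeriesAt_iff] at h
  refine (h.filter_mono nhdsWithin_le_nhds).mono fun t ht => ?_
  simp only [FormalMultilinearSeries.coeff_ofScalars, zero_add, smul_eq_mul] at ht
  exact ht.congr_fun fun n => mul_comm _ _

theorem of_analyticAt (h : AnalyticAt ℂ f 0) :
    HasJet f (PowerSeries.mk fun n => iteratedDeriv n f 0 / (n.factorial : ℂ)) := by
  refine of_hasFPowerSeriesAt ?_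
  simpa only [PowerSeries.coeff_mk] using h.hasFPowerSeriesAt

theorem exists_analyticAt (hf : HasJet f a) : ∃ F : ℂ → ℂ, AnalyticAt ℂ F 0 ∧
    (∀ᶠ t in 𝓝[≠] (0 : ℂ), f t = F t) ∧
      ∀ n, PowerSeries.coeff n a = iteratedDeriv n F 0 / (n.factorial : ℂ) := by
  obtain ⟨F, hF, h⟩ := hf.exists_hasFPowerSeriesAt
  refine ⟨F, hF.analyticAt, h, fun n => ?_⟩
  have := hF.eq_formalMultilinearSeries hF.analyticAt.hasFPowerSeriesAt
  have := congrArg (fun p => p.coeff n) this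
  simpa only [FormalMultilinearSeries.coeff_ofScalars] using this

theorem unique (hf : HasJet f a) (hf' : HasJet f b) : a = b := by
  obtain ⟨F, hF, h, hn⟩ := hf.exists_analyticAt
  obtain ⟨G, hG, h', hn'⟩ := hf'.exists_analyticAt
  have h1 : ∀ᶠ t in 𝓝[≠] (0 : ℂ), F t = G t := by
    filter_upwards [h, h'] with t h1 h2
    rw [← h1, h2]
  have h2 : F =ᶠ[𝓝 0] G := (hF.frequently_eq_iff_eventually_eq hG).1 h1.frequently
  ext n
  rw [hn, hn', h2.iteratedDeriv_eq]

theorem iteratedDeriv_eq (hf : HasJet f a) (h : AnalyticAt ℂ f 0) (n : ℕ) :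
    iteratedDeriv n f 0 / (n.factorial : ℂ) = PowerSeries.coeff n a := by
  rw [hf.unique (of_analyticAt h), PowerSeries.coeff_mk]

theorem deriv (hf : HasJet f a) : HasJet (deriv f) (PowerSeries.derivative ℂ a) := by
  obtain ⟨F, hF, h, hn⟩ := hf.exists_analyticAt
  have h1 : HasJet (_root_.deriv F) (PowerSeries.derivative ℂ a) := by
    have e : PowerSeries.derivative ℂ a =
        PowerSeries.mk fun n => iteratedDeriv n (_root_.deriv F) 0 / (n.factorial : ℂ) := by
      ext n
      rw [PowerSeries.coeff_derivative, PowerSeries.coeff_mk, hn, iteratedDeriv_succ',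
        Nat.factorial_succ]
      have := Nat.cast_add_one_ne_zero (R := ℂ) n
      push_cast
      field_simp
    rw [e]
    exact of_analyticAt hF.deriv
  refine h1.congr ?_
  filter_upwards [eventually_eventually_nhdsWithin.2 h, self_mem_nhdsWithin] with t ht ht0
  rw [isOpen_compl_singleton.nhdsWithin_eq ht0] at ht
  exact Filter.EventuallyEq.deriv_eq ht

/-- Splitting off the first terms of the expansion. -/
theorem exists_tail (hf : HasJet f a) (M : ℕ) : ∃ B : ℂ → ℂ, AnalyticAt ℂ B 0 ∧
    ∀ᶠ t in 𝓝[≠] (0 : ℂ),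
      f t = ∑ i ∈ Finset.range M, PowerSeries.coeff i a * t ^ i + t ^ M * B t := by
  have h : HasJet (fun t => (f t - ∑ i ∈ Finset.range M, PowerSeries.coeff i a * t ^ i) / t ^ M)
      (PowerSeries.mk fun n => PowerSeries.coeff (n + M) a) := by
    filter_upwards [hf, self_mem_nhdsWithin] with t ht ht0
    have ht0 : t ≠ 0 := ht0
    have := (hasSum_nat_add_iff' M).2 ht
    refine (this.div_const (t ^ M)).congr_fun fun n => ?_
    rw [PowerSeries.coeff_mk, pow_add]
    field_simp
  obtain ⟨B, hB, h1, -⟩ := h.exists_analyticAt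
  refine ⟨B, hB, ?_⟩
  filter_upwards [h1, self_mem_nhdsWithin] with t ht ht0
  have ht0 : t ≠ 0 := ht0
  rw [← ht]
  field_simp
  ring

end HasJet

/-! ### Residues -/

/-- The integral `(1/2πi) ∮ f(p) dp` over all small circles around `α` equals `c`. -/
def IsResidue (f : ℂ → ℂ) (α c : ℂ) : Prop :=
  ∀ᶠ r in 𝓝[>] (0 : ℝ), ContinuousOn f (Metric.sphere α r) ∧
    (2 * (π : ℂ) * Complex.I)⁻¹ * ∮ p in C(α, r), f p = c

theorem eventually_forall_sphere {α : ℂ} {P : ℂ → Prop} (h : ∀ᶠ p in 𝓝[≠] α, P p) :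
    ∀ᶠ r in 𝓝[>] (0 : ℝ), ∀ p ∈ Metric.sphere α r, P p := by
  rw [eventually_nhdsWithin_iff, Metric.eventually_nhds_iff] at h
  obtain ⟨ε, hε, h⟩ := h
  filter_upwards [Ioo_mem_nhdsGT hε] with r hr p hp
  refine h (by rw [Metric.mem_sphere.1 hp]; exact hr.2) ?_
  rintro rfl
  rw [Metric.mem_sphere, dist_self] at hp
  exact hr.1.ne hp

theorem eventually_closedBall {α : ℂ} {P : ℂ → Prop} (h : ∀ᶠ p in 𝓝 α, P p) :
    ∀ᶠ r in 𝓝[>] (0 : ℝ), 0 < r ∧ ∀ p ∈ Metric.closedBall α r, P p := by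
  rw [Metric.eventually_nhds_iff] at h
  obtain ⟨ε, hε, h⟩ := h
  filter_upwards [Ioo_mem_nhdsGT hε] with r hr
  exact ⟨hr.1, fun p hp => h (lt_of_le_of_lt (Metric.mem_closedBall.1 hp) hr.2)⟩

namespace IsResidue

variable {f g : ℂ → ℂ} {α c d : ℂ}

theorem residueAt_eq (h : IsResidue f α c) : residueAt f α = c := by
  refine Tendsto.limUnder_eq (tendsto_const_nhds.congr' ?_)
  filter_upwards [h] with r hr
  exact hr.2.symm

theorem congr (h : IsResidue f α c) (hg : ∀ᶠ p in 𝓝[≠] α, g p = f p) : IsResidue g α c := by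
  filter_upwards [h, eventually_forall_sphere hg, self_mem_nhdsWithin] with r hr hs h0
  refine ⟨hr.1.congr hs, ?_⟩
  rw [← hr.2, circleIntegral.integral_congr (le_of_lt h0) hs]

theorem add (hf : IsResidue f α c) (hg : IsResidue g α d) :
    IsResidue (fun p => f p + g p) α (c + d) := by
  filter_upwards [hf, hg, self_mem_nhdsWithin] with r h1 h2 h0
  refine ⟨h1.1.add h2.1, ?_⟩
  rw [circleIntegral.integral_add (h1.1.circleIntegrable (le_of_lt h0))
    (h2.1.circleIntegrable (le_of_lt h0)), mul_add, h1.2, h2.2]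

theorem const_mul (a : ℂ) (hf : IsResidue f α c) : IsResidue (fun p => a * f p) α (a * c) := by
  filter_upwards [hf] with r h1
  refine ⟨continuousOn_const.mul h1.1, ?_⟩
  rw [circleIntegral.integral_const_mul, ← h1.2]; ring

theorem zero : IsResidue (fun _ => 0) α 0 :=
  Eventually.of_forall fun r => ⟨continuousOn_const, by simp [circleIntegral]⟩

theorem sum {ι : Type*} (s : Finset ι) {f : ι → ℂ → ℂ} {c : ι → ℂ}
    (h : ∀ i ∈ s, IsResidue (f i) α (c i)) :
    IsResidue (fun p => ∑ i ∈ s, f i p) α (∑ i ∈ s, c i) := by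
  classical
  induction s using Finset.induction_on with
  | empty => simpa using zero
  | insert i s hi ih =>
    simp only [Finset.sum_insert hi]
    exact (h i (Finset.mem_insert_self _ _)).add
      (ih fun j hj => h j (Finset.mem_insert_of_mem hj))

theorem of_simple_pole (h : AnalyticAt ℂ f α) :
    IsResidue (fun p => (p - α)⁻¹ * f p) α (f α) := by
  filter_upwards [eventually_closedBall h.eventually_analyticAt] with r hr
  have hc : ContinuousOn f (Metric.closedBall α r) := fun p hp =>
    (hr.2 p hp).continuousAt.continuousWithinAt
  refine ⟨?_, ?_⟩
  · refine ContinuousOn.mul (ContinuousOn.inv₀ (by fun_prop) fun p hp => ?_)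
      (hc.mono Metric.sphere_subset_closedBall)
    rw [sub_ne_zero]
    rintro rfl
    rw [Metric.mem_sphere, dist_self] at hp
    exact hr.1.ne hp
  · have := Complex.circleIntegral_sub_inv_smul_of_differentiable_on_off_countable
      Set.countable_empty (Metric.mem_ball_self hr.1) hc
      (fun p hp => (hr.2 p (Metric.ball_subset_closedBall hp.1)).differentiableAt)
    simp only [smul_eq_mul] at this
    rw [this, inv_mul_cancel_left₀ Complex.two_pi_I_ne_zero]

theorem of_analyticAt (h : AnalyticAt ℂ f α) : IsResidue f α 0 := by
  have h1 : AnalyticAt ℂ (fun p => (p - α) * f p) α := by fun_prop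
  have h2 := of_simple_pole h1
  rw [sub_self, zero_mul] at h2
  refine h2.congr ?_
  filter_upwards [self_mem_nhdsWithin] with p hp
  rw [inv_mul_cancel_left₀ (sub_ne_zero.2 hp)]

/-- An exact differential has no residue. -/
theorem of_hasDerivAt (h : ∀ᶠ p in 𝓝[≠] α, HasDerivAt g (f p) p)
    (hc : ∀ᶠ p in 𝓝[≠] α, ContinuousAt f p) : IsResidue f α 0 := by
  filter_upwards [eventually_forall_sphere h, eventually_forall_sphere hc, self_mem_nhdsWithin]
    with r h1 h2 h0
  refine ⟨fun p hp => (h2 p hp).continuousWithinAt, ?_⟩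
  rw [circleIntegral.integral_eq_zero_of_hasDerivWithinAt (le_of_lt h0) fun p hp =>
    (h1 p hp).hasDerivWithinAt, mul_zero]

end IsResidue

theorem analyticAt_log_div {α : ℂ} (hα : α ≠ 0) : AnalyticAt ℂ (fun p => Complex.log (p / α)) α := by
  refine AnalyticAt.clog (by fun_prop) ?_
  rw [div_self hα]
  exact Complex.one_mem_slitPlane

theorem hasDerivAt_log_div {α p : ℂ} (hα : α ≠ 0) (hp : p / α ∈ Complex.slitPlane) :
    HasDerivAt (fun p => Complex.log (p / α)) p⁻¹ p := by
  have h := ((hasDerivAt_id p).div_const α).clog hp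
  have hp0 : p ≠ 0 := fun h => Complex.slitPlane_ne_zero hp (by rw [h, zero_div])
  refine h.congr_deriv ?_
  simp only [id]
  field_simp

/-- The coordinate `t` with `p = α e^t` near `p = α`. -/
theorem eventually_log_div {α : ℂ} (hα : α ≠ 0) {P : ℂ → Prop} (h : ∀ᶠ t in 𝓝[≠] (0 : ℂ), P t) :
    ∀ᶠ p in 𝓝[≠] α, P (Complex.log (p / α)) ∧ p = α * Complex.exp (Complex.log (p / α)) ∧
      p / α ∈ Complex.slitPlane ∧ Complex.log (p / α) ≠ 0 := by
  have hl : Tendsto (fun p => Complex.log (p / α)) (𝓝 α) (𝓝 0) := by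
    have := (analyticAt_log_div hα).continuousAt.tendsto
    rwa [div_self hα, Complex.log_one] at this
  have hs : ∀ᶠ p in 𝓝 α, p / α ∈ Complex.slitPlane := by
    have hc : ContinuousAt (fun p => p / α) α := by fun_prop
    refine hc.eventually (Complex.isOpen_slitPlane.mem_nhds ?_)
    simp only [div_self hα]
    exact Complex.one_mem_slitPlane
  have hexp : ∀ p, p / α ∈ Complex.slitPlane → p = α * Complex.exp (Complex.log (p / α)) :=
    fun p hp => by rw [Complex.exp_log (Complex.slitPlane_ne_zero hp), mul_div_cancel₀ _ hα]
  have hne : ∀ᶠ p in 𝓝[≠] α, Complex.log (p / α) ≠ 0 := by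
    filter_upwards [self_mem_nhdsWithin, hs.filter_mono nhdsWithin_le_nhds] with p hp hps h0
    have := hexp p hps
    rw [h0, Complex.exp_zero, mul_one] at this
    exact hp this
  have hl' : Tendsto (fun p => Complex.log (p / α)) (𝓝[≠] α) (𝓝[≠] 0) :=
    tendsto_nhdsWithin_iff.2 ⟨hl.mono_left nhdsWithin_le_nhds, hne⟩
  filter_upwards [hl'.eventually h, hs.filter_mono nhdsWithin_le_nhds, hne] with p h1 h2 h3
  exact ⟨h1, hexp p h2, h2, h3⟩

theorem isResidue_inv_mul_log_inv {α : ℂ} (hα : α ≠ 0) :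
    IsResidue (fun p => p⁻¹ * (Complex.log (p / α))⁻¹) α 1 := by
  have ha := analyticAt_log_div hα
  have hd : deriv (fun p => Complex.log (p / α)) α = α⁻¹ := by
    refine (hasDerivAt_log_div hα ?_).deriv
    rw [div_self hα]
    exact Complex.one_mem_slitPlane
  obtain ⟨s, hs⟩ := ha
  have hg : AnalyticAt ℂ (dslope (fun p => Complex.log (p / α)) α) α :=
    (hs.has_fpower_series_dslope_fslope).analyticAt
  have h0 : dslope (fun p => Complex.log (p / α)) α α = α⁻¹ := by rw [dslope_same, hd]
  have hk : AnalyticAt ℂ (fun p => (p * dslope (fun p => Complex.log (p / α)) α p)⁻¹) α := by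
    refine AnalyticAt.inv (by fun_prop) ?_
    rw [h0, mul_inv_cancel₀ hα]
    exact one_ne_zero
  have := IsResidue.of_simple_pole hk
  simp only [h0, mul_inv_cancel₀ hα, inv_one] at this
  refine this.congr ?_
  filter_upwards [self_mem_nhdsWithin] with p hp
  rw [dslope_of_ne _ hp, slope_def_field, div_self hα, Complex.log_one, sub_zero, mul_inv, inv_div]
  have : p - α ≠ 0 := sub_ne_zero.2 hp
  field_simp

/-- The residue at `α` of `t^(-M-1) A(t) dt` in the coordinate `t = log (p / α)`. -/
theorem isResidue_of_hasJet {α : ℂ} (hα : α ≠ 0) {f A : ℂ → ℂ} {a : PowerSeries ℂ}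
    (hA : HasJet A a) (M : ℕ) (hf : ∀ᶠ t in 𝓝[≠] (0 : ℂ),
      α * Complex.exp t * f (α * Complex.exp t) = A t / t ^ (M + 1)) :
    IsResidue f α (PowerSeries.coeff M a) := by
  obtain ⟨B, hB, hAB⟩ := hA.exists_tail (M + 1)
  have hz : ∀ j, IsResidue (fun p => p⁻¹ * ((Complex.log (p / α)) ^ (j + 2))⁻¹) α 0 := by
    intro j
    refine IsResidue.of_hasDerivAt
      (g := fun p => -((j : ℂ) + 1)⁻¹ * ((Complex.log (p / α)) ^ (j + 1))⁻¹) ?_ ?_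
    · filter_upwards [eventually_log_div hα (P := fun _ => True) (by simp)] with p hp
      have h1 := (((hasDerivAt_log_div hα hp.2.2.1).pow (j + 1)).inv
        (pow_ne_zero _ hp.2.2.2)).const_mul (-((j : ℂ) + 1)⁻¹)
      refine h1.congr_deriv ?_
      have := Nat.cast_add_one_ne_zero (R := ℂ) j
      have := hp.2.2.2
      have hp0 : p ≠ 0 := fun h => Complex.slitPlane_ne_zero hp.2.2.1 (by rw [h, zero_div])
      push_cast
      simp only [Pi.pow_apply]
      field_simp
      ring
    · filter_upwards [eventually_log_div hα (P := fun _ => True) (by simp)] with p hp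
      have hp0 : p ≠ 0 := fun h => Complex.slitPlane_ne_zero hp.2.2.1 (by rw [h, zero_div])
      have := (hasDerivAt_log_div hα hp.2.2.1).continuousAt
      exact (continuousAt_id.inv₀ hp0).mul ((this.pow _).inv₀ (pow_ne_zero _ hp.2.2.2))
  have h1 : IsResidue (fun p => (∑ i ∈ Finset.range M, PowerSeries.coeff i a *
      (p⁻¹ * ((Complex.log (p / α)) ^ (M - 1 - i + 2))⁻¹)) +
      PowerSeries.coeff M a * (p⁻¹ * (Complex.log (p / α))⁻¹) +
      p⁻¹ * B (Complex.log (p / α))) α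
      ((∑ i ∈ Finset.range M, PowerSeries.coeff i a * 0) + PowerSeries.coeff M a * 1 + 0) := by
    refine ((IsResidue.sum _ fun i _ => (hz _).const_mul _).add
      ((isResidue_inv_mul_log_inv hα).const_mul _)).add (IsResidue.of_analyticAt ?_)
    refine (analyticAt_inv hα).mul (AnalyticAt.fun_comp ?_ (analyticAt_log_div hα))
    rwa [div_self hα, Complex.log_one]
  simp only [mul_zero, Finset.sum_const_zero, zero_add, mul_one, add_zero] at h1
  refine h1.congr ?_
  filter_upwards [eventually_log_div hα (hf.and hAB)] with p hp
  obtain ⟨⟨h2, h3⟩, h4, h5, h6⟩ := hp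
  rw [← h4] at h2
  have hp0 : p ≠ 0 := fun h => Complex.slitPlane_ne_zero h5 (by rw [h, zero_div])
  generalize Complex.log (p / α) = t at *
  have h7 : f p = p⁻¹ * (A t / t ^ (M + 1)) := by rw [← h2, inv_mul_cancel_left₀ hp0]
  rw [h7, h3, Finset.sum_range_succ, add_div, add_div, mul_add, mul_add, Finset.sum_div,
    Finset.mul_sum]
  congr 1
  · congr 1
    · refine Finset.sum_congr rfl fun i hi => ?_
      have hi := Finset.mem_range.1 hi
      have e : t ^ (M + 1) = t ^ (M - 1 - i + 2) * t ^ i := by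
        rw [← pow_add]; congr 1; omega
      rw [e]
      field_simp
    · rw [pow_succ]
      field_simp
  · field_simp

/-! ### The basis differentials -/

/-- The rational function `∑_{b ≡ ε} b^m z^(b-1)`, the sum running over the positive integers `b` of
parity `ε`. Its poles are at `z = ±1`. -/
noncomputable def parityEta (ε : ZMod 2) : ℕ → ℂ → ℂ
  | 0, z => (if ε = 0 then z else 1) / (1 - z ^ 2)
  | m + 1, z => deriv (fun w => w * parityEta ε m w) z

theorem parityEta_zero (ε : ZMod 2) (z : ℂ) :
    parityEta ε 0 z = (if ε = 0 then z else 1) / (1 - z ^ 2) := by rw [parityEta]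

theorem parityEta_succ (ε : ZMod 2) (m : ℕ) (z : ℂ) :
    parityEta ε (m + 1) z = deriv (fun w => w * parityEta ε m w) z := by rw [parityEta]

theorem isOpen_sq_ne_one : IsOpen {z : ℂ | z ^ 2 ≠ 1} :=
  isOpen_ne_fun (by fun_prop) continuous_const

theorem analyticAt_parityEta (ε : ZMod 2) (m : ℕ) {z : ℂ} (hz : z ^ 2 ≠ 1) :
    AnalyticAt ℂ (parityEta ε m) z := by
  induction m generalizing z with
  | zero =>
    have e : parityEta ε 0 = fun z => (if ε = 0 then z else 1) / (1 - z ^ 2) :=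
      funext (parityEta_zero ε)
    rw [e]
    refine AnalyticAt.div ?_ (by fun_prop) (sub_ne_zero.2 hz.symm)
    split_ifs <;> fun_prop
  | succ m ih =>
    have e : parityEta ε (m + 1) = deriv (fun w => w * parityEta ε m w) :=
      funext (parityEta_succ ε m)
    rw [e]
    exact (analyticAt_id.mul (ih hz)).deriv

theorem hasDerivAt_mul_parityEta (ε : ZMod 2) (m : ℕ) {z : ℂ} (hz : z ^ 2 ≠ 1) :
    HasDerivAt (fun w => w * parityEta ε m w) (parityEta ε (m + 1) z) z := by
  rw [parityEta_succ]
  exact (analyticAt_id.mul (analyticAt_parityEta ε m hz)).differentiableAt.hasDerivAt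

theorem zmod_two_cases (ε : ZMod 2) : ε = 0 ∨ ε = 1 := by
  revert ε; decide

/-- The behaviour at the branch point `-1` is, up to a sign, that at `1`. -/
theorem parityEta_sign_mul {α : ℂ} (hα : α ^ 2 = 1) (ε : ZMod 2) (m : ℕ) (z : ℂ) :
    parityEta ε m (α * z) = α ^ (ε.val + 1) * parityEta ε m z := by
  induction m generalizing z with
  | zero =>
    rw [parityEta_zero, parityEta_zero, mul_pow, hα, one_mul]
    rcases zmod_two_cases ε with rfl | rfl
    · simp [mul_div_assoc]
    · simp [ZMod.val_one, hα]
  | succ m ih =>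
    have h1 : (fun w => α * w * parityEta ε m (α * w)) =
        fun w => α ^ (ε.val + 2) * (w * parityEta ε m w) := by
      ext w
      rw [ih]; ring
    have h2 := deriv_comp_mul_left α (fun w => w * parityEta ε m w) z
    rw [h1, deriv_const_mul_field, ← parityEta_succ, ← parityEta_succ, smul_eq_mul] at h2
    have h0 : α ≠ 0 := by rintro rfl; norm_num at hα
    refine mul_left_cancel₀ h0 ?_
    rw [← h2]; ring

theorem inv_sq_ne_one {z : ℂ} (hz : z ^ 2 ≠ 1) : z⁻¹ ^ 2 ≠ 1 := by
  rwa [inv_pow, Ne, inv_eq_one]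

theorem parityEta_inv_aux (ε : ZMod 2) (m : ℕ) (c : ℂ)
    (h : ∀ z : ℂ, z ≠ 0 → z ^ 2 ≠ 1 →
      z⁻¹ * parityEta ε m z⁻¹ = (-1) ^ (m + 1) * (z * parityEta ε m z) + c)
    (z : ℂ) (h0 : z ≠ 0) (hz : z ^ 2 ≠ 1) :
    z⁻¹ * parityEta ε (m + 1) z⁻¹ = (-1) ^ (m + 2) * (z * parityEta ε (m + 1) z) := by
  have h1 := (hasDerivAt_mul_parityEta ε m (inv_sq_ne_one hz)).comp z (hasDerivAt_inv h0)
  have h2 := ((hasDerivAt_mul_parityEta ε m hz).const_mul ((-1) ^ (m + 1))).add_const c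
  have h3 : (fun z => (-1) ^ (m + 1) * (z * parityEta ε m z) + c) =ᶠ[𝓝 z]
      ((fun w => w * parityEta ε m w) ∘ fun z => z⁻¹) := by
    filter_upwards [isOpen_sq_ne_one.mem_nhds hz, isOpen_ne.mem_nhds h0] with w hw hw0
    exact (h w hw0 hw).symm
  have h4 := h1.unique (h2.congr_of_eventuallyEq h3.symm)
  have h5 : z⁻¹ * parityEta ε (m + 1) z⁻¹ = -z * (parityEta ε (m + 1) z⁻¹ * -(z ^ 2)⁻¹) := by
    field_simp
  rw [h5, h4]; ring

/-- The differentials of odd index are odd under the involution `z ↦ z⁻¹`. -/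
theorem parityEta_inv (ε : ZMod 2) (k : ℕ) {z : ℂ} (h0 : z ≠ 0) (hz : z ^ 2 ≠ 1) :
    z⁻¹ * parityEta ε (2 * k + 1) z⁻¹ = z * parityEta ε (2 * k + 1) z := by
  have key : ∀ m, ∀ z : ℂ, z ≠ 0 → z ^ 2 ≠ 1 →
      z⁻¹ * parityEta ε (m + 1) z⁻¹ = (-1) ^ (m + 2) * (z * parityEta ε (m + 1) z) := by
    intro m
    induction m with
    | zero =>
      refine parityEta_inv_aux ε 0 (if ε = 0 then -1 else 0) fun z h0 hz => ?_
      have h1 : 1 - z ^ 2 ≠ 0 := sub_ne_zero.2 hz.symm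
      have h2 : 1 - z⁻¹ ^ 2 ≠ 0 := sub_ne_zero.2 (inv_sq_ne_one hz).symm
      have h3 : z ^ 2 - 1 ≠ 0 := sub_ne_zero.2 hz
      rw [parityEta_zero, parityEta_zero]
      rcases zmod_two_cases ε with rfl | rfl
      · simp only [if_true]
        field_simp
        ring
      · simp only [one_ne_zero, if_false]
        field_simp
        ring
    | succ m ih =>
      refine parityEta_inv_aux ε (m + 1) 0 fun z h0 hz => ?_
      rw [ih z h0 hz, add_zero]
  rw [key (2 * k) z h0 hz, show 2 * k + 2 = 2 * (k + 1) by ring, pow_mul]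
  norm_num

theorem hasDerivAt_exp_mul_parityEta (ε : ZMod 2) (m : ℕ) {z t : ℂ}
    (h : (z * Complex.exp t) ^ 2 ≠ 1) :
    HasDerivAt (fun t => Complex.exp t * parityEta ε m (z * Complex.exp t))
      (Complex.exp t * parityEta ε (m + 1) (z * Complex.exp t)) t := by
  have h1 : HasDerivAt (fun t => z * Complex.exp t) (z * Complex.exp t) t :=
    (Complex.hasDerivAt_exp t).const_mul z
  have h2 := hasDerivAt_mul_parityEta ε m h
  have h3 := (analyticAt_parityEta ε m h).differentiableAt.hasDerivAt
  have h4 := ((hasDerivAt_id _).mul h3).unique h2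
  have h5 := (Complex.hasDerivAt_exp t).mul (h3.comp t h1)
  refine h5.congr_deriv ?_
  rw [← h4]
  simp only [Function.comp]
  ring

/-- The Taylor coefficients of `e^t η(z e^t)` in `t` are again basis functions, because `d/dt` acts
as `z d/dz`. -/
theorem hasJet_exp_mul_parityEta (ε : ZMod 2) (m : ℕ) {z : ℂ} (hz : z ^ 2 ≠ 1) :
    HasJet (fun t => Complex.exp t * parityEta ε m (z * Complex.exp t))
      (PowerSeries.mk fun n => parityEta ε (m + n) z / (n.factorial : ℂ)) := by
  have hopen : IsOpen {t : ℂ | (z * Complex.exp t) ^ 2 ≠ 1} :=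
    isOpen_ne_fun (by fun_prop) continuous_const
  have h0 : (0 : ℂ) ∈ {t : ℂ | (z * Complex.exp t) ^ 2 ≠ 1} := by simpa using hz
  have hn : ∀ n, ∀ t ∈ {t : ℂ | (z * Complex.exp t) ^ 2 ≠ 1},
      iteratedDeriv n (fun t => Complex.exp t * parityEta ε m (z * Complex.exp t)) t =
        Complex.exp t * parityEta ε (m + n) (z * Complex.exp t) := by
    intro n
    induction n with
    | zero => intro t _; rw [iteratedDeriv_zero, add_zero]
    | succ n ih =>
      intro t ht
      rw [iteratedDeriv_succ]
      have : iteratedDeriv n (fun t => Complex.exp t * parityEta ε m (z * Complex.exp t)) =ᶠ[𝓝 t]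
          fun t => Complex.exp t * parityEta ε (m + n) (z * Complex.exp t) :=
        Filter.eventually_of_mem (hopen.mem_nhds ht) ih
      rw [this.deriv_eq]
      exact (hasDerivAt_exp_mul_parityEta ε (m + n) ht).deriv
  have ha : AnalyticAt ℂ (fun t => Complex.exp t * parityEta ε m (z * Complex.exp t)) 0 := by
    refine AnalyticAt.mul (by fun_prop) (AnalyticAt.fun_comp ?_ (by fun_prop))
    simpa using analyticAt_parityEta ε m hz
  have := HasJet.of_analyticAt ha
  simp only [hn _ 0 h0, Complex.exp_zero, mul_one, one_mul] at this
  exact this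

/-! ### Expansions at the branch points -/

/-- The expansion of `sinh t / t`. -/
noncomputable def sinhcSeries : PowerSeries ℚ :=
  PowerSeries.mk fun n => (1 + (-1) ^ n) / 2 / ((n + 1).factorial : ℚ)

/-- Extension of scalars from `ℚ` to `ℂ`. -/
noncomputable abbrev toComplex : PowerSeries ℚ →+* PowerSeries ℂ :=
  PowerSeries.map (algebraMap ℚ ℂ)

theorem hasJet_exp : HasJet Complex.exp (toComplex (PowerSeries.exp ℚ)) := by
  have h := HasJet.of_analyticAt (f := Complex.exp) (by fun_prop)
  convert! h using 1
  ext n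
  have : iteratedDeriv n Complex.exp 0 = 1 := by
    rw [iteratedDeriv_eq_iterate, Complex.iter_deriv_exp, Complex.exp_zero]
  simp [PowerSeries.coeff_exp, this]

namespace HasJet

variable {f : ℂ → ℂ} {a b : PowerSeries ℂ}

theorem comp_neg (hf : HasJet f a) : HasJet (fun t => f (-t)) (PowerSeries.rescale (-1) a) := by
  have hneg : Tendsto (fun t : ℂ => -t) (𝓝[≠] 0) (𝓝[≠] 0) := by
    refine tendsto_nhdsWithin_iff.2 ⟨?_, ?_⟩
    · have : ContinuousAt (fun t : ℂ => -t) 0 := by fun_prop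
      simpa using this.tendsto.mono_left nhdsWithin_le_nhds
    · filter_upwards [self_mem_nhdsWithin] with t ht
      exact neg_ne_zero.2 ht
  filter_upwards [hneg.eventually hf] with t ht
  refine ht.congr_fun fun n => ?_
  rw [PowerSeries.coeff_rescale, neg_pow t]; ring

theorem inv (hf : HasJet f a) (hab : a * b = 1) : HasJet (fun t => (f t)⁻¹) b := by
  obtain ⟨F, hF, h, hn⟩ := hf.exists_analyticAt
  have h0 : F 0 ≠ 0 := by
    have h1 := hn 0
    simp only [iteratedDeriv_zero, Nat.factorial_zero, Nat.cast_one, div_one] at h1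
    have h2 := congrArg (PowerSeries.coeff 0) hab
    rw [PowerSeries.coeff_zero_eq_constantCoeff_apply, map_mul,
      ← PowerSeries.coeff_zero_eq_constantCoeff_apply, h1, PowerSeries.coeff_zero_one] at h2
    exact left_ne_zero_of_mul_eq_one h2
  have hFi := of_analyticAt (hF.inv h0)
  have hFj := of_analyticAt hF
  have hone : HasJet (fun _ => 1) (a * PowerSeries.mk fun n =>
      iteratedDeriv n F⁻¹ 0 / (n.factorial : ℂ)) := by
    have hFa : HasJet F a := hf.congr (h.mono fun t ht => ht.symm)
    refine (hFa.mul hFi).congr ?_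
    filter_upwards [(hF.continuousAt.eventually_ne h0).filter_mono nhdsWithin_le_nhds] with t ht
    rw [Pi.inv_apply, mul_inv_cancel₀ ht]
  have e := hone.unique one
  have e2 : b = PowerSeries.mk fun n => iteratedDeriv n F⁻¹ 0 / (n.factorial : ℂ) := by
    calc b = b * (a * PowerSeries.mk fun n => iteratedDeriv n F⁻¹ 0 / (n.factorial : ℂ)) := by
          rw [e, mul_one]
      _ = _ := by rw [← mul_assoc, mul_comm b, hab, one_mul]
  rw [e2]
  refine hFi.congr ?_
  filter_upwards [h] with t ht
  rw [ht, Pi.inv_apply]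

/-- Division by `t`. -/
theorem div_id (hf : HasJet f (PowerSeries.X * a)) : HasJet (fun t => f t / t) a := by
  filter_upwards [hf, self_mem_nhdsWithin] with t ht h0
  have h0 : t ≠ 0 := h0
  have h1 := (hasSum_nat_add_iff' 1).2 ht
  simp only [Finset.range_one, Finset.sum_singleton, PowerSeries.coeff_zero_X_mul, zero_mul,
    sub_zero, PowerSeries.coeff_succ_X_mul] at h1
  refine (h1.div_const t).congr_fun fun n => ?_
  rw [pow_succ]; field_simp

end HasJet

theorem hasJet_sinh_div : HasJet (fun t => Complex.sinh t / t) (toComplex sinhcSeries) := by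
  refine HasJet.div_id ?_
  have h := (hasJet_exp.const_mul (1 / 2)).add ((hasJet_exp.comp_neg).const_mul (-1 / 2))
  have e : PowerSeries.X * toComplex sinhcSeries =
      PowerSeries.C (1 / 2 : ℂ) * toComplex (PowerSeries.exp ℚ) + PowerSeries.C (-1 / 2 : ℂ) *
        PowerSeries.rescale (-1) (toComplex (PowerSeries.exp ℚ)) := by
    ext n
    rw [map_add, PowerSeries.coeff_C_mul, PowerSeries.coeff_C_mul, PowerSeries.coeff_rescale]
    cases n with
    | zero => simp; norm_num
    | succ n =>
      rw [PowerSeries.coeff_succ_X_mul]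
      simp only [PowerSeries.coeff_map, sinhcSeries, PowerSeries.coeff_mk, PowerSeries.coeff_exp]
      simp only [map_div₀, map_add, map_one, map_pow, map_neg, map_natCast, map_ofNat]
      rw [pow_succ]; ring
  rw [e]
  refine h.congr (Eventually.of_forall fun t => ?_)
  rw [Complex.sinh]; ring

/-- The expansion of `t / sinh t`. -/
noncomputable def sinhcInv : PowerSeries ℚ := sinhcSeries⁻¹

theorem constantCoeff_sinhcSeries : PowerSeries.constantCoeff sinhcSeries = 1 := by
  rw [← PowerSeries.coeff_zero_eq_constantCoeff_apply, sinhcSeries, PowerSeries.coeff_mk]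
  norm_num

theorem sinhcSeries_mul_sinhcInv : sinhcSeries * sinhcInv = 1 :=
  PowerSeries.mul_inv_cancel _ (by rw [constantCoeff_sinhcSeries]; exact one_ne_zero)

theorem constantCoeff_sinhcInv : PowerSeries.constantCoeff sinhcInv = 1 := by
  rw [sinhcInv, PowerSeries.constantCoeff_inv, constantCoeff_sinhcSeries, inv_one]

theorem hasJet_div_sinh : HasJet (fun t => t / Complex.sinh t) (toComplex sinhcInv) := by
  have h := hasJet_sinh_div.inv (b := toComplex sinhcInv) (by
    rw [← map_mul, sinhcSeries_mul_sinhcInv, map_one])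
  refine h.congr (Eventually.of_forall fun t => ?_)
  rw [inv_div]

/-- The expansion of `t^(m+1) · p η(p)` at `p = e^t`, for the basis function
`η = ∑_{b ≡ ε} b^m z^(b-1)`. -/
noncomputable def etaSeries (ε : ZMod 2) : ℕ → PowerSeries ℚ
  | 0 => PowerSeries.C (-1 / 2) * (if ε = 0 then PowerSeries.exp ℚ else 1) * sinhcInv
  | m + 1 => PowerSeries.X * PowerSeries.derivative ℚ (etaSeries ε m) -
      PowerSeries.C ((m : ℚ) + 1) * etaSeries ε m

/-- The leading term at the branch point does not depend on the parity `ε`; this is why the top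
degree part of the discrete volumes is a genuine polynomial. -/
theorem constantCoeff_etaSeries (ε : ZMod 2) (m : ℕ) :
    PowerSeries.constantCoeff (etaSeries ε m) = (-1) ^ (m + 1) * (m.factorial : ℚ) / 2 := by
  induction m with
  | zero =>
    rw [etaSeries, map_mul, map_mul, constantCoeff_sinhcInv, PowerSeries.constantCoeff_C]
    split_ifs <;> simp
  | succ m ih =>
    rw [etaSeries, map_sub, map_mul, map_mul, PowerSeries.constantCoeff_X, zero_mul,
      PowerSeries.constantCoeff_C, ih, Nat.factorial_succ]
    push_cast
    ring

theorem eventually_exp_sq_ne_one : ∀ᶠ t in 𝓝[≠] (0 : ℂ), Complex.exp t ^ 2 ≠ 1 := by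
  have h : AnalyticAt ℂ (fun t => Complex.exp t ^ 2 - 1) 0 := by fun_prop
  rcases h.eventually_eq_zero_or_eventually_ne_zero with h0 | h0
  · have h1 := (Filter.EventuallyEq.deriv (f := fun _ => 0) h0).eq_of_nhds
    have h2 : HasDerivAt (fun t => Complex.exp t ^ 2 - 1) _ (0 : ℂ) :=
      ((Complex.hasDerivAt_exp 0).pow 2).sub_const 1
    rw [h2.deriv] at h1
    simp at h1
  · filter_upwards [h0] with t ht h1
    exact ht (by rw [h1, sub_self])

/-- Every application of `z d/dz` raises the order of the pole at the branch points by one. -/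
theorem hasJet_parityEta (ε : ZMod 2) (m : ℕ) :
    HasJet (fun t => t ^ (m + 1) * (Complex.exp t * parityEta ε m (Complex.exp t)))
      (toComplex (etaSeries ε m)) := by
  induction m with
  | zero =>
    have h1 : HasJet (fun t => if ε = 0 then Complex.exp t else 1)
        (toComplex (if ε = 0 then PowerSeries.exp ℚ else 1)) := by
      split_ifs
      · exact hasJet_exp
      · rw [map_one]; exact HasJet.one
    have h := (h1.const_mul (-1 / 2)).mul hasJet_div_sinh
    have e : toComplex (etaSeries ε 0) = PowerSeries.C (-1 / 2 : ℂ) *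
        toComplex (if ε = 0 then PowerSeries.exp ℚ else 1) * toComplex sinhcInv := by
      rw [etaSeries, map_mul, map_mul, PowerSeries.map_C]
      simp
    rw [e]
    refine h.congr ?_
    filter_upwards [eventually_exp_sq_ne_one] with t ht
    have h1 : 1 - Complex.exp t ^ 2 ≠ 0 := sub_ne_zero.2 ht.symm
    have h2 : Complex.exp t ≠ 0 := Complex.exp_ne_zero t
    have h4 : Complex.exp t ^ 2 - 1 ≠ 0 := sub_ne_zero.2 ht
    have h3 : Complex.sinh t = (Complex.exp t ^ 2 - 1) / (2 * Complex.exp t) := by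
      rw [Complex.sinh, Complex.exp_neg]; field_simp
    rw [parityEta_zero, h3]
    split_ifs
    · field_simp
      ring
    · field_simp
      ring
  | succ m ih =>
    have h := (HasJet.id.mul ih.deriv).add (ih.const_mul (-((m : ℂ) + 1)))
    have e : toComplex (etaSeries ε (m + 1)) =
        PowerSeries.X * PowerSeries.derivative ℂ (toComplex (etaSeries ε m)) +
          PowerSeries.C (-((m : ℂ) + 1)) * toComplex (etaSeries ε m) := by
      have : toComplex (PowerSeries.derivative ℚ (etaSeries ε m)) =
          PowerSeries.derivative ℂ (toComplex (etaSeries ε m)) := by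
        ext n
        simp [PowerSeries.coeff_derivative]
      rw [etaSeries, map_sub, map_mul, map_mul, PowerSeries.map_C, PowerSeries.map_X, this]
      simp only [map_add, map_natCast, map_one, map_neg]
      ring
    rw [e]
    refine h.congr ?_
    filter_upwards [eventually_exp_sq_ne_one] with t ht
    have h1 := hasDerivAt_exp_mul_parityEta ε m (z := 1) (t := t) (by rwa [one_mul])
    simp only [one_mul] at h1
    have h2 := ((hasDerivAt_id t).pow (m + 1)).mul h1
    have h3 : deriv (fun t => t ^ (m + 1) * (Complex.exp t * parityEta ε m (Complex.exp t))) t = _ :=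
      h2.deriv
    rw [h3]
    simp only [id, Pi.pow_apply, Nat.add_sub_cancel]
    push_cast
    ring

/-! ### The recursion kernel at the branch points -/

/-- The expansion of `4 (sinh t)²`. -/
noncomputable def sinhSqSeries : PowerSeries ℚ :=
  PowerSeries.X ^ 2 * (PowerSeries.C 4 * sinhcSeries ^ 2)

theorem hasJet_sinhSq : HasJet (fun t => 4 * Complex.sinh t ^ 2) (toComplex sinhSqSeries) := by
  have h := (HasJet.id.pow 2).mul ((hasJet_sinh_div.pow 2).const_mul 4)
  have e : toComplex sinhSqSeries =
      PowerSeries.X ^ 2 * (PowerSeries.C 4 * toComplex sinhcSeries ^ 2) := by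
    rw [sinhSqSeries, map_mul, map_pow, map_mul, map_pow, PowerSeries.map_X, PowerSeries.map_C,
      map_ofNat]
  rw [e]
  refine h.congr ?_
  filter_upwards [self_mem_nhdsWithin] with t ht
  have ht : t ≠ 0 := ht
  field_simp

/-- The coefficient of `t^r` in `Ψ(t) ∏ (1 - 4 a_m (sinh t)²)⁻¹`, as a polynomial in the `q`-zeta
values. -/
noncomputable def zetaCoeff (Ψ : PowerSeries ℚ) (r : ℕ) : ZetaRing :=
  ∑ j ∈ Finset.range (r + 1),
    MvPolynomial.C (PowerSeries.coeff r (sinhSqSeries ^ j * Ψ)) * completeSymm j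

theorem coeff_sinhSqSeries_pow_mul_of_lt {Ψ : PowerSeries ℚ} {r j : ℕ} (h : r < 2 * j) :
    PowerSeries.coeff r (sinhSqSeries ^ j * Ψ) = 0 := by
  rw [sinhSqSeries, mul_pow, ← pow_mul, mul_assoc, PowerSeries.coeff_X_pow_mul', if_neg (by omega)]

theorem coeff_sinhSqSeries_pow_mul_self (Ψ : PowerSeries ℚ) (j : ℕ) :
    PowerSeries.coeff (2 * j) (sinhSqSeries ^ j * Ψ) = 4 ^ j * PowerSeries.constantCoeff Ψ := by
  rw [sinhSqSeries, mul_pow, ← pow_mul, mul_assoc, PowerSeries.coeff_X_pow_mul', if_pos le_rfl,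
    Nat.sub_self, PowerSeries.coeff_zero_eq_constantCoeff_apply, map_mul, map_pow, map_mul,
    map_pow, constantCoeff_sinhcSeries, PowerSeries.constantCoeff_C, one_pow, mul_one]

theorem eventually_norm_sinhSq_le {q : ℝ} (hq : 0 < q) (hq1 : q < 1) :
    ∀ᶠ t in 𝓝[≠] (0 : ℂ), ‖4 * Complex.sinh t ^ 2‖ ≤ qNode q 0 / 2 := by
  have hc : ContinuousAt (fun t => ‖4 * Complex.sinh t ^ 2‖) 0 := by fun_prop
  have h := hc.tendsto.eventually_lt_const (u := qNode q 0 / 2) (by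
    simpa using qNode_pos hq hq1 0)
  exact (h.filter_mono nhdsWithin_le_nhds).mono fun t ht => le_of_lt ht

/-- The coefficient of `t^r` only involves the first terms of the Taylor expansion of the inverse
product, because `4 (sinh t)²` vanishes to second order. -/
theorem hasJet_invProd_mul {q : ℝ} (hq : 0 < q) (hq1 : q < 1) {ψ : ℂ → ℂ} {Ψ : PowerSeries ℚ}
    (hψ : HasJet ψ (toComplex Ψ)) :
    HasJet (fun t => invProd q (4 * Complex.sinh t ^ 2) * ψ t)
      (PowerSeries.mk fun r => ((zetaEval q (zetaCoeff Ψ r) : ℝ) : ℂ)) := by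
  have htail : ∀ J, AnalyticAt ℂ (fun t => invProdTail q J (4 * Complex.sinh t ^ 2)) 0 := fun J => by
    refine AnalyticAt.fun_comp ?_ (by fun_prop)
    simpa using analyticAt_invProdTail hq hq1 J
  have hJ : ∀ J, ∃ γ : PowerSeries ℂ,
      HasJet (fun t => invProd q (4 * Complex.sinh t ^ 2) * ψ t)
        (∑ j ∈ Finset.range J, PowerSeries.C (zetaEval q (completeSymm j) : ℂ) *
          toComplex (sinhSqSeries ^ j * Ψ) + toComplex sinhSqSeries ^ J * γ) := fun J => by
    refine ⟨_, HasJet.congr (HasJet.add (HasJet.sum _ fun j _ => HasJet.const_mul _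
      (f := fun t => (4 * Complex.sinh t ^ 2) ^ j * ψ t) ?_)
      ((hasJet_sinhSq.pow J).mul ((HasJet.of_analyticAt (htail J)).mul hψ))) ?_⟩
    · rw [map_mul, map_pow]
      exact (hasJet_sinhSq.pow j).mul hψ
    · filter_upwards [eventually_norm_sinhSq_le hq hq1] with t ht
      rw [invProd_eq_sum_add hq hq1 ht J, add_mul, Finset.sum_mul]
      congr 1
      · exact Finset.sum_congr rfl fun j _ => by ring
      · ring
  obtain ⟨γ₀, h₀⟩ := hJ 0
  convert! h₀ using 1
  ext r
  -- with `r + 1` terms split off, the remainder does not contribute to the coefficient of `t^r`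
  obtain ⟨γ, h⟩ := hJ (r + 1)
  rw [h₀.unique h, map_add, map_sum, PowerSeries.coeff_mk, zetaCoeff, map_sum]
  have e : PowerSeries.coeff r (toComplex sinhSqSeries ^ (r + 1) * γ) = 0 := by
    have e' : toComplex sinhSqSeries =
        PowerSeries.X ^ 2 * toComplex (PowerSeries.C 4 * sinhcSeries ^ 2) := by
      rw [sinhSqSeries, map_mul, map_pow, PowerSeries.map_X]
    rw [e', mul_pow, ← pow_mul, mul_assoc, PowerSeries.coeff_X_pow_mul', if_neg (by omega)]
  rw [e, add_zero, Complex.ofReal_sum]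
  refine Finset.sum_congr rfl fun j _ => ?_
  rw [PowerSeries.coeff_C_mul, PowerSeries.coeff_map, map_mul, zetaEval, MvPolynomial.aeval_C]
  simp [mul_comm]

/-- The infinite product of the curve, as a product over `1 - a_m (z - z⁻¹)²`. -/
theorem okuyamaY_eq {q : ℝ} (hq : 0 < q) (hq1 : q < 1) {z : ℂ} (hz : z ≠ 0) :
    okuyamaY q z = 1 / 2 * (z - z⁻¹) *
      ∏' m, (1 - (((qNode q m)⁻¹ : ℝ) : ℂ) * (z - z⁻¹) ^ 2) := by
  rw [okuyamaY]
  congr 1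
  refine tprod_congr fun m => ?_
  have h1 : (1 - (q : ℂ) ^ (m + 1)) ≠ 0 := by
    have := (one_sub_qpow_pos hq hq1 (Nat.succ_ne_zero m)).ne'
    exact_mod_cast this
  rw [inv_qNode_eq hq]
  push_cast
  field_simp
  ring

theorem eq_one_or_neg_one_of_sq {α : ℂ} (hα : α ^ 2 = 1) : α = 1 ∨ α = -1 := by
  have h : (α - 1) * (α + 1) = 0 := by linear_combination hα
  rcases mul_eq_zero.1 h with h | h
  · exact Or.inl (sub_eq_zero.1 h)
  · exact Or.inr (eq_neg_of_add_eq_zero_left h)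

/-- The numerator `α sinh t / ((1 - α z e^t) (1 - α z e^(-t)))` of the recursion kernel at
`p = α e^t`, in terms of the basis functions. -/
noncomputable def kernelNum (α z t : ℂ) : ℂ :=
  ∑ ε : ZMod 2, α ^ ε.val * (1 / 2 * (Complex.exp t * parityEta ε 0 (z * Complex.exp t)) +
    -1 / 2 * (Complex.exp (-t) * parityEta ε 0 (z * Complex.exp (-t))))

/-- The factor `p / (p - w)² + p⁻¹ / (p⁻¹ - w)²` at `p = α e^t`, in terms of the basis functions. -/
noncomputable def bergmanNum (α w t : ℂ) : ℂ :=
  ∑ ε : ZMod 2, α ^ ε.val * (Complex.exp t * parityEta ε 1 (w * Complex.exp t) +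
    Complex.exp (-t) * parityEta ε 1 (w * Complex.exp (-t)))

/-- The expansion of `kernelNum`. -/
noncomputable def kernelSeries (α z : ℂ) : PowerSeries ℂ := PowerSeries.mk fun n =>
  if Even n then 0 else ∑ ε : ZMod 2, α ^ ε.val * (parityEta ε n z / (n.factorial : ℂ))

/-- The expansion of `bergmanNum`. -/
noncomputable def bergmanSeries (α w : ℂ) : PowerSeries ℂ := PowerSeries.mk fun n =>
  if Even n then ∑ ε : ZMod 2, α ^ ε.val * (2 * parityEta ε (n + 1) w / (n.factorial : ℂ)) else 0

theorem hasJet_kernelNum (α : ℂ) {z : ℂ} (hz : z ^ 2 ≠ 1) :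
    HasJet (kernelNum α z) (kernelSeries α z) := by
  have h := HasJet.sum Finset.univ fun (ε : ZMod 2) _ =>
    (((hasJet_exp_mul_parityEta ε 0 hz).const_mul (1 / 2)).add
      ((hasJet_exp_mul_parityEta ε 0 hz).comp_neg.const_mul (-1 / 2))).const_mul (α ^ ε.val)
  convert! h using 1
  ext n
  rw [kernelSeries, PowerSeries.coeff_mk, map_sum]
  simp only [PowerSeries.coeff_C_mul, map_add, PowerSeries.coeff_rescale, PowerSeries.coeff_mk,
    zero_add]
  split_ifs with hn
  · rw [hn.neg_one_pow]
    exact (Finset.sum_eq_zero fun ε _ => by ring).symm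
  · rw [(Nat.not_even_iff_odd.1 hn).neg_one_pow]
    exact Finset.sum_congr rfl fun ε _ => by ring

theorem hasJet_bergmanNum (α : ℂ) {w : ℂ} (hw : w ^ 2 ≠ 1) :
    HasJet (bergmanNum α w) (bergmanSeries α w) := by
  have h := HasJet.sum Finset.univ fun (ε : ZMod 2) _ =>
    ((hasJet_exp_mul_parityEta ε 1 hw).add
      ((hasJet_exp_mul_parityEta ε 1 hw).comp_neg)).const_mul (α ^ ε.val)
  convert! h using 1
  ext n
  rw [bergmanSeries, PowerSeries.coeff_mk, map_sum]
  simp only [PowerSeries.coeff_C_mul, map_add, PowerSeries.coeff_rescale, PowerSeries.coeff_mk,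
    add_comm 1 n]
  split_ifs with hn
  · rw [hn.neg_one_pow]
    exact Finset.sum_congr rfl fun ε _ => by ring
  · rw [(Nat.not_even_iff_odd.1 hn).neg_one_pow]
    exact (Finset.sum_eq_zero fun ε _ => by ring).symm

theorem sum_zmod_two {A : Type*} [AddCommMonoid A] (f : ZMod 2 → A) :
    ∑ ε : ZMod 2, f ε = f 0 + f 1 := Fin.sum_univ_two f

theorem sum_sign_mul_parityEta_zero {α w : ℂ} (hα : α ^ 2 = 1) (hw : w ^ 2 ≠ 1) :
    ∑ ε : ZMod 2, α ^ ε.val * parityEta ε 0 w = α / (1 - α * w) := by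
  have h1 : 1 - w ^ 2 ≠ 0 := sub_ne_zero.2 hw.symm
  have h2 : 1 - α * w ≠ 0 := fun h => hw (by linear_combination -(1 + α * w) * h + w ^ 2 * (-hα))
  rw [sum_zmod_two, parityEta_zero, parityEta_zero]
  simp only [ZMod.val_zero, ZMod.val_one, if_true, one_ne_zero, if_false, pow_zero, pow_one]
  rw [eq_div_iff h2]
  field_simp
  linear_combination (-w) * hα

theorem sum_sign_mul_parityEta_one {α w : ℂ} (hα : α ^ 2 = 1) (hw : w ^ 2 ≠ 1) :
    ∑ ε : ZMod 2, α ^ ε.val * parityEta ε 1 w = α / (1 - α * w) ^ 2 := by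
  have h2 : 1 - α * w ≠ 0 := fun h => hw (by linear_combination -(1 + α * w) * h + w ^ 2 * (-hα))
  have h3 : HasDerivAt (fun w => ∑ ε : ZMod 2, α ^ ε.val * (w * parityEta ε 0 w))
      (∑ ε : ZMod 2, α ^ ε.val * parityEta ε 1 w) w :=
    HasDerivAt.fun_sum fun ε _ => (hasDerivAt_mul_parityEta ε 0 hw).const_mul _
  have h4 : HasDerivAt (fun w => α * w / (1 - α * w)) (α / (1 - α * w) ^ 2) w := by
    have := ((hasDerivAt_id w).const_mul α).div (((hasDerivAt_id w).const_mul α).const_sub 1) h2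
    refine this.congr_deriv ?_
    simp only [id]
    field_simp
    ring
  refine h3.unique (h4.congr_of_eventuallyEq ?_)
  filter_upwards [isOpen_sq_ne_one.mem_nhds hw] with v hv
  rw [mul_div_right_comm, ← sum_sign_mul_parityEta_zero hα hv, Finset.sum_mul]
  exact Finset.sum_congr rfl fun ε _ => by ring

/-- Conditions that hold near the branch point, away from it. -/
theorem eventually_mul_exp_sq_ne {z : ℂ} (hz : z ^ 2 ≠ 1) :
    ∀ᶠ t in 𝓝[≠] (0 : ℂ), (z * Complex.exp t) ^ 2 ≠ 1 ∧ (z * Complex.exp (-t)) ^ 2 ≠ 1 := by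
  have h1 : ContinuousAt (fun t => (z * Complex.exp t) ^ 2) 0 := by fun_prop
  have h2 : ContinuousAt (fun t => (z * Complex.exp (-t)) ^ 2) 0 := by fun_prop
  exact ((h1.eventually_ne (by simpa using hz)).and
    (h2.eventually_ne (by simpa using hz))).filter_mono nhdsWithin_le_nhds

theorem bergmanNum_eq {α w t : ℂ} (hα : α ^ 2 = 1) (h1 : (w * Complex.exp t) ^ 2 ≠ 1)
    (h2 : (w * Complex.exp (-t)) ^ 2 ≠ 1) {p : ℂ} (hp : p = α * Complex.exp t) :
    p * (1 / (p - w) ^ 2) = ∑ ε : ZMod 2, α ^ ε.val *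
        (Complex.exp (-t) * parityEta ε 1 (w * Complex.exp (-t))) ∧
      p⁻¹ * (1 / (p⁻¹ - w) ^ 2) = ∑ ε : ZMod 2, α ^ ε.val *
        (Complex.exp t * parityEta ε 1 (w * Complex.exp t)) := by
  have hα0 : α ≠ 0 := by rintro rfl; norm_num at hα
  have hαi : α⁻¹ = α := inv_eq_of_mul_eq_one_right (by rw [← sq, hα])
  have hpi : p⁻¹ = α * Complex.exp (-t) := by rw [hp, mul_inv, hαi, Complex.exp_neg]
  have key : ∀ s : ℂ, (w * Complex.exp (-s)) ^ 2 ≠ 1 →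
      α * Complex.exp s * (1 / (α * Complex.exp s - w) ^ 2) = ∑ ε : ZMod 2, α ^ ε.val *
        (Complex.exp (-s) * parityEta ε 1 (w * Complex.exp (-s))) := fun s hs => by
    have e : ∀ ε : ZMod 2, α ^ ε.val * (Complex.exp (-s) * parityEta ε 1 (w * Complex.exp (-s))) =
        Complex.exp (-s) * (α ^ ε.val * parityEta ε 1 (w * Complex.exp (-s))) := fun ε => by ring
    simp only [e]
    rw [← Finset.mul_sum, sum_sign_mul_parityEta_one hα hs, Complex.exp_neg]
    have h0 := Complex.exp_ne_zero s
    have h3 : α * Complex.exp s - w = α * Complex.exp s * (1 - α * (w * (Complex.exp s)⁻¹)) := by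
      field_simp
      linear_combination w * hα
    rw [h3, mul_pow, mul_pow, hα]
    field_simp
  refine ⟨hp ▸ key t h2, ?_⟩
  rw [hpi]
  have := key (-t) (by rwa [neg_neg])
  rwa [neg_neg] at this

theorem deriv_okuyamaX {p : ℂ} (hp : p ≠ 0) : deriv okuyamaX p = 1 - (p ^ 2)⁻¹ := by
  have : HasDerivAt okuyamaX (1 + -(p ^ 2)⁻¹) p := (hasDerivAt_id p).add (hasDerivAt_inv hp)
  rw [this.deriv, sub_eq_add_neg]

/-- The recursion kernel near the branch point `α`, in the coordinate `t` with `p = α e^t`. -/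
theorem eventually_recursionKernel_eq {q : ℝ} (hq : 0 < q) (hq1 : q < 1) {α z : ℂ}
    (hα : α ^ 2 = 1) (hz : z ^ 2 ≠ 1) : ∀ᶠ t in 𝓝[≠] (0 : ℂ),
      α * Complex.exp t * (recursionKernel okuyamaX (okuyamaY q) (fun z => z⁻¹) z
        (α * Complex.exp t) * deriv (fun z => z⁻¹) (α * Complex.exp t)) =
      kernelNum α z t * invProd q (4 * Complex.sinh t ^ 2) / (4 * Complex.sinh t ^ 2) := by
  filter_upwards [eventually_exp_sq_ne_one, eventually_mul_exp_sq_ne hz,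
    eventually_norm_sinhSq_le hq hq1] with t ht hzt ht'
  have hα0 : α ≠ 0 := by rintro rfl; norm_num at hα
  have hαi : α⁻¹ = α := inv_eq_of_mul_eq_one_right (by rw [← sq, hα])
  have hE := Complex.exp_ne_zero t
  have hP := invProd_mul_tprod hq hq1 ht'
  have hp0 : α * Complex.exp t ≠ 0 := mul_ne_zero hα0 hE
  have hsinh : Complex.sinh t = (Complex.exp t - (Complex.exp t)⁻¹) / 2 := by
    rw [Complex.sinh, Complex.exp_neg]
  have hpi : (α * Complex.exp t)⁻¹ = α * (Complex.exp t)⁻¹ := by rw [mul_inv, hαi]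
  have hu : (α * Complex.exp t - (α * Complex.exp t)⁻¹) ^ 2 = 4 * Complex.sinh t ^ 2 := by
    rw [hpi, ← mul_sub, mul_pow, hα, hsinh]; ring
  have hu' : ((α * Complex.exp t)⁻¹ - (α * Complex.exp t)⁻¹⁻¹) ^ 2 = 4 * Complex.sinh t ^ 2 := by
    rw [inv_inv, ← hu]; ring
  have hnum : kernelNum α z t = 1 / 2 * (Complex.exp t * (α / (1 - α * (z * Complex.exp t)))) +
      -1 / 2 * (Complex.exp (-t) * (α / (1 - α * (z * Complex.exp (-t))))) := by
    rw [← sum_sign_mul_parityEta_zero hα hzt.1, ← sum_sign_mul_parityEta_zero hα hzt.2, kernelNum]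
    simp only [Finset.mul_sum, ← Finset.sum_add_distrib]
    exact Finset.sum_congr rfl fun ε _ => by ring
  rw [recursionKernel, okuyamaY_eq hq hq1 hp0, okuyamaY_eq hq hq1 (inv_ne_zero hp0), hu, hu',
    deriv_okuyamaX hp0, (hasDerivAt_inv hp0).deriv, inv_inv, hnum, hpi, Complex.exp_neg]
  generalize invProd q (4 * Complex.sinh t ^ 2) = F at *
  generalize ∏' m, (1 - (((qNode q m)⁻¹ : ℝ) : ℂ) * (4 * Complex.sinh t ^ 2)) = P at *
  rw [Complex.exp_neg] at hzt
  rw [hsinh]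
  generalize Complex.exp t = E at *
  have hP0 : P ≠ 0 := right_ne_zero_of_mul_eq_one hP
  have hF : F = P⁻¹ := eq_inv_of_mul_eq_one_left hP
  have h5 : E ^ 2 - 1 ≠ 0 := sub_ne_zero.2 ht
  have hz1 : 1 - α * (z * E) ≠ 0 := fun h => hzt.1 (by
    linear_combination -(1 + α * (z * E)) * h + (z * E) ^ 2 * (-hα))
  have hz2 : 1 - α * (z * E⁻¹) ≠ 0 := fun h => hzt.2 (by
    linear_combination -(1 + α * (z * E⁻¹)) * h + (z * E⁻¹) ^ 2 * (-hα))
  have e1 : z - α * E⁻¹ = -(α * E⁻¹) * (1 - α * (z * E)) := by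
    field_simp
    linear_combination -(E * z) * hα
  have e2 : z - α * E = -(α * E) * (1 - α * (z * E⁻¹)) := by
    field_simp
    linear_combination -z * hα
  have e3 : 1 - ((α * E) ^ 2)⁻¹ = (E ^ 2 - 1) / E ^ 2 := by
    rw [mul_pow, hα]; field_simp
  have e4 : E - E⁻¹ = (E ^ 2 - 1) / E := by field_simp
  have e5 : α * E - α * E⁻¹ = α * ((E ^ 2 - 1) / E) := by rw [← e4]; ring
  have e6 : α * E⁻¹ - α * E = -(α * ((E ^ 2 - 1) / E)) := by rw [← e4]; ring
  have e7 : -((α * E) ^ 2)⁻¹ = -(E ^ 2)⁻¹ := by rw [mul_pow, hα, one_mul]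
  rw [e1, e2, e3, e5, e6, e7, e4, hF]
  generalize 1 - α * (z * E) = A at *
  generalize 1 - α * (z * E⁻¹) = B at *
  obtain rfl | rfl := eq_one_or_neg_one_of_sq hα
  · field_simp
    ring
  · field_simp
    ring

/-! ### Residues of the recursion -/

/-- The expansion of `Ψ(t) (t / (2 sinh t))² ∏ (1 - 4 a_m (sinh t)²)⁻¹`: the part of the recursion
kernel that does not depend on `z₁`, times `Ψ`. -/
noncomputable def zetaSeries (q : ℝ) (Ψ : PowerSeries ℚ) : PowerSeries ℂ :=
  PowerSeries.mk fun r => ((zetaEval q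
    (zetaCoeff (PowerSeries.C (1 / 4) * sinhcInv ^ 2 * Ψ) r) : ℝ) : ℂ)

/-- The recursion kernel at `p`, together with the factor from `d(σ(p)) = σ'(p) dp`. -/
noncomputable def signedKernel (q : ℝ) (z p : ℂ) : ℂ :=
  recursionKernel okuyamaX (okuyamaY q) (fun z => z⁻¹) z p * deriv (fun z => z⁻¹) p

/-- The residue at `α` of the recursion kernel times a function that is `Q(t) ψ(t) t^(-N)` at
`p = α e^t`: the kernel contributes `kernelSeries / (4 sinh² t)` and the inverse product. -/
theorem isResidue_signedKernel_mul {q : ℝ} (hq : 0 < q) (hq1 : q < 1) {α z : ℂ}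
    (hα : α ^ 2 = 1) (hz : z ^ 2 ≠ 1) {Y Q ψ : ℂ → ℂ} {b : PowerSeries ℂ} {Ψ : PowerSeries ℚ}
    (N : ℕ) (hQ : HasJet Q b) (hψ : HasJet ψ (toComplex Ψ))
    (hY : ∀ᶠ t in 𝓝[≠] (0 : ℂ), Y (α * Complex.exp t) = Q t * ψ t / t ^ N) :
    IsResidue (fun p => signedKernel q z p * Y p) α
      (PowerSeries.coeff (N + 1) (kernelSeries α z * b * zetaSeries q Ψ)) := by
  have hα0 : α ≠ 0 := by rintro rfl; norm_num at hα
  have h1 : HasJet (fun t => 1 / 4 * (t / Complex.sinh t) ^ 2 * ψ t)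
      (toComplex (PowerSeries.C (1 / 4) * sinhcInv ^ 2 * Ψ)) := by
    rw [map_mul, map_mul, map_pow, PowerSeries.map_C, map_div₀, map_one, map_ofNat]
    exact ((hasJet_div_sinh.pow 2).const_mul (1 / 4)).mul hψ
  refine isResidue_of_hasJet hα0
    (((hasJet_kernelNum α hz).mul hQ).mul (hasJet_invProd_mul hq hq1 h1)) (N + 1) ?_
  filter_upwards [hY, eventually_recursionKernel_eq hq hq1 hα hz, self_mem_nhdsWithin]
    with t h2 h3 ht
  have ht : t ≠ 0 := ht
  rw [signedKernel, ← mul_assoc, h3, h2, pow_add, pow_add, div_pow]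
  ring_nf
  field_simp

theorem sum_range_two_mul {A : Type*} [AddCommMonoid A] (f : ℕ → A) (n : ℕ) :
    ∑ i ∈ Finset.range (2 * n), f i =
      ∑ i ∈ Finset.range n, f (2 * i) + ∑ i ∈ Finset.range n, f (2 * i + 1) := by
  induction n with
  | zero => simp
  | succ n ih =>
    rw [mul_add, mul_one, Finset.sum_range_succ, Finset.sum_range_succ, ih,
      Finset.sum_range_succ _ n, Finset.sum_range_succ _ n, add_assoc, add_assoc, add_assoc,
      add_left_comm (f (2 * n))]

section coefficients
variable {a b : PowerSeries ℂ}

theorem coeff_odd_mul (ha : ∀ n, Even n → PowerSeries.coeff n a = 0) (μ : ℕ) :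
    PowerSeries.coeff (2 * μ + 1) (a * b) = ∑ i ∈ Finset.range (μ + 1),
      PowerSeries.coeff (2 * i + 1) a * PowerSeries.coeff (2 * (μ - i)) b := by
  rw [PowerSeries.coeff_mul, Finset.Nat.sum_antidiagonal_eq_sum_range_succ_mk,
    show (2 * μ + 1).succ = 2 * (μ + 1) by omega, sum_range_two_mul,
    Finset.sum_eq_zero fun i _ => by rw [ha _ (even_two_mul i), zero_mul], zero_add]
  refine Finset.sum_congr rfl fun i _ => ?_
  rw [show 2 * μ + 1 - (2 * i + 1) = 2 * (μ - i) by omega]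

theorem coeff_even_odd_mul (ha : ∀ n, Even n → PowerSeries.coeff n a = 0)
    (hb : ∀ n, ¬ Even n → PowerSeries.coeff n b = 0) (n : ℕ) (hn : Even n) :
    PowerSeries.coeff n (a * b) = 0 := by
  rw [PowerSeries.coeff_mul]
  refine Finset.sum_eq_zero fun p hp => ?_
  have hp := Finset.HasAntidiagonal.mem_antidiagonal.1 hp
  by_cases h : Even p.1
  · rw [ha _ h, zero_mul]
  · rw [hb p.2 fun h2 => h (by rw [← hp] at hn; exact (Nat.even_add.1 hn).2 h2), mul_zero]

end coefficients

theorem sum_range_eq_sum_ite {A : Type*} [AddCommMonoid A] {μ K : ℕ} (h : μ < K) (f : ℕ → A) :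
    ∑ i ∈ Finset.range (μ + 1), f i = ∑ i ∈ Finset.range K, if i ≤ μ then f i else 0 := by
  rw [← Finset.sum_filter]
  refine Finset.sum_congr ?_ fun _ _ => rfl
  ext i
  simp only [Finset.mem_range, Finset.mem_filter]
  omega

theorem sum_range_sum_range_eq {A : Type*} [AddCommMonoid A] {μ K : ℕ} (h : μ < K)
    (f : ℕ → ℕ → A) :
    ∑ a ∈ Finset.range (μ + 1), ∑ i ∈ Finset.range (a + 1), f i (a - i) =
      ∑ i ∈ Finset.range K, ∑ j ∈ Finset.range K, if i + j ≤ μ then f i j else 0 := by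
  rw [← Finset.sum_product', ← Finset.sum_filter, Finset.sum_sigma']
  refine Finset.sum_bij' (fun x _ => (x.2, x.1 - x.2)) (fun x _ => ⟨x.1 + x.2, x.1⟩) ?_ ?_ ?_ ?_ ?_
  · rintro ⟨a, i⟩ h
    simp only [Finset.mem_sigma, Finset.mem_range, Finset.mem_filter, Finset.mem_product] at h ⊢
    omega
  · rintro ⟨i, j⟩ h
    simp only [Finset.mem_sigma, Finset.mem_range, Finset.mem_filter, Finset.mem_product] at h ⊢
    omega
  · rintro ⟨a, i⟩ h
    simp only [Finset.mem_sigma, Finset.mem_range] at h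
    simp only [Sigma.mk.injEq, heq_eq_eq, and_true]
    omega
  · rintro ⟨i, j⟩ h
    simp
  · intro x _
    rfl

theorem coeff_kernelSeries_even (α z : ℂ) (n : ℕ) (hn : Even n) :
    PowerSeries.coeff n (kernelSeries α z) = 0 := by
  rw [kernelSeries, PowerSeries.coeff_mk, if_pos hn]

theorem coeff_kernelSeries_odd (α z : ℂ) (i : ℕ) :
    PowerSeries.coeff (2 * i + 1) (kernelSeries α z) =
      ∑ ε : ZMod 2, α ^ ε.val * (parityEta ε (2 * i + 1) z / ((2 * i + 1).factorial : ℂ)) := by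
  rw [kernelSeries, PowerSeries.coeff_mk, if_neg (by simp)]

theorem coeff_bergmanSeries_odd (α z : ℂ) (n : ℕ) (hn : ¬ Even n) :
    PowerSeries.coeff n (bergmanSeries α z) = 0 := by
  rw [bergmanSeries, PowerSeries.coeff_mk, if_neg hn]

theorem coeff_bergmanSeries_even (α z : ℂ) (j : ℕ) :
    PowerSeries.coeff (2 * j) (bergmanSeries α z) =
      ∑ ε : ZMod 2, α ^ ε.val * (2 * parityEta ε (2 * j + 1) z / ((2 * j).factorial : ℂ)) := by
  rw [bergmanSeries, PowerSeries.coeff_mk, if_pos (even_two_mul j)]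

/-- The index of the basis differential `∑_{b ≡ ε} b^(2k+1) z^(b-1) dz`. -/
abbrev EtaIndex : Type := ZMod 2 × ℕ

/-- The basis differential with index `κ = (ε, k)`, as the coefficient of `dz`. -/
noncomputable def etaBasis (κ : EtaIndex) (z : ℂ) : ℂ := parityEta κ.1 (2 * κ.2 + 1) z

/-- The coefficient with which the pair `η_{κ₁}(p) η_{κ₂}(σ(p))` contributes the `i`-th basis
differentials to the residue. -/
noncomputable def pairCoeff (κ₁ κ₂ : EtaIndex) (i : ℕ) : ZetaRing :=
  if i ≤ κ₁.2 + κ₂.2 + 2 then MvPolynomial.C (1 / ((2 * i + 1).factorial : ℚ)) *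
    zetaCoeff (PowerSeries.C (1 / 4) * sinhcInv ^ 2 *
      (etaSeries κ₁.1 (2 * κ₁.2 + 1) * etaSeries κ₂.1 (2 * κ₂.2 + 1)))
      (2 * (κ₁.2 + κ₂.2 + 2 - i)) else 0

/-- The coefficient with which `η_κ` contributes the products of the `i`-th and the `j`-th basis
differentials to the residue that contains `ω_{0,2}`. -/
noncomputable def singleCoeff (κ : EtaIndex) (i j : ℕ) : ZetaRing :=
  if i + j ≤ κ.2 + 1 then
    MvPolynomial.C (2 / ((2 * i + 1).factorial * (2 * j).factorial : ℚ)) *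
    zetaCoeff (PowerSeries.C (1 / 4) * sinhcInv ^ 2 * etaSeries κ.1 (2 * κ.2 + 1))
      (2 * (κ.2 + 1 - (i + j))) else 0

theorem zetaEval_C_mul (q : ℝ) (c : ℚ) (h : ZetaRing) :
    zetaEval q (MvPolynomial.C c * h) = c * zetaEval q h := by
  rw [map_mul, zetaEval, MvPolynomial.aeval_C]; rfl

theorem coeff_zetaSeries (q : ℝ) (Ψ : PowerSeries ℚ) (r : ℕ) :
    PowerSeries.coeff r (zetaSeries q Ψ) = ((zetaEval q
      (zetaCoeff (PowerSeries.C (1 / 4) * sinhcInv ^ 2 * Ψ) r) : ℝ) : ℂ) := by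
  rw [zetaSeries, PowerSeries.coeff_mk]

/-- `p η(p)` near the branch point `α`. -/
theorem mul_etaBasis_eq {α : ℂ} (hα : α ^ 2 = 1) (κ : EtaIndex) {t : ℂ} (ht : t ≠ 0) :
    α * Complex.exp t * etaBasis κ (α * Complex.exp t) = α ^ κ.1.val *
      (t ^ (2 * κ.2 + 1 + 1) * (Complex.exp t * parityEta κ.1 (2 * κ.2 + 1) (Complex.exp t))) /
        t ^ (2 * κ.2 + 2) := by
  rw [etaBasis, parityEta_sign_mul hα, pow_succ]
  field_simp
  linear_combination (α ^ κ.1.val * parityEta κ.1 (2 * κ.2 + 1) (Complex.exp t)) * hα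

theorem etaBasis_inv (κ : EtaIndex) {z : ℂ} (h0 : z ≠ 0) (hz : z ^ 2 ≠ 1) :
    etaBasis κ z⁻¹ = z * (z * etaBasis κ z) := by
  rw [etaBasis, etaBasis, ← parityEta_inv κ.1 κ.2 h0 hz, mul_inv_cancel_left₀ h0]

/-- The residue of the kernel times a product of two basis differentials. -/
theorem isResidue_pair {q : ℝ} (hq : 0 < q) (hq1 : q < 1) {α z : ℂ} (hα : α ^ 2 = 1)
    (hz : z ^ 2 ≠ 1) (κ₁ κ₂ : EtaIndex) {K : ℕ} (hK : κ₁.2 + κ₂.2 + 2 < K) :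
    IsResidue (fun p => signedKernel q z p * (etaBasis κ₁ p * etaBasis κ₂ p⁻¹)) α
      (∑ i ∈ Finset.range K, ∑ ε : ZMod 2, α ^ (ε.val + κ₁.1.val + κ₂.1.val) *
        ((zetaEval q (pairCoeff κ₁ κ₂ i) : ℝ) : ℂ) * etaBasis (ε, i) z) := by
  have hα0 : α ≠ 0 := by rintro rfl; norm_num at hα
  have h := isResidue_signedKernel_mul hq hq1 hα hz
    (Y := fun p => etaBasis κ₁ p * etaBasis κ₂ p⁻¹)
    (2 * (κ₁.2 + κ₂.2 + 2)) (HasJet.one.const_mul (α ^ (κ₁.1.val + κ₂.1.val)))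
    (ψ := fun t => (t ^ (2 * κ₁.2 + 1 + 1) *
      (Complex.exp t * parityEta κ₁.1 (2 * κ₁.2 + 1) (Complex.exp t))) *
      (t ^ (2 * κ₂.2 + 1 + 1) *
      (Complex.exp t * parityEta κ₂.1 (2 * κ₂.2 + 1) (Complex.exp t))))
    (Ψ := etaSeries κ₁.1 (2 * κ₁.2 + 1) * etaSeries κ₂.1 (2 * κ₂.2 + 1))
    (by rw [map_mul]; exact (hasJet_parityEta _ _).mul (hasJet_parityEta _ _)) ?_
  · convert! h using 1
    rw [mul_one, mul_comm (kernelSeries α z), mul_assoc, PowerSeries.coeff_C_mul,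
      coeff_odd_mul (coeff_kernelSeries_even α z), sum_range_eq_sum_ite hK, Finset.mul_sum]
    refine Finset.sum_congr rfl fun i _ => ?_
    rw [pairCoeff]
    split_ifs with hi
    · rw [coeff_kernelSeries_odd, coeff_zetaSeries, zetaEval_C_mul, Finset.sum_mul, Finset.mul_sum]
      refine Finset.sum_congr rfl fun ε _ => ?_
      rw [etaBasis]
      push_cast
      ring
    · simp
  · filter_upwards [eventually_exp_sq_ne_one, self_mem_nhdsWithin] with t ht ht0
    have ht0 : t ≠ 0 := ht0
    have hp0 : α * Complex.exp t ≠ 0 := mul_ne_zero hα0 (Complex.exp_ne_zero t)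
    have hp : (α * Complex.exp t) ^ 2 ≠ 1 := by rwa [mul_pow, hα, one_mul]
    have e : etaBasis κ₁ (α * Complex.exp t) * etaBasis κ₂ (α * Complex.exp t)⁻¹ =
        (α * Complex.exp t * etaBasis κ₁ (α * Complex.exp t)) *
        (α * Complex.exp t * etaBasis κ₂ (α * Complex.exp t)) := by
      rw [etaBasis_inv κ₂ hp0 hp]; ring
    rw [e, mul_etaBasis_eq hα κ₁ ht0, mul_etaBasis_eq hα κ₂ ht0,
      show 2 * (κ₁.2 + κ₂.2 + 2) = (2 * κ₁.2 + 2) + (2 * κ₂.2 + 2) by ring, pow_add α, pow_add t]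
    field_simp
    ring

/-- The residue of the kernel times `ω_{0,2}(p, w)` and a basis differential, symmetrized. -/
theorem isResidue_single {q : ℝ} (hq : 0 < q) (hq1 : q < 1) {α z w : ℂ} (hα : α ^ 2 = 1)
    (hz : z ^ 2 ≠ 1) (hw : w ^ 2 ≠ 1) (κ : EtaIndex) {K : ℕ} (hK : κ.2 + 1 < K) :
    IsResidue (fun p => signedKernel q z p *
        (1 / (p - w) ^ 2 * etaBasis κ p⁻¹ + etaBasis κ p * (1 / (p⁻¹ - w) ^ 2))) α
      (∑ i ∈ Finset.range K, ∑ ε : ZMod 2, ∑ j ∈ Finset.range K, ∑ ε' : ZMod 2,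
        α ^ (ε.val + ε'.val + κ.1.val) *
        ((zetaEval q (singleCoeff κ i j) : ℝ) : ℂ) * (etaBasis (ε, i) z * etaBasis (ε', j) w)) := by
  have hα0 : α ≠ 0 := by rintro rfl; norm_num at hα
  have h := isResidue_signedKernel_mul hq hq1 hα hz
    (Y := fun p => 1 / (p - w) ^ 2 * etaBasis κ p⁻¹ + etaBasis κ p * (1 / (p⁻¹ - w) ^ 2))
    (2 * (κ.2 + 1)) ((hasJet_bergmanNum α hw).const_mul (α ^ κ.1.val))
    (ψ := fun t => t ^ (2 * κ.2 + 1 + 1) *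
      (Complex.exp t * parityEta κ.1 (2 * κ.2 + 1) (Complex.exp t)))
    (Ψ := etaSeries κ.1 (2 * κ.2 + 1)) (hasJet_parityEta _ _) ?_
  · convert! h using 1
    rw [show kernelSeries α z * (PowerSeries.C (α ^ κ.1.val) * bergmanSeries α w) *
      zetaSeries q (etaSeries κ.1 (2 * κ.2 + 1)) = PowerSeries.C (α ^ κ.1.val) *
      (kernelSeries α z * bergmanSeries α w * zetaSeries q (etaSeries κ.1 (2 * κ.2 + 1))) by ring,
      PowerSeries.coeff_C_mul,
      coeff_odd_mul (coeff_even_odd_mul (coeff_kernelSeries_even α z) (coeff_bergmanSeries_odd α w))]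
    have e : ∀ a ∈ Finset.range (κ.2 + 1 + 1),
        PowerSeries.coeff (2 * a + 1) (kernelSeries α z * bergmanSeries α w) *
          PowerSeries.coeff (2 * (κ.2 + 1 - a)) (zetaSeries q (etaSeries κ.1 (2 * κ.2 + 1))) =
        ∑ i ∈ Finset.range (a + 1), PowerSeries.coeff (2 * i + 1) (kernelSeries α z) *
          PowerSeries.coeff (2 * (a - i)) (bergmanSeries α w) *
          PowerSeries.coeff (2 * (κ.2 + 1 - (i + (a - i))))
            (zetaSeries q (etaSeries κ.1 (2 * κ.2 + 1))) := fun a _ => by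
      rw [coeff_odd_mul (coeff_kernelSeries_even α z), Finset.sum_mul]
      refine Finset.sum_congr rfl fun i hi => ?_
      rw [Nat.add_sub_cancel' (Nat.lt_succ_iff.1 (Finset.mem_range.1 hi))]
    rw [Finset.sum_congr rfl e, sum_range_sum_range_eq hK (fun i j =>
      PowerSeries.coeff (2 * i + 1) (kernelSeries α z) *
          PowerSeries.coeff (2 * j) (bergmanSeries α w) *
          PowerSeries.coeff (2 * (κ.2 + 1 - (i + j)))
            (zetaSeries q (etaSeries κ.1 (2 * κ.2 + 1)))), Finset.mul_sum]
    refine Finset.sum_congr rfl fun i _ => ?_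
    rw [Finset.sum_comm, Finset.mul_sum]
    refine Finset.sum_congr rfl fun j _ => ?_
    rw [singleCoeff]
    split_ifs with hij
    · rw [coeff_kernelSeries_odd, coeff_bergmanSeries_even, coeff_zetaSeries, zetaEval_C_mul,
        Finset.sum_mul_sum, Finset.sum_mul, Finset.mul_sum]
      refine Finset.sum_congr rfl fun ε _ => ?_
      rw [Finset.sum_mul, Finset.mul_sum]
      refine Finset.sum_congr rfl fun ε' _ => ?_
      rw [etaBasis, etaBasis]
      push_cast
      ring
    · simp
  · filter_upwards [eventually_exp_sq_ne_one, self_mem_nhdsWithin, eventually_mul_exp_sq_ne hw]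
      with t ht ht0 hwt
    have ht0 : t ≠ 0 := ht0
    have hp0 : α * Complex.exp t ≠ 0 := mul_ne_zero hα0 (Complex.exp_ne_zero t)
    have hp : (α * Complex.exp t) ^ 2 ≠ 1 := by rwa [mul_pow, hα, one_mul]
    have hb := bergmanNum_eq hα hwt.1 hwt.2 (p := α * Complex.exp t) rfl
    have hb' : bergmanNum α w t = α * Complex.exp t * (1 / (α * Complex.exp t - w) ^ 2) +
        (α * Complex.exp t)⁻¹ * (1 / ((α * Complex.exp t)⁻¹ - w) ^ 2) := by
      rw [hb.1, hb.2, bergmanNum, ← Finset.sum_add_distrib]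
      exact Finset.sum_congr rfl fun ε _ => by ring
    have e : ∀ x y : ℂ, x * etaBasis κ (α * Complex.exp t)⁻¹ + etaBasis κ (α * Complex.exp t) * y =
        (α * Complex.exp t * x + (α * Complex.exp t)⁻¹ * y) *
        (α * Complex.exp t * etaBasis κ (α * Complex.exp t)) := fun x y => by
      rw [etaBasis_inv κ hp0 hp]
      generalize α * Complex.exp t = p at *
      field_simp
    rw [e, ← hb', mul_etaBasis_eq hα κ ht0, show 2 * (κ.2 + 1) = 2 * κ.2 + 2 by ring]
    ring

/-- The coefficients of `ω_{1,1}`. -/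
noncomputable def torusCoeff (i : ℕ) : ZetaRing :=
  if i ≤ 1 then MvPolynomial.C (1 / ((2 * i + 1).factorial : ℚ)) *
    zetaCoeff (PowerSeries.C (1 / 4) * sinhcInv ^ 2 * (PowerSeries.C (1 / 4) * sinhcInv ^ 2))
      (2 * (1 - i)) else 0

/-- The residue of the kernel times `ω_{0,2}(p, σ(p))`, which gives `ω_{1,1}`. -/
theorem isResidue_torus {q : ℝ} (hq : 0 < q) (hq1 : q < 1) {α z : ℂ} (hα : α ^ 2 = 1)
    (hz : z ^ 2 ≠ 1) {K : ℕ} (hK : 1 < K) :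
    IsResidue (fun p => signedKernel q z p * (1 / (p - p⁻¹) ^ 2)) α
      (∑ i ∈ Finset.range K, ∑ ε : ZMod 2, α ^ ε.val *
        ((zetaEval q (torusCoeff i) : ℝ) : ℂ) * etaBasis (ε, i) z) := by
  have hα0 : α ≠ 0 := by rintro rfl; norm_num at hα
  have hαi : α⁻¹ = α := inv_eq_of_mul_eq_one_right (by rw [← sq, hα])
  have h := isResidue_signedKernel_mul hq hq1 hα hz (Y := fun p => 1 / (p - p⁻¹) ^ 2)
    2 HasJet.one (ψ := fun t => 1 / 4 * (t / Complex.sinh t) ^ 2)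
    (Ψ := PowerSeries.C (1 / 4) * sinhcInv ^ 2)
    (by
      rw [map_mul, map_pow, PowerSeries.map_C, map_div₀, map_one, map_ofNat]
      exact (hasJet_div_sinh.pow 2).const_mul (1 / 4)) ?_
  · convert! h using 1
    rw [mul_one, show 2 + 1 = 2 * 1 + 1 by norm_num,
      coeff_odd_mul (coeff_kernelSeries_even α z), sum_range_eq_sum_ite hK]
    refine Finset.sum_congr rfl fun i _ => ?_
    rw [torusCoeff]
    split_ifs with hi
    · rw [coeff_kernelSeries_odd, coeff_zetaSeries, zetaEval_C_mul, Finset.sum_mul]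
      refine Finset.sum_congr rfl fun ε _ => ?_
      rw [etaBasis]
      push_cast
      ring
    · simp
  · filter_upwards [self_mem_nhdsWithin] with t ht0
    have ht0 : t ≠ 0 := ht0
    have : α * Complex.exp t - (α * Complex.exp t)⁻¹ = α * (2 * Complex.sinh t) := by
      rw [mul_inv, hαi, Complex.sinh, Complex.exp_neg]; ring
    rw [this, mul_pow, hα, mul_pow, one_mul, one_mul, div_pow]
    field_simp
    norm_num

/-- The residue of the kernel times two factors `ω_{0,2}`, which gives `ω_{0,3}`. -/
theorem isResidue_sphere {q : ℝ} (hq : 0 < q) (hq1 : q < 1) {α z w v : ℂ} (hα : α ^ 2 = 1)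
    (hz : z ^ 2 ≠ 1) (hw : w ^ 2 ≠ 1) (hv : v ^ 2 ≠ 1) :
    IsResidue (fun p => signedKernel q z p * (1 / (p - w) ^ 2 * (1 / (p⁻¹ - v) ^ 2))) α
      (∑ ε : ZMod 2, ∑ ε' : ZMod 2, ∑ ε'' : ZMod 2, α ^ (ε.val + ε'.val + ε''.val) *
        (1 / 4) * (etaBasis (ε, 0) z * etaBasis (ε', 0) w * etaBasis (ε'', 0) v)) := by
  have hα0 : α ≠ 0 := by rintro rfl; norm_num at hα
  have h1 := HasJet.sum Finset.univ fun (ε : ZMod 2) _ =>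
    ((hasJet_exp_mul_parityEta ε 1 hw).comp_neg).const_mul (α ^ ε.val)
  have h2 := HasJet.sum Finset.univ fun (ε : ZMod 2) _ =>
    (hasJet_exp_mul_parityEta ε 1 hv).const_mul (α ^ ε.val)
  have h := isResidue_signedKernel_mul hq hq1 hα hz
    (Y := fun p => 1 / (p - w) ^ 2 * (1 / (p⁻¹ - v) ^ 2)) 0 (h1.mul h2)
    (ψ := fun _ => 1) (Ψ := 1) (by rw [map_one]; exact HasJet.one) ?_
  · convert! h using 1
    rw [mul_assoc, show 0 + 1 = 2 * 0 + 1 by norm_num,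
      coeff_odd_mul (coeff_kernelSeries_even α z)]
    simp only [zero_add, Finset.range_one, Finset.sum_singleton, Nat.sub_zero, mul_zero]
    have e1 : PowerSeries.coeff 1 (kernelSeries α z) =
        ∑ ε : ZMod 2, α ^ ε.val * (parityEta ε 1 z / (1 : ℂ)) := by
      simpa using coeff_kernelSeries_odd α z 0
    rw [e1]
    simp only [PowerSeries.coeff_zero_eq_constantCoeff_apply, map_mul, map_sum]
    simp only [← PowerSeries.coeff_zero_eq_constantCoeff_apply, coeff_zetaSeries,
      PowerSeries.coeff_zero_C, PowerSeries.coeff_rescale, PowerSeries.coeff_mk]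
    have e : zetaEval q (zetaCoeff (PowerSeries.C (1 / 4) * sinhcInv ^ 2 * 1) 0) = 1 / 4 := by
      rw [zetaCoeff, zero_add, Finset.range_one, Finset.sum_singleton, completeSymm, zetaEval_C_mul,
        PowerSeries.coeff_zero_eq_constantCoeff_apply]
      simp [constantCoeff_sinhcInv]
    rw [e]
    simp only [sum_zmod_two, etaBasis]
    simp
    ring
  · filter_upwards [self_mem_nhdsWithin, eventually_mul_exp_sq_ne hw, eventually_mul_exp_sq_ne hv]
      with t ht0 hwt hvt
    have ht0 : t ≠ 0 := ht0
    have hp0 : α * Complex.exp t ≠ 0 := mul_ne_zero hα0 (Complex.exp_ne_zero t)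
    have hb := bergmanNum_eq hα hwt.1 hwt.2 (p := α * Complex.exp t) rfl
    have hb2 := bergmanNum_eq hα hvt.1 hvt.2 (p := α * Complex.exp t) rfl
    rw [← hb.1, ← hb2.2]
    generalize α * Complex.exp t = p at *
    rw [pow_zero]
    field_simp

/-! ### Leading parts with respect to the degree -/

/-- The degree of a monomial in the `q`-zeta values, as an integer: degrees of coefficients in the
recursion are differences, and nothing but `0` has a negative degree. -/
noncomputable def zetaWeight (m : ℕ →₀ ℕ) : ℤ := (Finsupp.weight (fun k => 2 * k + 2) m : ℕ)

theorem zetaWeight_add (m m' : ℕ →₀ ℕ) : zetaWeight (m + m') = zetaWeight m + zetaWeight m' := by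
  rw [zetaWeight, map_add]; push_cast; rfl

theorem zetaWeight_nonneg (m : ℕ →₀ ℕ) : 0 ≤ zetaWeight m := Int.natCast_nonneg _

/-- The polynomials that are homogeneous of degree `d`. -/
noncomputable def homogeneousPart (d : ℤ) : Submodule ℚ ZetaRing :=
  MvPolynomial.restrictSupport ℚ {m | zetaWeight m = d}

/-- The polynomials all of whose monomials have degree less than `d`. -/
noncomputable def lowerPart (d : ℤ) : Submodule ℚ ZetaRing :=
  MvPolynomial.restrictSupport ℚ {m | zetaWeight m < d}

/-- `x` has degree at most `d`, with part `x₀` in degree `d`. -/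
def HasTopPart (d : ℤ) (x₀ x : ZetaRing) : Prop := x₀ ∈ homogeneousPart d ∧ x - x₀ ∈ lowerPart d

open scoped Pointwise in
theorem mul_mem_restrictSupport {s t u : Set (ℕ →₀ ℕ)} (h : ∀ a ∈ s, ∀ b ∈ t, a + b ∈ u)
    {x y : ZetaRing} (hx : x ∈ MvPolynomial.restrictSupport ℚ s)
    (hy : y ∈ MvPolynomial.restrictSupport ℚ t) : x * y ∈ MvPolynomial.restrictSupport ℚ u := by
  refine MvPolynomial.restrictSupport_mono (R := ℚ) (s := s + t) ?_ ?_
  · rintro _ ⟨a, ha, b, hb, rfl⟩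
    exact h a ha b hb
  · rw [MvPolynomial.restrictSupport_add]
    exact Submodule.mul_mem_mul hx hy

theorem C_mul_mem_restrictSupport {s : Set (ℕ →₀ ℕ)} (r : ℚ) {x : ZetaRing}
    (hx : x ∈ MvPolynomial.restrictSupport ℚ s) :
    MvPolynomial.C r * x ∈ MvPolynomial.restrictSupport ℚ s := by
  rw [← MvPolynomial.smul_eq_C_mul]
  exact Submodule.smul_mem _ _ hx

theorem mul_mem_homogeneousPart {d d' : ℤ} {x y : ZetaRing} (hx : x ∈ homogeneousPart d)
    (hy : y ∈ homogeneousPart d') : x * y ∈ homogeneousPart (d + d') :=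
  mul_mem_restrictSupport (fun a ha b hb => by
    simp only [Set.mem_ofPred_eq] at ha hb ⊢
    rw [zetaWeight_add, ha, hb]) hx hy

namespace HasTopPart
variable {d d' : ℤ} {x₀ x y₀ y : ZetaRing}

theorem zero (d : ℤ) : HasTopPart d 0 0 :=
  ⟨Submodule.zero_mem _, by rw [sub_zero]; exact Submodule.zero_mem _⟩

theorem of_mem (h : x ∈ homogeneousPart d) : HasTopPart d x x :=
  ⟨h, by rw [sub_self]; exact Submodule.zero_mem _⟩

theorem of_lower (h : x ∈ lowerPart d) : HasTopPart d 0 x :=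
  ⟨Submodule.zero_mem _, by rwa [sub_zero]⟩

theorem add (hx : HasTopPart d x₀ x) (hy : HasTopPart d y₀ y) :
    HasTopPart d (x₀ + y₀) (x + y) :=
  ⟨Submodule.add_mem _ hx.1 hy.1, by
    rw [add_sub_add_comm]; exact Submodule.add_mem _ hx.2 hy.2⟩

theorem sum {ι : Type*} (s : Finset ι) {f₀ f : ι → ZetaRing}
    (h : ∀ i ∈ s, HasTopPart d (f₀ i) (f i)) : HasTopPart d (∑ i ∈ s, f₀ i) (∑ i ∈ s, f i) :=
  ⟨Submodule.sum_mem _ fun i hi => (h i hi).1, by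
    rw [← Finset.sum_sub_distrib]; exact Submodule.sum_mem _ fun i hi => (h i hi).2⟩

theorem C_mul (r : ℚ) (hx : HasTopPart d x₀ x) :
    HasTopPart d (MvPolynomial.C r * x₀) (MvPolynomial.C r * x) :=
  ⟨C_mul_mem_restrictSupport r hx.1, by
    rw [← mul_sub]; exact C_mul_mem_restrictSupport r hx.2⟩

theorem mul (hx : HasTopPart d x₀ x) (hy : HasTopPart d' y₀ y) :
    HasTopPart (d + d') (x₀ * y₀) (x * y) := by
  refine ⟨mul_mem_homogeneousPart hx.1 hy.1, ?_⟩
  rw [show x * y - x₀ * y₀ = (x - x₀) * (y - y₀) + ((x - x₀) * y₀ + x₀ * (y - y₀)) by ring]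
  refine Submodule.add_mem _ ?_ (Submodule.add_mem _ ?_ ?_)
  · refine mul_mem_restrictSupport (fun a ha b hb => ?_) hx.2 hy.2
    simp only [Set.mem_ofPred_eq] at ha hb ⊢
    rw [zetaWeight_add]; omega
  · refine mul_mem_restrictSupport (fun a ha b hb => ?_) hx.2 hy.1
    simp only [Set.mem_ofPred_eq] at ha hb ⊢
    rw [zetaWeight_add]; omega
  · refine mul_mem_restrictSupport (fun a ha b hb => ?_) hx.1 hy.2
    simp only [Set.mem_ofPred_eq] at ha hb ⊢
    rw [zetaWeight_add]; omega

theorem congr_degree (hx : HasTopPart d x₀ x) (h : d = d') : HasTopPart d' x₀ x := h ▸ hx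

theorem eq_zero_of_neg (hx : HasTopPart d x₀ x) (hd : d < 0) : x₀ = 0 ∧ x = 0 := by
  have h1 : ∀ y ∈ MvPolynomial.restrictSupport ℚ {m | zetaWeight m ≤ d}, y = 0 := by
    intro y hy
    rw [MvPolynomial.mem_restrictSupport_iff] at hy
    rw [← MvPolynomial.support_eq_empty]
    by_contra hne
    obtain ⟨m, hm⟩ := Finset.nonempty_iff_ne_empty.2 hne
    have h2 : zetaWeight m ≤ d := hy hm
    have := zetaWeight_nonneg m
    omega
  have h0 : x₀ = 0 := h1 _ (MvPolynomial.restrictSupport_mono (R := ℚ)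
    (fun m (hm : zetaWeight m = d) => hm.le) hx.1)
  refine ⟨h0, ?_⟩
  have h2 := h1 _ (MvPolynomial.restrictSupport_mono (R := ℚ)
    (fun m (hm : zetaWeight m < d) => hm.le) hx.2)
  rwa [h0, sub_zero] at h2

end HasTopPart

theorem one_mem_homogeneousPart : (1 : ZetaRing) ∈ homogeneousPart 0 := by
  rw [← MvPolynomial.C_1, ← MvPolynomial.monomial_zero', homogeneousPart,
    MvPolynomial.monomial_mem_restrictSupport]
  exact Or.inl (by simp [zetaWeight])

theorem X_mem_homogeneousPart (k : ℕ) : (MvPolynomial.X k : ZetaRing) ∈ homogeneousPart (2 * k + 2) := by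
  rw [homogeneousPart, MvPolynomial.mem_restrictSupport_iff, MvPolynomial.support_X]
  intro m hm
  have : m = Finsupp.single k 1 := by simpa using hm
  subst this
  simp [zetaWeight, Finsupp.weight_apply]

theorem completeSymm_mem_homogeneousPart (j : ℕ) : completeSymm j ∈ homogeneousPart (2 * j) := by
  induction j using Nat.strong_induction_on with
  | _ j ih =>
    cases j with
    | zero => rw [completeSymm]; exact one_mem_homogeneousPart
    | succ j =>
      rw [completeSymm_succ]
      refine C_mul_mem_restrictSupport _ (Submodule.sum_mem _ fun i hi => ?_)
      have hi := Finset.mem_range.1 hi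
      have h := mul_mem_homogeneousPart (X_mem_homogeneousPart (j - i)) (ih i hi)
      have e : (2 * ((j - i : ℕ) : ℤ) + 2 + 2 * (i : ℤ)) = 2 * ((j + 1 : ℕ) : ℤ) := by
        push_cast [Nat.cast_sub (Nat.lt_succ_iff.1 hi)]; ring
      rwa [e] at h

/-- The term with `h_j` needs the factor `(4 sinh² t)^j`, of order `2j`. Hence the coefficient of
`t^(2ρ)` has degree `2ρ`, and in top degree only the leading terms of `4 sinh² t` and `Ψ`
contribute. -/
theorem hasTopPart_zetaCoeff (Ψ : PowerSeries ℚ) (ρ : ℕ) :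
    HasTopPart (2 * ρ) (MvPolynomial.C (4 ^ ρ * PowerSeries.constantCoeff Ψ) * completeSymm ρ)
      (zetaCoeff Ψ (2 * ρ)) := by
  have h : ∀ j ∈ Finset.range (2 * ρ + 1), HasTopPart (2 * ρ)
      (if j = ρ then MvPolynomial.C (4 ^ ρ * PowerSeries.constantCoeff Ψ) * completeSymm ρ else 0)
      (MvPolynomial.C (PowerSeries.coeff (2 * ρ) (sinhSqSeries ^ j * Ψ)) * completeSymm j) := by
    intro j _
    split_ifs with hj
    · subst hj
      rw [coeff_sinhSqSeries_pow_mul_self]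
      exact HasTopPart.C_mul _ (HasTopPart.of_mem (completeSymm_mem_homogeneousPart _))
    · rcases Nat.lt_or_gt_of_ne hj with h | h
      · refine HasTopPart.of_lower (C_mul_mem_restrictSupport _
          (MvPolynomial.restrictSupport_mono (R := ℚ) ?_ (completeSymm_mem_homogeneousPart j)))
        intro m (hm : zetaWeight m = 2 * j)
        show zetaWeight m < 2 * ρ
        omega
      · rw [coeff_sinhSqSeries_pow_mul_of_lt (by omega), map_zero, zero_mul]
        exact HasTopPart.zero _
  have := HasTopPart.sum _ h
  rwa [Finset.sum_ite_eq' , if_pos (Finset.mem_range.2 (by omega))] at this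

/-- The leading part of `16 pairCoeff`. It is also the coefficient of `t^(2i)`, divided by `2i + 1`,
in the integral of `x^(2k+1) y^(2l+1) H_q(x + y, t)`, see `kernelMoment_pair`. -/
noncomputable def pairTop (k l i : ℕ) : ZetaRing :=
  if i ≤ k + l + 2 then MvPolynomial.C ((2 * k + 1).factorial * (2 * l + 1).factorial *
    4 ^ (k + l + 2 - i) / (2 * i + 1).factorial : ℚ) * completeSymm (k + l + 2 - i) else 0

theorem hasTopPart_pairCoeff (κ₁ κ₂ : EtaIndex) (i : ℕ) :
    HasTopPart (2 * (κ₁.2 + κ₂.2 + 2 - i)) (MvPolynomial.C (1 / 16) * pairTop κ₁.2 κ₂.2 i)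
      (pairCoeff κ₁ κ₂ i) := by
  rw [pairTop, pairCoeff]
  split_ifs with h
  · have h1 := ((hasTopPart_zetaCoeff (PowerSeries.C (1 / 4) * sinhcInv ^ 2 *
      (etaSeries κ₁.1 (2 * κ₁.2 + 1) * etaSeries κ₂.1 (2 * κ₂.2 + 1)))
      (κ₁.2 + κ₂.2 + 2 - i)).C_mul (1 / ((2 * i + 1).factorial : ℚ))).congr_degree
      (d' := 2 * (κ₁.2 + κ₂.2 + 2 - i)) (by push_cast [Nat.cast_sub h]; ring)
    have e : (1 / ((2 * i + 1).factorial : ℚ)) * (4 ^ (κ₁.2 + κ₂.2 + 2 - i) *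
        PowerSeries.constantCoeff (PowerSeries.C (1 / 4) * sinhcInv ^ 2 *
          (etaSeries κ₁.1 (2 * κ₁.2 + 1) * etaSeries κ₂.1 (2 * κ₂.2 + 1)))) =
        1 / 16 * ((2 * κ₁.2 + 1).factorial * (2 * κ₂.2 + 1).factorial *
          4 ^ (κ₁.2 + κ₂.2 + 2 - i) / (2 * i + 1).factorial : ℚ) := by
      simp only [map_mul, map_pow, constantCoeff_sinhcInv, constantCoeff_etaSeries,
        PowerSeries.constantCoeff_C, one_pow]
      rw [Even.neg_one_pow ⟨κ₁.2 + 1, by ring⟩, Even.neg_one_pow ⟨κ₂.2 + 1, by ring⟩]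
      ring
    rw [← mul_assoc, ← map_mul, e, map_mul, mul_assoc] at h1
    exact h1
  · rw [mul_zero]; exact HasTopPart.zero _

/-- The leading part of `8 singleCoeff`. It is also the coefficient of `t^(2i) y^(2j)`, divided by
`2i + 1`, in the integral of `x^(2k+1) (H_q(x, t + y) + H_q(x, t - y))`, see
`kernelMoment_single`. -/
noncomputable def singleTop (k i j : ℕ) : ZetaRing :=
  if i + j ≤ k + 1 then MvPolynomial.C (2 * (2 * k + 1).factorial * 4 ^ (k + 1 - (i + j)) /
    ((2 * i + 1).factorial * (2 * j).factorial) : ℚ) * completeSymm (k + 1 - (i + j)) else 0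

theorem hasTopPart_singleCoeff (κ : EtaIndex) (i j : ℕ) :
    HasTopPart (2 * (κ.2 + 1 - i - j)) (MvPolynomial.C (1 / 8) * singleTop κ.2 i j)
      (singleCoeff κ i j) := by
  rw [singleTop, singleCoeff]
  split_ifs with h
  · have h1 := ((hasTopPart_zetaCoeff (PowerSeries.C (1 / 4) * sinhcInv ^ 2 *
      etaSeries κ.1 (2 * κ.2 + 1)) (κ.2 + 1 - (i + j))).C_mul
      (2 / ((2 * i + 1).factorial * (2 * j).factorial : ℚ))).congr_degree
      (d' := 2 * (κ.2 + 1 - i - j)) (by push_cast [Nat.cast_sub h]; ring)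
    have e : (2 / ((2 * i + 1).factorial * (2 * j).factorial : ℚ)) *
        (4 ^ (κ.2 + 1 - (i + j)) * PowerSeries.constantCoeff (PowerSeries.C (1 / 4) *
          sinhcInv ^ 2 * etaSeries κ.1 (2 * κ.2 + 1))) =
        1 / 8 * (2 * (2 * κ.2 + 1).factorial * 4 ^ (κ.2 + 1 - (i + j)) /
          ((2 * i + 1).factorial * (2 * j).factorial) : ℚ) := by
      simp only [map_mul, map_pow, constantCoeff_sinhcInv, constantCoeff_etaSeries,
        PowerSeries.constantCoeff_C, one_pow]
      rw [Even.neg_one_pow ⟨κ.2 + 1, by ring⟩]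
      ring
    rw [← mul_assoc, ← map_mul, e, map_mul, mul_assoc] at h1
    exact h1
  · rw [mul_zero]; exact HasTopPart.zero _

/-! ### Expansions in products of functions of one variable -/

section piFinset
variable {ι : Type*} {n : ℕ}

theorem sum_piFinset_cons {F : Type*} [AddCommMonoid F] (B : Finset ι) (f : (Fin (n + 1) → ι) → F) :
    ∑ κ ∈ Fintype.piFinset (fun _ : Fin (n + 1) => B), f κ =
      ∑ b ∈ B, ∑ κ ∈ Fintype.piFinset (fun _ : Fin n => B), f (Fin.cons b κ) := by
  rw [← Finset.sum_product']
  refine Finset.sum_bij' (fun κ _ => (κ 0, Fin.tail κ)) (fun x _ => Fin.cons x.1 x.2) ?_ ?_ ?_ ?_ ?_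
  · intro κ h
    rw [Fintype.mem_piFinset] at h
    exact Finset.mem_product.2 ⟨h 0, Fintype.mem_piFinset.2 fun i => h i.succ⟩
  · rintro ⟨b, κ⟩ h
    obtain ⟨h1, h2⟩ := Finset.mem_product.1 h
    rw [Fintype.mem_piFinset] at h2 ⊢
    exact Fin.cases h1 h2
  · intro κ _
    exact Fin.cons_self_tail κ
  · rintro ⟨b, κ⟩ _
    simp
  · intro κ _
    rw [Fin.cons_self_tail]

theorem subtuple_mem_piFinset {B : Finset ι} {κ : Fin n → ι}
    (h : κ ∈ Fintype.piFinset fun _ => B) (I : Finset (Fin n)) :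
    subtuple κ I ∈ Fintype.piFinset fun _ => B :=
  Fintype.mem_piFinset.2 fun _ => Fintype.mem_piFinset.1 h _

/-- The tuple with entries `u` at the places in `I`, and `v` at the others. -/
noncomputable def mergeTuple (I : Finset (Fin n)) (u : Fin I.card → ι) (v : Fin Iᶜ.card → ι)
    (i : Fin n) : ι :=
  if h : i ∈ I then u ((I.orderIsoOfFin rfl).symm ⟨i, h⟩)
  else v ((Iᶜ.orderIsoOfFin rfl).symm ⟨i, Finset.mem_compl.2 h⟩)

theorem subtuple_mergeTuple (I : Finset (Fin n)) (u : Fin I.card → ι) (v : Fin Iᶜ.card → ι) :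
    subtuple (mergeTuple I u v) I = u := by
  funext i
  rw [subtuple, mergeTuple, dif_pos (Finset.orderEmbOfFin_mem I rfl i)]
  congr 1
  exact (I.orderIsoOfFin rfl).symm_apply_apply i

theorem subtuple_compl_mergeTuple (I : Finset (Fin n)) (u : Fin I.card → ι)
    (v : Fin Iᶜ.card → ι) : subtuple (mergeTuple I u v) Iᶜ = v := by
  funext i
  rw [subtuple, mergeTuple, dif_neg (Finset.mem_compl.1 (Finset.orderEmbOfFin_mem Iᶜ rfl i))]
  congr 1
  exact (Iᶜ.orderIsoOfFin rfl).symm_apply_apply i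

theorem subtuple_orderIsoOfFin_symm (κ : Fin n → ι) (I : Finset (Fin n)) (i : I) :
    subtuple κ I ((I.orderIsoOfFin rfl).symm i) = κ i := by
  rw [subtuple]
  congr 1
  exact congrArg Subtype.val ((I.orderIsoOfFin rfl).apply_symm_apply i)

theorem mergeTuple_subtuple (I : Finset (Fin n)) (κ : Fin n → ι) :
    mergeTuple I (subtuple κ I) (subtuple κ Iᶜ) = κ := by
  funext i
  rw [mergeTuple]
  split_ifs with h <;> rw [subtuple_orderIsoOfFin_symm]

/-- A sum over tuples that splits into factors depending on the entries in `I` and off `I`. -/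
theorem sum_piFinset_subtuple {F : Type*} [CommSemiring F] (B : Finset ι) (I : Finset (Fin n))
    (f : (Fin I.card → ι) → F) (g : (Fin Iᶜ.card → ι) → F) :
    ∑ κ ∈ Fintype.piFinset (fun _ : Fin n => B), f (subtuple κ I) * g (subtuple κ Iᶜ) =
      (∑ κ ∈ Fintype.piFinset (fun _ => B), f κ) * ∑ κ ∈ Fintype.piFinset (fun _ => B), g κ := by
  rw [Finset.sum_mul_sum, ← Finset.sum_product']
  refine Finset.sum_bij' (fun κ _ => (subtuple κ I, subtuple κ Iᶜ))
    (fun x _ => mergeTuple I x.1 x.2) ?_ ?_ ?_ ?_ ?_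
  · intro κ h
    exact Finset.mem_product.2 ⟨subtuple_mem_piFinset h _, subtuple_mem_piFinset h _⟩
  · rintro ⟨u, v⟩ h
    obtain ⟨h1, h2⟩ := Finset.mem_product.1 h
    refine Fintype.mem_piFinset.2 fun i => ?_
    rw [mergeTuple]
    split_ifs
    exacts [Fintype.mem_piFinset.1 h1 _, Fintype.mem_piFinset.1 h2 _]
  · intro κ _
    exact mergeTuple_subtuple I κ
  · rintro ⟨u, v⟩ _
    rw [subtuple_mergeTuple, subtuple_compl_mergeTuple]
  · intro κ _
    rfl

theorem prod_subtuple {A F : Type*} [CommMonoid F] (f : ι → A → F) (κ : Fin n → ι) (z : Fin n → A)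
    (I : Finset (Fin n)) :
    ∏ i, f (subtuple κ I i) (subtuple z I i) = ∏ i ∈ I, f (κ i) (z i) := by
  rw [← Finset.prod_coe_sort I fun i => f (κ i) (z i)]
  exact (I.orderIsoOfFin rfl).toEquiv.prod_comp fun i : I => f (κ i) (z i)

theorem sum_subtuple {F : Type*} [AddCommMonoid F] (κ : Fin n → F) (I : Finset (Fin n)) :
    ∑ i, subtuple κ I i = ∑ i ∈ I, κ i := by
  rw [← Finset.sum_coe_sort I fun i => κ i]
  exact (I.orderIsoOfFin rfl).toEquiv.sum_comp fun i : I => κ i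

end piFinset

section multiSum
variable {ι A F : Type*} [CommRing F] (φ : ι → A → F) (B : Finset ι) {n : ℕ}

/-- The combination, with coefficients `c`, of the products `∏ φ_{κᵢ}(zᵢ)` with all `κᵢ` in `B`. -/
noncomputable def multiSum (c : (Fin n → ι) → F) (z : Fin n → A) : F :=
  ∑ κ ∈ Fintype.piFinset (fun _ : Fin n => B), c κ * ∏ i, φ (κ i) (z i)

theorem multiSum_cons (c : (Fin (n + 1) → ι) → F) (p : A) (z : Fin n → A) :
    multiSum φ B c (Fin.cons p z) =
      ∑ b ∈ B, φ b p * multiSum φ B (fun κ => c (Fin.cons b κ)) z := by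
  simp only [multiSum, sum_piFinset_cons, Fin.prod_univ_succ, Fin.cons_zero, Fin.cons_succ,
    Finset.mul_sum]
  exact Finset.sum_congr rfl fun _ _ => Finset.sum_congr rfl fun _ _ => by ring

theorem multiSum_add (c d : (Fin n → ι) → F) (z : Fin n → A) :
    multiSum φ B (fun κ => c κ + d κ) z = multiSum φ B c z + multiSum φ B d z := by
  simp only [multiSum, add_mul, Finset.sum_add_distrib]

theorem multiSum_sum {J : Type*} (s : Finset J) (c : J → (Fin n → ι) → F) (z : Fin n → A) :
    multiSum φ B (fun κ => ∑ j ∈ s, c j κ) z = ∑ j ∈ s, multiSum φ B (c j) z := by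
  simp only [multiSum, Finset.sum_mul]
  exact Finset.sum_comm

theorem multiSum_mul_left (a : F) (c : (Fin n → ι) → F) (z : Fin n → A) :
    multiSum φ B (fun κ => a * c κ) z = a * multiSum φ B c z := by
  simp only [multiSum, Finset.mul_sum, mul_assoc]

theorem multiSum_zero (z : Fin n → A) : multiSum φ B (fun _ => 0) z = 0 := by
  simp only [multiSum, zero_mul, Finset.sum_const_zero]

theorem multiSum_subtuple (I : Finset (Fin n)) (c : (Fin I.card → ι) → F)
    (d : (Fin Iᶜ.card → ι) → F) (z : Fin n → A) :
    multiSum φ B (fun κ => c (subtuple κ I) * d (subtuple κ Iᶜ)) z =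
      multiSum φ B c (subtuple z I) * multiSum φ B d (subtuple z Iᶜ) := by
  rw [multiSum, multiSum, multiSum, ← sum_piFinset_subtuple]
  refine Finset.sum_congr rfl fun κ _ => ?_
  rw [prod_subtuple, prod_subtuple, ← Finset.prod_mul_prod_compl I]
  ring

theorem subtuple_singleton {X : Type*} (κ : Fin n → X) (a : Fin n) (i : Fin ({a} : Finset (Fin n)).card) :
    subtuple κ {a} i = κ a := by
  rw [subtuple]
  congr 1
  exact Finset.mem_singleton.1 (Finset.orderEmbOfFin_mem {a} rfl i)

/-- The expansion of a product in which one variable is separated from the others. -/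
theorem multiSum_single_mul (a : Fin n) {J : Finset (Fin n)} (hJ : J = {a}ᶜ) (e : ι → F)
    (d : (Fin J.card → ι) → F) (z : Fin n → A) :
    multiSum φ B (fun κ => e (κ a) * d (subtuple κ J)) z =
      (∑ b ∈ B, e b * φ b (z a)) * multiSum φ B d (subtuple z J) := by
  subst hJ
  have h := multiSum_subtuple φ B {a} (fun κ => e (κ ⟨0, by simp⟩)) d z
  simp only [subtuple_singleton] at h
  rw [h]
  congr 1
  have hs : Subsingleton (Fin ({a} : Finset (Fin n)).card) := by
    rw [Finset.card_singleton]; infer_instance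
  rw [multiSum]
  refine Finset.sum_bij' (fun κ _ => κ ⟨0, by simp⟩) (fun b _ _ => b) ?_ ?_ ?_ ?_ ?_
  · intro κ h
    exact Fintype.mem_piFinset.1 h _
  · intro b hb
    exact Fintype.mem_piFinset.2 fun _ => hb
  · intro κ _
    funext i
    rw [Subsingleton.elim i]
  · intro b _
    rfl
  · intro κ _
    rw [Fintype.prod_subsingleton _ ⟨0, by simp⟩, subtuple_singleton]

end multiSum

/-! ### The terms of the recursion -/

/-- The types `(g, n)` with `n ≥ 1` other than `(0, 1)` and `(0, 2)`. -/
def IsStable (g n : ℕ) : Prop := 1 ≤ n ∧ 3 ≤ 2 * g + n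

/-- The condition that both factors of the term of `(g₁, I)` in the quadratic part of the recursion
are of stable type. -/
abbrev IsStableSplit (g : ℕ) {n : ℕ} (g₁ : ℕ) (I : Finset (Fin n)) : Prop :=
  2 ≤ 2 * g₁ + I.card ∧ 2 ≤ 2 * (g - g₁) + Iᶜ.card

/-- The coefficient of `φ_a(p) φ_b(p') ∏ φ_{κᵢ}(zᵢ)` in the stable terms of the recursion other than
those with `ω_{0,2}`, if `c` contains the coefficients of the lower terms. -/
noncomputable def splitCoeff {ι R : Type*} [CommRing R] (c : ∀ _g n : ℕ, (Fin n → ι) → R)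
    (g n : ℕ) (a b : ι) (κ : Fin n → ι) : R :=
  (if 0 < g then c (g - 1) (n + 2) (Fin.cons a (Fin.cons b κ)) else 0) +
    ∑ g₁ : Fin (g + 1), ∑ I : Finset (Fin n), if IsStableSplit g g₁.1 I then
      c g₁.1 (I.card + 1) (Fin.cons a (subtuple κ I)) *
        c (g - g₁.1) (Iᶜ.card + 1) (Fin.cons b (subtuple κ Iᶜ)) else 0

theorem map_splitCoeff {ι R R' : Type*} [CommRing R] [CommRing R'] (e : R →+* R')
    (c : ∀ _g n : ℕ, (Fin n → ι) → R) (g n : ℕ) (a b : ι) (κ : Fin n → ι) :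
    e (splitCoeff c g n a b κ) = splitCoeff (fun g n κ => e (c g n κ)) g n a b κ := by
  simp only [splitCoeff, map_add, map_sum, apply_ite e, map_mul, map_zero]

/-- `c` contains the coefficients of the expansions of the functions `f g n`, for `(g, n)` stable
and lower than `(g₀, n₀)`, at arguments in `S`. -/
def ExpandsBelow {ι A F : Type*} [CommRing F] (φ : ι → A → F) (B : Finset ι) (S : Set A)
    (f : ∀ _g n : ℕ, (Fin n → A) → F) (c : ∀ _g n : ℕ, (Fin n → ι) → F) (g₀ n₀ : ℕ) : Prop :=
  ∀ g n, IsStable g n → 2 * g + n < 2 * g₀ + n₀ → ∀ z : Fin n → A, (∀ i, z i ∈ S) →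
    f g n z = multiSum φ B (c g n) z

theorem cons_mem {A : Type*} {S : Set A} {n : ℕ} {p : A} {z : Fin n → A} (hp : p ∈ S)
    (hz : ∀ i, z i ∈ S) (i : Fin (n + 1)) : (Fin.cons p z : Fin (n + 1) → A) i ∈ S :=
  Fin.cases (by simpa using hp) (fun i => by simpa using hz i) i

theorem subtuple_mem {A : Type*} {S : Set A} {n : ℕ} {z : Fin n → A} (hz : ∀ i, z i ∈ S)
    (I : Finset (Fin n)) (i : Fin I.card) : subtuple z I i ∈ S := hz _

section ExpandsBelow
variable {ι A F : Type*} [CommRing F] {φ : ι → A → F} {B : Finset ι} {S : Set A}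
  {f : ∀ _g n : ℕ, (Fin n → A) → F} {c : ∀ _g n : ℕ, (Fin n → ι) → F} {g n : ℕ}

theorem ExpandsBelow.genus (h : ExpandsBelow φ B S f c g (n + 1)) (hs : 3 ≤ 2 * g + n)
    {p p' : A} (hp : p ∈ S) (hp' : p' ∈ S) {z : Fin n → A} (hz : ∀ i, z i ∈ S) (hg : 0 < g) :
    f (g - 1) (n + 2) (Fin.cons p (Fin.cons p' z)) = ∑ a ∈ B, ∑ b ∈ B, φ a p * φ b p' *
      multiSum φ B (fun κ => c (g - 1) (n + 2) (Fin.cons a (Fin.cons b κ))) z := by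
  rw [h (g - 1) (n + 2) ⟨by omega, by omega⟩ (by omega) _ (cons_mem hp (cons_mem hp' hz)),
    multiSum_cons]
  simp only [multiSum_cons, Finset.mul_sum, mul_assoc]

theorem ExpandsBelow.split (h : ExpandsBelow φ B S f c g (n + 1)) {p p' : A} (hp : p ∈ S)
    (hp' : p' ∈ S) {z : Fin n → A} (hz : ∀ i, z i ∈ S) {g₁ : Fin (g + 1)} {I : Finset (Fin n)}
    (hI : IsStableSplit g g₁.1 I) :
    f g₁.1 (I.card + 1) (Fin.cons p (subtuple z I)) *
      f (g - g₁.1) (Iᶜ.card + 1) (Fin.cons p' (subtuple z Iᶜ)) =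
      ∑ a ∈ B, ∑ b ∈ B, φ a p * φ b p' * multiSum φ B (fun κ =>
        c g₁.1 (I.card + 1) (Fin.cons a (subtuple κ I)) *
        c (g - g₁.1) (Iᶜ.card + 1) (Fin.cons b (subtuple κ Iᶜ))) z := by
  have hg := g₁.2
  have hc := Finset.card_add_card_compl I
  rw [Fintype.card_fin] at hc
  obtain ⟨h1, h2⟩ := hI
  rw [h g₁.1 _ ⟨by omega, by omega⟩ (by omega) _ (cons_mem hp (subtuple_mem hz _)),
    h (g - g₁.1) _ ⟨by omega, by omega⟩ (by omega) _ (cons_mem hp' (subtuple_mem hz _)),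
    multiSum_cons, multiSum_cons, Finset.sum_mul_sum]
  refine Finset.sum_congr rfl fun a _ => Finset.sum_congr rfl fun b _ => ?_
  rw [multiSum_subtuple φ B I (fun κ => c g₁.1 (I.card + 1) (Fin.cons a κ))
    (fun κ => c (g - g₁.1) (Iᶜ.card + 1) (Fin.cons b κ))]
  ring

/-- The stable terms, with each `φ_a(p) φ_b(p')` replaced by `w a b`. -/
theorem sum_mul_multiSum_splitCoeff (φ : ι → A → F) (B : Finset ι)
    (c : ∀ _g n : ℕ, (Fin n → ι) → F) (g n : ℕ) (w : ι → ι → F) (z : Fin n → A) :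
    (if 0 < g then ∑ a ∈ B, ∑ b ∈ B, w a b *
        multiSum φ B (fun κ => c (g - 1) (n + 2) (Fin.cons a (Fin.cons b κ))) z else 0) +
      ∑ g₁ : Fin (g + 1), ∑ I : Finset (Fin n), (if IsStableSplit g g₁.1 I then
        ∑ a ∈ B, ∑ b ∈ B, w a b * multiSum φ B (fun κ =>
          c g₁.1 (I.card + 1) (Fin.cons a (subtuple κ I)) *
          c (g - g₁.1) (Iᶜ.card + 1) (Fin.cons b (subtuple κ Iᶜ))) z else 0) =
      ∑ a ∈ B, ∑ b ∈ B, w a b * multiSum φ B (splitCoeff c g n a b) z := by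
  have e : ∀ a b, multiSum φ B (splitCoeff c g n a b) z =
      (if 0 < g then multiSum φ B (fun κ => c (g - 1) (n + 2) (Fin.cons a (Fin.cons b κ))) z
        else 0) + ∑ g₁ : Fin (g + 1), ∑ I : Finset (Fin n), if IsStableSplit g g₁.1 I then
          multiSum φ B (fun κ => c g₁.1 (I.card + 1) (Fin.cons a (subtuple κ I)) *
            c (g - g₁.1) (Iᶜ.card + 1) (Fin.cons b (subtuple κ Iᶜ))) z else 0 := fun a b => by
    have e1 : splitCoeff c g n a b = fun κ => _ := rfl
    rw [e1]
    simp only [splitCoeff, multiSum_add, multiSum_sum]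
    congr 1
    · split_ifs
      exacts [rfl, multiSum_zero _ _ _]
    · refine Finset.sum_congr rfl fun g₁ _ => Finset.sum_congr rfl fun I _ => ?_
      split_ifs
      exacts [rfl, multiSum_zero _ _ _]
  simp only [e, mul_add, Finset.sum_add_distrib, Finset.mul_sum]
  congr 1
  · split_ifs with hg
    · rfl
    · simp
  · have e2 : ∀ (g₁ : Fin (g + 1)) (I : Finset (Fin n)), (if IsStableSplit g g₁.1 I then
        ∑ a ∈ B, ∑ b ∈ B, w a b * multiSum φ B (fun κ =>
          c g₁.1 (I.card + 1) (Fin.cons a (subtuple κ I)) *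
          c (g - g₁.1) (Iᶜ.card + 1) (Fin.cons b (subtuple κ Iᶜ))) z else 0) =
        ∑ a ∈ B, ∑ b ∈ B, w a b * (if IsStableSplit g g₁.1 I then
          multiSum φ B (fun κ => c g₁.1 (I.card + 1) (Fin.cons a (subtuple κ I)) *
            c (g - g₁.1) (Iᶜ.card + 1) (Fin.cons b (subtuple κ Iᶜ))) z else 0) := fun g₁ I => by
      split_ifs with hI
      · rfl
      · simp
    simp only [e2]
    rw [Finset.sum_congr rfl fun g₁ _ => Finset.sum_comm]
    rw [Finset.sum_comm]
    refine Finset.sum_congr rfl fun a _ => ?_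
    rw [Finset.sum_congr rfl fun g₁ _ => Finset.sum_comm]
    rw [Finset.sum_comm]

theorem ExpandsBelow.sum_split (h : ExpandsBelow φ B S f c g (n + 1)) (hs : 3 ≤ 2 * g + n)
    {p p' : A} (hp : p ∈ S) (hp' : p' ∈ S) {z : Fin n → A} (hz : ∀ i, z i ∈ S) :
    (if 0 < g then f (g - 1) (n + 2) (Fin.cons p (Fin.cons p' z)) else 0) +
      ∑ g₁ : Fin (g + 1), ∑ I : Finset (Fin n), (if IsStableSplit g g₁.1 I then
        f g₁.1 (I.card + 1) (Fin.cons p (subtuple z I)) *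
        f (g - g₁.1) (Iᶜ.card + 1) (Fin.cons p' (subtuple z Iᶜ)) else 0) =
      ∑ a ∈ B, ∑ b ∈ B, φ a p * φ b p' * multiSum φ B (splitCoeff c g n a b) z := by
  rw [← sum_mul_multiSum_splitCoeff φ B c g n (fun a b => φ a p * φ b p') z]
  congr 1
  · split_ifs with hg
    · exact h.genus hs hp hp' hz hg
    · rfl
  · refine Finset.sum_congr rfl fun g₁ _ => Finset.sum_congr rfl fun I _ => ?_
    split_ifs with hI
    · exact h.split hp hp' hz hI
    · rfl

theorem ExpandsBelow.erase (h : ExpandsBelow φ B S f c g (n + 1)) (hs : 3 ≤ 2 * g + n) {p : A}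
    (hp : p ∈ S) {z : Fin n → A} (hz : ∀ i, z i ∈ S) (a : Fin n) {J : Finset (Fin n)}
    (hJ : J = {a}ᶜ) :
    f g (J.card + 1) (Fin.cons p (subtuple z J)) =
      ∑ b ∈ B, φ b p * multiSum φ B (fun κ => c g (J.card + 1) (Fin.cons b κ)) (subtuple z J) := by
  have hc : J.card = n - 1 := by rw [hJ, Finset.card_compl, Finset.card_singleton, Fintype.card_fin]
  have := a.2
  rw [h g _ ⟨by omega, by omega⟩ (by omega) _ (cons_mem hp (subtuple_mem hz _)), multiSum_cons]

end ExpandsBelow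

theorem sum_ite_eq_singleton {F : Type*} [AddCommMonoid F] {n : ℕ} (I : Finset (Fin n)) (x : F) :
    (∑ a, if I = {a} then x else 0) = if I.card = 1 then x else 0 := by
  split_ifs with h
  · obtain ⟨a, rfl⟩ := Finset.card_eq_one.1 h
    rw [Finset.sum_eq_single a, if_pos rfl]
    · exact fun b _ hb => if_neg fun h => hb (Finset.singleton_inj.1 h).symm
    · simp
  · exact Finset.sum_eq_zero fun a _ => if_neg fun ha => h (by rw [ha, Finset.card_singleton])

/-- The terms of the quadratic part of the recursion that contain a factor of type `(0, 2)`. -/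
theorem sum_split_eq {F : Type*} [AddCommMonoid F] {g n : ℕ} (hs : 3 ≤ 2 * g + n)
    (t : ℕ → Finset (Fin n) → F) :
    ∑ g₁ : Fin (g + 1), ∑ I : Finset (Fin n),
      (if (g₁.1 = 0 ∧ I = ∅) ∨ (g₁.1 = g ∧ I = Finset.univ) then 0 else t g₁.1 I) =
    ∑ g₁ : Fin (g + 1), ∑ I : Finset (Fin n), (if IsStableSplit g g₁.1 I then t g₁.1 I else 0) +
      ∑ a : Fin n, (t 0 {a} + t g {a}ᶜ) := by
  have e : ∀ (g₁ : Fin (g + 1)) (I : Finset (Fin n)),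
      (if (g₁.1 = 0 ∧ I = ∅) ∨ (g₁.1 = g ∧ I = Finset.univ) then 0 else t g₁.1 I) =
      (if IsStableSplit g g₁.1 I then t g₁.1 I else 0) +
      ((∑ a, if I = {a} then (if g₁ = 0 then t 0 I else 0) else 0) +
        ∑ a, if I = {a}ᶜ then (if g₁ = Fin.last g then t g I else 0) else 0) := by
    intro g₁ I
    have hc := Finset.card_add_card_compl I
    have hg := g₁.2
    have hI : ∀ a, I = {a}ᶜ ↔ Iᶜ = {a} := fun a => by rw [← compl_inj_iff, compl_compl]
    have h0 : I = ∅ ↔ I.card = 0 := Finset.card_eq_zero.symm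
    have h1 : I = Finset.univ ↔ Iᶜ.card = 0 := by
      rw [Finset.card_eq_zero, Finset.compl_eq_empty_iff]
    have h2 : g₁ = 0 ↔ g₁.1 = 0 := by rw [Fin.ext_iff]; rfl
    have h3 : g₁ = Fin.last g ↔ g₁.1 = g := by rw [Fin.ext_iff]; rfl
    rw [Fintype.card_fin] at hc
    simp only [hI, sum_ite_eq_singleton, h0, h1, h2, h3]
    generalize g₁.1 = k at *
    split_ifs <;> first | omega | (subst_vars; simp)
  simp only [e, Finset.sum_add_distrib]
  congr 1
  congr 1
  · rw [Finset.sum_congr rfl fun g₁ _ => Finset.sum_comm, Finset.sum_comm]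
    refine Finset.sum_congr rfl fun a _ => ?_
    simp
  · rw [Finset.sum_congr rfl fun g₁ _ => Finset.sum_comm, Finset.sum_comm]
    refine Finset.sum_congr rfl fun a _ => ?_
    simp

/-! ### Mirzakhani's recursion on the coefficients -/

/-- The even powers, in which the volumes are expanded. -/
def evenPow (k : ℕ) (x : ℝ) : ℝ := x ^ (2 * k)

/-- The coefficients that Mirzakhani's recursion yields from those in `c`. -/
noncomputable def volumeStep (c : ∀ _g n : ℕ, (Fin n → ℕ) → ZetaRing) (g n K : ℕ)
    (κ : Fin (n + 1) → ℕ) : ZetaRing :=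
  MvPolynomial.C (1 / 2) * ∑ k ∈ Finset.range K, ∑ l ∈ Finset.range K,
    pairTop k l (κ 0) * splitCoeff c g n k l (Fin.tail κ) +
  MvPolynomial.C (1 / 2) * ∑ a : Fin n, ∑ k ∈ Finset.range K,
    singleTop k (κ 0) (Fin.tail κ a) * c g ((Finset.univ.erase a).card + 1)
      (Fin.cons k (subtuple (Fin.tail κ) (Finset.univ.erase a)))

/-- The coefficients of Mirzakhani's recursion are `(2i + 1) pairTop`; the factor `2i + 1` goes
away on integrating `∂/∂L₁ (L₁ V)`. -/
theorem kernelMoment_pair (q : ℝ) {k l K : ℕ} (h : k + l + 2 < K) (t : ℝ) :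
    (2 * k + 1).factorial * (2 * l + 1).factorial * kernelMoment q (k + l + 2) t =
      ∑ i ∈ Finset.range K, (2 * i + 1) * zetaEval q (pairTop k l i) * t ^ (2 * i) := by
  rw [kernelMoment, sum_range_eq_sum_ite h, Finset.mul_sum]
  refine Finset.sum_congr rfl fun i _ => ?_
  rw [pairTop]
  split_ifs
  · rw [zetaEval_C_mul, Nat.factorial_succ (2 * i)]
    have : ((2 * i).factorial : ℝ) ≠ 0 := by positivity
    have : (2 * (i : ℝ) + 1) ≠ 0 := by positivity
    push_cast
    field_simp
  · simp

/-- The linear terms of Mirzakhani's recursion, expanded in both `t` and `y`; the coefficients are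
`(2i + 1) singleTop`. -/
theorem kernelMoment_single (q : ℝ) {k K : ℕ} (h : k + 1 < K) (t y : ℝ) :
    (2 * k + 1).factorial * (kernelMoment q (k + 1) (t + y) + kernelMoment q (k + 1) (t - y)) =
      ∑ i ∈ Finset.range K, (2 * i + 1) * (∑ j ∈ Finset.range K,
        zetaEval q (singleTop k i j) * evenPow j y) * t ^ (2 * i) := by
  have e : ∀ a ∈ Finset.range (k + 1 + 1),
      4 ^ (k + 1 - a) * zetaEval q (completeSymm (k + 1 - a)) / ((2 * a).factorial : ℝ) *
        (t + y) ^ (2 * a) +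
      4 ^ (k + 1 - a) * zetaEval q (completeSymm (k + 1 - a)) / ((2 * a).factorial : ℝ) *
        (t - y) ^ (2 * a) =
      ∑ i ∈ Finset.range (a + 1), 4 ^ (k + 1 - (i + (a - i))) *
        zetaEval q (completeSymm (k + 1 - (i + (a - i)))) *
        (2 * (t ^ (2 * i) / ((2 * i).factorial : ℝ)) *
        (y ^ (2 * (a - i)) / ((2 * (a - i)).factorial : ℝ))) := fun a _ => by
    rw [← mul_add, div_mul_eq_mul_div, mul_div_assoc, add_pow_add_sub_pow_div_factorial,
      Finset.mul_sum]
    refine Finset.sum_congr rfl fun i hi => ?_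
    rw [Nat.add_sub_cancel' (Nat.lt_succ_iff.1 (Finset.mem_range.1 hi))]
  rw [kernelMoment, kernelMoment, ← Finset.sum_add_distrib, Finset.sum_congr rfl e,
    sum_range_sum_range_eq h fun i j => 4 ^ (k + 1 - (i + j)) *
        zetaEval q (completeSymm (k + 1 - (i + j))) *
        (2 * (t ^ (2 * i) / ((2 * i).factorial : ℝ)) *
        (y ^ (2 * j) / ((2 * j).factorial : ℝ))), Finset.mul_sum]
  refine Finset.sum_congr rfl fun i _ => ?_
  rw [Finset.mul_sum, Finset.mul_sum, Finset.sum_mul]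
  refine Finset.sum_congr rfl fun j _ => ?_
  rw [singleTop, evenPow]
  split_ifs
  · rw [zetaEval_C_mul, Nat.factorial_succ (2 * i)]
    have : ((2 * i).factorial : ℝ) ≠ 0 := by positivity
    have : (2 * (i : ℝ) + 1) ≠ 0 := by positivity
    push_cast
    field_simp
  · simp

theorem qVolume_zero_eq_zero (q : ℝ) {m : ℕ} (hm : m ≤ 1) (L : Fin (m + 1) → ℝ) :
    qVolume q 0 (m + 1) L = 0 := by
  rw [qVolume, if_pos ⟨rfl, hm⟩]

theorem qKernelIntegral₂_evenPow {q : ℝ} (hq : 0 < q) (hq1 : q < 1) (B : Finset ℕ)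
    (X : ℕ → ℕ → ℝ) {f : ℝ → ℝ → ℝ}
    (hf : ∀ x y, f x y = ∑ k ∈ B, ∑ l ∈ B, evenPow k x * evenPow l y * X k l) (t : ℝ) :
    qKernelIntegral₂ q (fun x y => x * y * f x y) t = ∑ k ∈ B, ∑ l ∈ B,
      (2 * k + 1).factorial * (2 * l + 1).factorial * kernelMoment q (k + l + 2) t * X k l := by
  have h := qKernelIntegral₂_odd_sum hq hq1 (B ×ˢ B) (fun x => X x.1 x.2) (fun x => x.1)
    (fun x => x.2) t
  simp only [Finset.sum_product] at h
  refine Eq.trans ?_ (h.trans ?_)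
  · congr 1
    funext x y
    rw [hf, Finset.mul_sum]
    refine Finset.sum_congr rfl fun k _ => ?_
    rw [Finset.mul_sum]
    refine Finset.sum_congr rfl fun l _ => ?_
    rw [evenPow, evenPow]; ring
  · exact Finset.sum_congr rfl fun _ _ => Finset.sum_congr rfl fun _ _ => by ring

theorem qKernelIntegral_evenPow {q : ℝ} (hq : 0 < q) (hq1 : q < 1) (B : Finset ℕ)
    (X : ℕ → ℝ) {f : ℝ → ℝ} (hf : ∀ x, f x = ∑ k ∈ B, evenPow k x * X k) (t : ℝ) :
    qKernelIntegral q (fun x => x * f x) t = ∑ k ∈ B,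
      (2 * k + 1).factorial * kernelMoment q (k + 1) t * X k := by
  have h := qKernelIntegral_odd_sum hq hq1 B X (fun x => x) t
  refine Eq.trans ?_ (h.trans ?_)
  · congr 1
    funext x
    rw [hf, Finset.mul_sum]
    refine Finset.sum_congr rfl fun k _ => ?_
    rw [evenPow]; ring
  · exact Finset.sum_congr rfl fun _ _ => by ring

theorem integral_sum_even_pow (K : ℕ) (A : ℕ → ℝ) (x : ℝ) :
    ∫ s in (0 : ℝ)..1, ∑ i ∈ Finset.range K, (2 * i + 1) * A i * (s * x) ^ (2 * i) =
      ∑ i ∈ Finset.range K, evenPow i x * A i := by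
  rw [intervalIntegral.integral_finsetSum fun j _ => by
    apply Continuous.intervalIntegrable; fun_prop]
  refine Finset.sum_congr rfl fun j _ => ?_
  simp only [mul_pow, ← mul_assoc]
  rw [intervalIntegral.integral_mul_const, intervalIntegral.integral_const_mul, integral_pow,
    evenPow]
  have : (2 * (j : ℝ) + 1) ≠ 0 := by positivity
  push_cast
  field_simp
  simp

/-- Mirzakhani's recursion, for expansions in even powers. The hypotheses `h2` and `h1` say that the
range of exponents is large enough for the step not to leave it. -/
theorem qVolume_eq_multiSum_volumeStep {q : ℝ} (hq : 0 < q) (hq1 : q < 1) {g n K : ℕ}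
    (hs : 3 ≤ 2 * g + n) {c : ∀ _g n : ℕ, (Fin n → ℕ) → ZetaRing}
    (hc : ExpandsBelow evenPow (Finset.range K) Set.univ (qVolume q)
      (fun g n κ => zetaEval q (c g n κ)) g (n + 1))
    (h2 : ∀ k l κ, K ≤ k + l + 2 → splitCoeff c g n k l κ = 0)
    (h1 : ∀ (a : Fin n) k κ, K ≤ k + 1 →
      c g ((Finset.univ.erase a).card + 1) (Fin.cons k κ) = 0) (L : Fin (n + 1) → ℝ) :
    qVolume q g (n + 1) L = multiSum evenPow (Finset.range K)
      (fun κ => zetaEval q (volumeStep c g n K κ)) L := by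
  obtain ⟨x, L', rfl⟩ : ∃ x L', L = Fin.cons x L' := ⟨_, _, (Fin.cons_self_tail L).symm⟩
  set B := Finset.range K with hB
  set D : ℕ → ℕ → ℝ := fun k l => multiSum evenPow B
    (splitCoeff (fun g n κ => zetaEval q (c g n κ)) g n k l) L' with hD
  set E : Fin n → ℕ → ℝ := fun a k => multiSum evenPow B
    (fun κ => zetaEval q (c g ((Finset.univ.erase a).card + 1) (Fin.cons k κ)))
    (subtuple L' (Finset.univ.erase a)) with hE
  have hD0 : ∀ k l, K ≤ k + l + 2 → D k l = 0 := fun k l h => by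
    rw [hD]
    simp only
    have : splitCoeff (fun g n κ => zetaEval q (c g n κ)) g n k l = fun κ => 0 := by
      funext κ
      have := map_splitCoeff (zetaEval q : ZetaRing →+* ℝ) c g n k l κ
      rw [h2 k l κ h, map_zero] at this
      exact this.symm
    rw [this, multiSum_zero]
  have hE0 : ∀ a k, K ≤ k + 1 → E a k = 0 := fun a k h => by
    rw [hE]
    simp only [h1 a k _ h, map_zero, multiSum_zero]
  -- the coefficient of `x^(2i)`
  have hA : ∀ i, multiSum evenPow B (fun κ => zetaEval q (volumeStep c g n K (Fin.cons i κ))) L' =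
      1 / 2 * ∑ k ∈ B, ∑ l ∈ B, zetaEval q (pairTop k l i) * D k l +
      1 / 2 * ∑ a, ∑ k ∈ B, (∑ j ∈ B, zetaEval q (singleTop k i j) * evenPow j (L' a)) * E a k := by
    intro i
    have e2 : ∀ k l κ, zetaEval q (splitCoeff c g n k l κ) =
        splitCoeff (fun g n κ => zetaEval q (c g n κ)) g n k l κ := fun k l κ =>
      map_splitCoeff (zetaEval q : ZetaRing →+* ℝ) c g n k l κ
    simp only [volumeStep, Fin.cons_zero, Fin.tail_cons, map_add, zetaEval_C_mul]
    simp only [map_sum, map_mul, multiSum_add, multiSum_mul_left, multiSum_sum, e2, ← hB]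
    push_cast
    congr 2
    refine Finset.sum_congr rfl fun a _ => Finset.sum_congr rfl fun k _ => ?_
    exact multiSum_single_mul evenPow B a (Finset.compl_singleton a).symm
      (fun j => zetaEval q (singleTop k i j))
      (fun κ => zetaEval q (c g ((Finset.univ.erase a).card + 1) (Fin.cons k κ))) L'
  rw [multiSum_cons]
  simp only [hA]
  rw [← integral_sum_even_pow, qVolume, if_neg (by omega), if_neg (by omega), if_neg (by omega)]
  refine intervalIntegral.integral_congr fun s _ => ?_
  simp only [Fin.cons_zero, Fin.tail_cons]
  generalize s * x = t
  have hmem : ∀ {m : ℕ} (z : Fin m → ℝ) (i : Fin m), z i ∈ (Set.univ : Set ℝ) :=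
    fun _ _ => Set.mem_univ _
  -- the quadratic part
  have hpair : (if _h : 0 < g then qKernelIntegral₂ q (fun x y => x * y *
        qVolume q (g - 1) (n + 2) (Fin.cons x (Fin.cons y L'))) t else 0) +
      ∑ g₁ : Fin (g + 1), ∑ I : Finset (Fin n),
        (if _h : (g₁.1 = 0 ∧ I = ∅) ∨ (g₁.1 = g ∧ I = Finset.univ) then 0
        else qKernelIntegral₂ q (fun x y => x * y *
            (qVolume q g₁.1 (I.card + 1) (Fin.cons x (subtuple L' I)) *
            qVolume q (g - g₁.1) (Iᶜ.card + 1) (Fin.cons y (subtuple L' Iᶜ)))) t) =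
      ∑ k ∈ B, ∑ l ∈ B, (2 * k + 1).factorial * (2 * l + 1).factorial *
        kernelMoment q (k + l + 2) t * D k l := by
    have e := sum_split_eq (g := g) (n := n) hs (fun g₁ I => qKernelIntegral₂ q (fun x y => x * y *
            (qVolume q g₁ (I.card + 1) (Fin.cons x (subtuple L' I)) *
            qVolume q (g - g₁) (Iᶜ.card + 1) (Fin.cons y (subtuple L' Iᶜ)))) t)
    simp only [dite_eq_ite]
    rw [e, Finset.sum_eq_zero (s := Finset.univ) (f := fun a : Fin n => (_ + _ : ℝ)), add_zero,
      ← sum_mul_multiSum_splitCoeff]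
    · congr 1
      · split_ifs with hg
        · exact qKernelIntegral₂_evenPow hq hq1 B _ (fun x y =>
            hc.genus hs (Set.mem_univ x) (Set.mem_univ y) (hmem L') hg) t
        · rfl
      · refine Finset.sum_congr rfl fun g₁ _ => Finset.sum_congr rfl fun I _ => ?_
        split_ifs with hI
        · exact qKernelIntegral₂_evenPow hq hq1 B _ (fun x y =>
            hc.split (Set.mem_univ x) (Set.mem_univ y) (hmem L') hI) t
        · rfl
    · intro a _
      -- the terms with a factor of type `(0, 2)` vanish, as `V_{0,2} = 0`
      have z1 : ∀ x, qVolume q 0 (({a} : Finset (Fin n)).card + 1)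
          (Fin.cons x (subtuple L' {a})) = 0 := fun x =>
        qVolume_zero_eq_zero q (by simp) _
      have z2 : ∀ x, qVolume q (g - g) (({a} : Finset (Fin n))ᶜᶜ.card + 1)
          (Fin.cons x (subtuple L' {a}ᶜᶜ)) = 0 := fun x => by
        rw [Nat.sub_self]
        exact qVolume_zero_eq_zero q (by simp) _
      simp only [z1, z2, zero_mul, mul_zero]
      simp [qKernelIntegral₂]
  have hsingle : ∀ a : Fin n, ∀ u, qKernelIntegral q (fun x => x *
      qVolume q g ((Finset.univ.erase a).card + 1)
        (Fin.cons x (subtuple L' (Finset.univ.erase a)))) u =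
      ∑ k ∈ B, (2 * k + 1).factorial * kernelMoment q (k + 1) u * E a k := fun a u =>
    qKernelIntegral_evenPow hq hq1 B _ (fun x => hc.erase hs (Set.mem_univ x) (hmem L') a
      (Finset.compl_singleton a).symm) u
  simp only [hsingle]
  rw [← mul_add, hpair]
  -- pairs `(k, l)` too large for the range of exponents do not occur, because `D k l = 0`
  have e1 : ∀ k ∈ B, ∀ l ∈ B, (2 * k + 1).factorial * (2 * l + 1).factorial *
      kernelMoment q (k + l + 2) t * D k l =
      ∑ i ∈ B, (2 * i + 1) * (zetaEval q (pairTop k l i) * D k l) * t ^ (2 * i) :=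
      fun k _ l _ => by
    rcases Nat.lt_or_ge (k + l + 2) K with h | h
    · rw [kernelMoment_pair q h, Finset.sum_mul]
      exact Finset.sum_congr rfl fun i _ => by ring
    · simp [hD0 k l h]
  have e3 : ∀ a, ∀ k ∈ B, (2 * k + 1).factorial * kernelMoment q (k + 1) (t + L' a) * E a k +
      (2 * k + 1).factorial * kernelMoment q (k + 1) (t - L' a) * E a k =
      ∑ i ∈ B, (2 * i + 1) * ((∑ j ∈ B, zetaEval q (singleTop k i j) * evenPow j (L' a)) * E a k) *
        t ^ (2 * i) := fun a k _ => by
    rcases Nat.lt_or_ge (k + 1) K with h | h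
    · rw [← add_mul, ← mul_add, kernelMoment_single q h, Finset.sum_mul]
      exact Finset.sum_congr rfl fun i _ => by ring
    · simp [hE0 a k h]
  simp only [← Finset.sum_add_distrib]
  rw [Finset.sum_congr rfl fun k hk => Finset.sum_congr rfl (e1 k hk),
    Finset.sum_congr rfl fun a _ => Finset.sum_congr rfl (e3 a)]
  have e4 : ∀ i : ℕ, (2 * (i : ℝ) + 1) * (1 / 2 * ∑ k ∈ B, ∑ l ∈ B, zetaEval q (pairTop k l i) * D k l +
      1 / 2 * ∑ a, ∑ k ∈ B, (∑ j ∈ B, zetaEval q (singleTop k i j) * evenPow j (L' a)) * E a k) *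
      t ^ (2 * i) =
      1 / 2 * ∑ k ∈ B, ∑ l ∈ B, (2 * i + 1) * (zetaEval q (pairTop k l i) * D k l) * t ^ (2 * i) +
      1 / 2 * ∑ a, ∑ k ∈ B, (2 * i + 1) * ((∑ j ∈ B, zetaEval q (singleTop k i j) *
        evenPow j (L' a)) * E a k) * t ^ (2 * i) := fun i => by
    simp only [← Finset.mul_sum, ← Finset.sum_mul]
    ring
  rw [Finset.sum_congr rfl fun i _ => e4 i, Finset.sum_add_distrib, ← Finset.mul_sum,
    ← Finset.mul_sum]
  congr 2
  · exact (Finset.sum_congr rfl fun k _ => Finset.sum_comm).trans Finset.sum_comm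
  · exact (Finset.sum_congr rfl fun k _ => Finset.sum_comm).trans Finset.sum_comm

/-! ### The topological recursion on the coefficients -/

/-- The indices `(ε, k)` with `k < K`. -/
def etaBox (K : ℕ) : Finset EtaIndex := Finset.univ ×ˢ Finset.range K

/-- `∑ αᵐ` over the branch points `α = ±1`. -/
def branchSum (m : ℕ) : ℚ := 1 + (-1) ^ m

/-- Evaluation of coefficients, with complex values. -/
noncomputable def zetaEvalC (q : ℝ) : ZetaRing →+* ℂ :=
  Complex.ofRealHom.comp (zetaEval q : ZetaRing →+* ℝ)

theorem zetaEvalC_apply (q : ℝ) (x : ZetaRing) : zetaEvalC q x = ((zetaEval q x : ℝ) : ℂ) := rfl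

theorem zetaEvalC_C (q : ℝ) (r : ℚ) : zetaEvalC q (MvPolynomial.C r) = r := by
  rw [zetaEvalC_apply, zetaEval, MvPolynomial.aeval_C]
  simp

/-- The coefficients that the topological recursion yields from those in `c`. -/
noncomputable def etaStep (c : ∀ _g n : ℕ, (Fin n → EtaIndex) → ZetaRing) (g n K : ℕ)
    (κ : Fin (n + 1) → EtaIndex) : ZetaRing :=
  ∑ b₁ ∈ etaBox K, ∑ b₂ ∈ etaBox K,
    MvPolynomial.C (branchSum ((κ 0).1.val + b₁.1.val + b₂.1.val)) * pairCoeff b₁ b₂ (κ 0).2 *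
      splitCoeff c g n b₁ b₂ (Fin.tail κ) +
  ∑ a : Fin n, ∑ b ∈ etaBox K,
    MvPolynomial.C (branchSum ((κ 0).1.val + (Fin.tail κ a).1.val + b.1.val)) *
      singleCoeff b (κ 0).2 (Fin.tail κ a).2 * c g ((Finset.univ.erase a).card + 1)
      (Fin.cons b (subtuple (Fin.tail κ) (Finset.univ.erase a)))

theorem okuyamaCorrelator_zero_two (q : ℝ) {n : ℕ} {a : Fin n} {J : Finset (Fin n)} (hJ : J = {a})
    (p : ℂ) (z : Fin n → ℂ) :
    okuyamaCorrelator q 0 (J.card + 1) (Fin.cons p (subtuple z J)) = 1 / (p - z a) ^ 2 := by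
  subst hJ
  rw [okuyamaCorrelator, correlator, if_neg (by simp), if_pos ⟨rfl, by simp⟩, Fin.cons_zero]
  have e : Fin.last ({a} : Finset (Fin n)).card = Fin.succ ⟨0, by simp⟩ :=
    Fin.ext (by simp)
  rw [e, Fin.cons_succ, subtuple_singleton]

theorem eventually_ne_zero_and_sq_ne_one {α : ℂ} (hα : α ^ 2 = 1) :
    ∀ᶠ p in 𝓝[≠] α, p ≠ 0 ∧ p ^ 2 ≠ 1 := by
  have hα0 : α ≠ 0 := by rintro rfl; norm_num at hα
  have h2 : α ≠ -α := fun h => hα0 (by linear_combination h / 2)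
  filter_upwards [self_mem_nhdsWithin, mem_nhdsWithin_of_mem_nhds (isOpen_ne.mem_nhds hα0),
    mem_nhdsWithin_of_mem_nhds (isOpen_ne.mem_nhds h2)] with p h1 h0 h2
  refine ⟨h0, fun h => ?_⟩
  have : (p - α) * (p + α) = 0 := by linear_combination h - hα
  rcases mul_eq_zero.1 this with h | h
  · exact h1 (sub_eq_zero.1 h)
  · exact h2 (eq_neg_of_add_eq_zero_left h)

theorem sum_etaBox {F : Type*} [AddCommMonoid F] (K : ℕ) (f : EtaIndex → F) :
    ∑ x ∈ etaBox K, f x = ∑ i ∈ Finset.range K, ∑ ε : ZMod 2, f (ε, i) := by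
  rw [etaBox, Finset.sum_product_right]

section step
variable {q : ℝ} {g n K : ℕ} {c : ∀ _g n : ℕ, (Fin n → EtaIndex) → ZetaRing}

/-- The part of the integrand of the recursion in parentheses, at points `p` and `p' = σ(p)`. -/
theorem sum_okuyamaCorrelator_eq (hs : 3 ≤ 2 * g + n)
    (hc : ExpandsBelow etaBasis (etaBox K) {z : ℂ | z ^ 2 ≠ 1} (okuyamaCorrelator q)
      (fun g n κ => zetaEvalC q (c g n κ)) g (n + 1)) {p p' : ℂ} (hp : p ^ 2 ≠ 1) (hp' : p' ^ 2 ≠ 1)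
    {z : Fin n → ℂ} (hz : ∀ i, z i ^ 2 ≠ 1) :
    (if _h : 0 < g then
        okuyamaCorrelator q (g - 1) (n + 2) (Fin.cons p (Fin.cons p' z)) else 0) +
      ∑ g₁ : Fin (g + 1), ∑ I : Finset (Fin n),
        (if _h : (g₁.1 = 0 ∧ I = ∅) ∨ (g₁.1 = g ∧ I = Finset.univ) then 0
        else okuyamaCorrelator q g₁.1 (I.card + 1) (Fin.cons p (subtuple z I)) *
          okuyamaCorrelator q (g - g₁.1) (Iᶜ.card + 1) (Fin.cons p' (subtuple z Iᶜ))) =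
      ∑ a ∈ etaBox K, ∑ b ∈ etaBox K, multiSum etaBasis (etaBox K)
        (splitCoeff (fun g n κ => zetaEvalC q (c g n κ)) g n a b) z *
          (etaBasis a p * etaBasis b p') +
      ∑ a : Fin n, ∑ b ∈ etaBox K, multiSum etaBasis (etaBox K)
        (fun κ => zetaEvalC q (c g ((Finset.univ.erase a).card + 1) (Fin.cons b κ)))
        (subtuple z (Finset.univ.erase a)) *
        (1 / (p - z a) ^ 2 * etaBasis b p' + etaBasis b p * (1 / (p' - z a) ^ 2)) := by
  have e := sum_split_eq (g := g) (n := n) hs (fun g₁ I =>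
    okuyamaCorrelator q g₁ (I.card + 1) (Fin.cons p (subtuple z I)) *
      okuyamaCorrelator q (g - g₁) (Iᶜ.card + 1) (Fin.cons p' (subtuple z Iᶜ)))
  have hJ : ∀ (a : Fin n) (J : Finset (Fin n)), J = {a}ᶜ → ∀ x ∈ {z : ℂ | z ^ 2 ≠ 1},
      okuyamaCorrelator q g (J.card + 1) (Fin.cons x (subtuple z J)) =
      ∑ b ∈ etaBox K, etaBasis b x * multiSum etaBasis (etaBox K)
        (fun κ => zetaEvalC q (c g ((Finset.univ.erase a).card + 1) (Fin.cons b κ)))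
        (subtuple z (Finset.univ.erase a)) := by
    intro a J hJ x hx
    obtain rfl : J = Finset.univ.erase a := hJ.trans (Finset.compl_singleton a)
    exact hc.erase hs hx hz a hJ
  simp only [dite_eq_ite]
  rw [e, ← add_assoc, hc.sum_split hs (p := p) (p' := p') hp hp' hz]
  congr 1
  · exact Finset.sum_congr rfl fun a _ => Finset.sum_congr rfl fun b _ => mul_comm _ _
  · refine Finset.sum_congr rfl fun a _ => ?_
    rw [Nat.sub_zero, Nat.sub_self, okuyamaCorrelator_zero_two q rfl,
      okuyamaCorrelator_zero_two q (compl_compl {a}), hJ a _ rfl p hp, hJ a _ rfl p' hp',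
      Finset.mul_sum, Finset.sum_mul, ← Finset.sum_add_distrib]
    exact Finset.sum_congr rfl fun b _ => by ring

theorem okuyamaCorrelator_eq_sum_residueAt (hs : 2 ≤ 2 * g + n) (z₁ : ℂ) (z : Fin n → ℂ) :
    okuyamaCorrelator q g (n + 1) (Fin.cons z₁ z) = ∑ α ∈ {1, -1}, residueAt (fun p =>
      signedKernel q z₁ p * ((if _h : 0 < g then
        okuyamaCorrelator q (g - 1) (n + 2) (Fin.cons p (Fin.cons p⁻¹ z)) else 0) +
      ∑ g₁ : Fin (g + 1), ∑ I : Finset (Fin n),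
        (if _h : (g₁.1 = 0 ∧ I = ∅) ∨ (g₁.1 = g ∧ I = Finset.univ) then 0
        else okuyamaCorrelator q g₁.1 (I.card + 1) (Fin.cons p (subtuple z I)) *
          okuyamaCorrelator q (g - g₁.1) (Iᶜ.card + 1) (Fin.cons p⁻¹ (subtuple z Iᶜ))))) α := by
  rw [okuyamaCorrelator, correlator, if_neg (by omega), if_neg (by omega)]
  rfl

/-- The topological recursion, for expansions in the basis differentials. The hypotheses `h2` and
`h1` say that the range of indices is large enough for the step not to leave it. -/
theorem okuyamaCorrelator_eq_multiSum_etaStep (hq : 0 < q) (hq1 : q < 1) (hs : 3 ≤ 2 * g + n)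
    (hc : ExpandsBelow etaBasis (etaBox K) {z : ℂ | z ^ 2 ≠ 1} (okuyamaCorrelator q)
      (fun g n κ => zetaEvalC q (c g n κ)) g (n + 1))
    (h2 : ∀ k l κ, K ≤ k.2 + l.2 + 2 → splitCoeff c g n k l κ = 0)
    (h1 : ∀ (a : Fin n) k κ, K ≤ k.2 + 1 →
      c g ((Finset.univ.erase a).card + 1) (Fin.cons k κ) = 0)
    (z : Fin (n + 1) → ℂ) (hz : ∀ i, z i ^ 2 ≠ 1) :
    okuyamaCorrelator q g (n + 1) z = multiSum etaBasis (etaBox K)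
      (fun κ => zetaEvalC q (etaStep c g n K κ)) z := by
  obtain ⟨x, z', rfl⟩ : ∃ x L', z = Fin.cons x L' := ⟨_, _, (Fin.cons_self_tail z).symm⟩
  have hx : x ^ 2 ≠ 1 := hz 0
  have hz' : ∀ i, z' i ^ 2 ≠ 1 := fun i => by simpa using hz i.succ
  set B := etaBox K with hB
  set D : EtaIndex → EtaIndex → ℂ := fun k l => multiSum etaBasis B
    (splitCoeff (fun g n κ => zetaEvalC q (c g n κ)) g n k l) z' with hD
  set E : Fin n → EtaIndex → ℂ := fun a k => multiSum etaBasis B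
    (fun κ => zetaEvalC q (c g ((Finset.univ.erase a).card + 1) (Fin.cons k κ)))
    (subtuple z' (Finset.univ.erase a)) with hE
  have e2 : ∀ k l κ, zetaEvalC q (splitCoeff c g n k l κ) =
      splitCoeff (fun g n κ => zetaEvalC q (c g n κ)) g n k l κ := fun k l κ =>
    map_splitCoeff (zetaEvalC q) c g n k l κ
  have hD0 : ∀ k l, K ≤ k.2 + l.2 + 2 → D k l = 0 := fun k l h => by
    have : splitCoeff (fun g n κ => zetaEvalC q (c g n κ)) g n k l = fun κ => 0 := by
      funext κ
      rw [← e2, h2 k l κ h, map_zero]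
    rw [hD]
    simp only [this, multiSum_zero]
  have hE0 : ∀ a k, K ≤ k.2 + 1 → E a k = 0 := fun a k h => by
    rw [hE]
    simp only [h1 a k _ h, map_zero, multiSum_zero]
  -- the contribution of the branch point `α` to the coefficient of the basis function `η_u`
  set R : ℂ → EtaIndex → ℂ := fun α u =>
    ∑ k ∈ B, ∑ l ∈ B, α ^ (u.1.val + k.1.val + l.1.val) * zetaEvalC q (pairCoeff k l u.2) * D k l +
    ∑ a, ∑ k ∈ B, (∑ v ∈ B, α ^ (u.1.val + v.1.val + k.1.val) *
      zetaEvalC q (singleCoeff k u.2 v.2) * etaBasis v (z' a)) * E a k with hR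
  have hres : ∀ α : ℂ, α ^ 2 = 1 → residueAt (fun p =>
      signedKernel q x p * ((if _h : 0 < g then
        okuyamaCorrelator q (g - 1) (n + 2) (Fin.cons p (Fin.cons p⁻¹ z')) else 0) +
      ∑ g₁ : Fin (g + 1), ∑ I : Finset (Fin n),
        (if _h : (g₁.1 = 0 ∧ I = ∅) ∨ (g₁.1 = g ∧ I = Finset.univ) then 0
        else okuyamaCorrelator q g₁.1 (I.card + 1) (Fin.cons p (subtuple z' I)) *
          okuyamaCorrelator q (g - g₁.1) (Iᶜ.card + 1) (Fin.cons p⁻¹ (subtuple z' Iᶜ))))) α =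
      ∑ u ∈ B, etaBasis u x * R α u := by
    intro α hα
    refine IsResidue.residueAt_eq ?_
    have r1 : ∀ k ∈ B, ∀ l ∈ B, IsResidue (fun p => D k l * (signedKernel q x p *
        (etaBasis k p * etaBasis l p⁻¹))) α (∑ u ∈ B, etaBasis u x *
        (α ^ (u.1.val + k.1.val + l.1.val) * zetaEvalC q (pairCoeff k l u.2) * D k l)) := by
      intro k _ l _
      rcases Nat.lt_or_ge (k.2 + l.2 + 2) K with h | h
      · convert! (isResidue_pair hq hq1 hα hx k l h).const_mul (D k l) using 1
        rw [sum_etaBox, Finset.mul_sum]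
        refine Finset.sum_congr rfl fun i _ => ?_
        rw [Finset.mul_sum]
        exact Finset.sum_congr rfl fun ε _ => by rw [zetaEvalC_apply]; ring
      · simpa [hD0 k l h] using IsResidue.zero
    have r2 : ∀ a, ∀ k ∈ B, IsResidue (fun p => E a k * (signedKernel q x p *
        (1 / (p - z' a) ^ 2 * etaBasis k p⁻¹ + etaBasis k p * (1 / (p⁻¹ - z' a) ^ 2)))) α
        (∑ u ∈ B, etaBasis u x * ((∑ v ∈ B, α ^ (u.1.val + v.1.val + k.1.val) *
          zetaEvalC q (singleCoeff k u.2 v.2) * etaBasis v (z' a)) * E a k)) := by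
      intro a k _
      rcases Nat.lt_or_ge (k.2 + 1) K with h | h
      · convert! (isResidue_single hq hq1 hα hx (hz' a) k h).const_mul (E a k) using 1
        rw [sum_etaBox, Finset.mul_sum]
        refine Finset.sum_congr rfl fun i _ => ?_
        rw [Finset.mul_sum]
        refine Finset.sum_congr rfl fun ε _ => ?_
        rw [sum_etaBox, Finset.sum_mul, Finset.mul_sum, Finset.mul_sum]
        refine Finset.sum_congr rfl fun j _ => ?_
        rw [Finset.sum_mul, Finset.mul_sum, Finset.mul_sum]
        exact Finset.sum_congr rfl fun ε _ => by rw [zetaEvalC_apply]; ring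
      · simpa [hE0 a k h] using IsResidue.zero
    have r := (IsResidue.sum B fun k hk => IsResidue.sum B (r1 k hk)).add
      (IsResidue.sum Finset.univ fun a _ => IsResidue.sum B (r2 a))
    convert! r.congr ?_ using 1
    · rw [Finset.sum_congr rfl fun k _ => Finset.sum_comm, Finset.sum_comm,
        Finset.sum_congr (s₁ := (Finset.univ : Finset (Fin n))) rfl fun k _ => Finset.sum_comm,
        Finset.sum_comm (s := (Finset.univ : Finset (Fin n))), ← Finset.sum_add_distrib]
      refine Finset.sum_congr rfl fun u _ => ?_
      simp only [hR, mul_add, Finset.mul_sum]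
    · filter_upwards [eventually_ne_zero_and_sq_ne_one hα] with p hp
      rw [sum_okuyamaCorrelator_eq hs hc hp.2 (inv_sq_ne_one hp.2) hz', mul_add]
      simp only [Finset.mul_sum, mul_left_comm (signedKernel q x p)]
      rfl
  -- the coefficient of `η_u(z₁)`
  have hA : ∀ u, multiSum etaBasis B (fun κ => zetaEvalC q (etaStep c g n K (Fin.cons u κ))) z' =
      R 1 u + R (-1) u := by
    intro u
    have hbr : ∀ m, zetaEvalC q (MvPolynomial.C (branchSum m)) = 1 ^ m + (-1) ^ m := fun m => by
      rw [zetaEvalC_C, branchSum, one_pow]; push_cast; rfl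
    simp only [etaStep, Fin.cons_zero, Fin.tail_cons, map_add, map_sum, map_mul, hbr, e2,
      multiSum_add, multiSum_mul_left, multiSum_sum, ← hB]
    simp only [hR]
    rw [add_add_add_comm]
    congr 1
    · simp only [← Finset.sum_add_distrib]
      exact Finset.sum_congr rfl fun _ _ => Finset.sum_congr rfl fun _ _ => by ring
    · simp only [← Finset.sum_add_distrib]
      refine Finset.sum_congr rfl fun a _ => Finset.sum_congr rfl fun k _ => ?_
      rw [multiSum_single_mul etaBasis B a (Finset.compl_singleton a).symm
        (fun v => (1 ^ (u.1.val + v.1.val + k.1.val) + (-1) ^ (u.1.val + v.1.val + k.1.val)) *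
          zetaEvalC q (singleCoeff k u.2 v.2))
        (fun κ => zetaEvalC q (c g ((Finset.univ.erase a).card + 1) (Fin.cons k κ))) z',
        ← add_mul, ← Finset.sum_add_distrib]
      congr 1
      exact Finset.sum_congr rfl fun v _ => by ring
  rw [okuyamaCorrelator_eq_sum_residueAt (by omega), Finset.sum_pair (by norm_num),
    hres 1 (by norm_num), hres (-1) (by norm_num), multiSum_cons, ← Finset.sum_add_distrib]
  refine Finset.sum_congr rfl fun u _ => ?_
  rw [hA]
  exact (mul_add _ _ _).symm

end step

/-! ### Comparison of the two recursions -/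

/-- The factor between the volume and the top degree part of the discrete volume. -/
def volumeFactor (g n : ℕ) : ℚ := 2 ^ (3 - 2 * (g : ℤ) - (n : ℤ))

/-- The indicator of `0`. -/
def evenInd (x : ZMod 2) : ℚ := if x = 0 then 1 else 0

/-- For even total parity, the coefficients `c` of a correlation differential, in the basis
`etaBasis`, have leading parts that do not depend on the individual parities: they are the
coefficients `c₀` of the volume up to the factor `volumeFactor`. For odd total parity, `c`
vanishes. -/
structure HasVolumeTop (g n : ℕ) (c₀ : (Fin n → ℕ) → ZetaRing) (c : (Fin n → EtaIndex) → ZetaRing) :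
    Prop where
  top : ∀ κ, HasTopPart (6 * g - 6 + 2 * n - 2 * ∑ i, ((κ i).2 : ℤ))
    (MvPolynomial.C (evenInd (∑ i, (κ i).1) * volumeFactor g n) * c₀ (fun i => (κ i).2)) (c κ)
  parity : ∀ κ, ∑ i, (κ i).1 ≠ 0 → c κ = 0

/-- The contributions of the branch points `1` and `-1` cancel for odd total parity. -/
theorem branchSum_eq (e ε₁ ε₂ : ZMod 2) :
    branchSum (e.val + ε₁.val + ε₂.val) = 2 * evenInd (e + ε₁ + ε₂) := by
  have h : (1 + 1 : ZMod 2) = 0 := by decide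
  rcases zmod_two_cases e with rfl | rfl <;> rcases zmod_two_cases ε₁ with rfl | rfl <;>
    rcases zmod_two_cases ε₂ with rfl | rfl <;>
    simp [branchSum, evenInd, ZMod.val_one, h] <;> norm_num

theorem sum_etaBox_sum_etaBox {F : Type*} [AddCommMonoid F] (K : ℕ) (f : EtaIndex → EtaIndex → F) :
    ∑ a ∈ etaBox K, ∑ b ∈ etaBox K, f a b = ∑ k ∈ Finset.range K, ∑ l ∈ Finset.range K,
      ∑ ε₁ : ZMod 2, ∑ ε₂ : ZMod 2, f (ε₁, k) (ε₂, l) := by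
  simp only [sum_etaBox]
  exact Finset.sum_congr rfl fun k _ => Finset.sum_comm

theorem sum_sum_sum_sum_comm {F W X Y Z : Type*} [AddCommMonoid F] [Fintype W] [Fintype X]
    [Fintype Y] [Fintype Z] (f : W → X → Y → Z → F) :
    ∑ w, ∑ x, ∑ y, ∑ z, f w x y z = ∑ y, ∑ z, ∑ w, ∑ x, f w x y z := by
  rw [Finset.sum_congr rfl fun w _ => Finset.sum_comm, Finset.sum_comm]
  refine Finset.sum_congr rfl fun y _ => ?_
  rw [Finset.sum_congr rfl fun w _ => Finset.sum_comm, Finset.sum_comm]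

/-- Summing over the parities of the two inner indices leaves the factor `1/2` that Mirzakhani's
recursion has in front of its first term. -/
theorem evenInd_genus (e s : ZMod 2) :
    ∑ ε₁, ∑ ε₂, 2 * evenInd (e + ε₁ + ε₂) * (1 / 16) * (evenInd (ε₁ + (ε₂ + s)) * 2) =
      evenInd (e + s) * (1 / 2) := by
  have h : (1 + 1 : ZMod 2) = 0 := by decide
  simp only [sum_zmod_two]
  rcases zmod_two_cases e with rfl | rfl <;> rcases zmod_two_cases s with rfl | rfl <;>
    simp [evenInd, h] <;> norm_num

/-- The same sum over parities, for the terms with two factors. -/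
theorem evenInd_split (e s s' : ZMod 2) :
    ∑ ε₁, ∑ ε₂, 2 * evenInd (e + ε₁ + ε₂) * (1 / 16) *
      (evenInd (ε₁ + s) * evenInd (ε₂ + s') * 4) = evenInd (e + (s + s')) * (1 / 2) := by
  have h : (1 + 1 : ZMod 2) = 0 := by decide
  simp only [sum_zmod_two]
  rcases zmod_two_cases e with rfl | rfl <;> rcases zmod_two_cases s with rfl | rfl <;>
    rcases zmod_two_cases s' with rfl | rfl <;> simp [evenInd, h] <;> norm_num

/-- The same sum over parities, for the terms that are linear in the volumes. -/
theorem evenInd_single (e s s' : ZMod 2) :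
    ∑ ε, 2 * evenInd (e + s + ε) * (1 / 8) * (evenInd (ε + s') * 2) =
      evenInd (e + (s + s')) * (1 / 2) := by
  have h : (1 + 1 : ZMod 2) = 0 := by decide
  simp only [sum_zmod_two]
  rcases zmod_two_cases e with rfl | rfl <;> rcases zmod_two_cases s with rfl | rfl <;>
    rcases zmod_two_cases s' with rfl | rfl <;> simp [evenInd, h] <;> norm_num

theorem volumeFactor_genus {g : ℕ} (hg : 0 < g) (n : ℕ) :
    volumeFactor (g - 1) (n + 2) = 2 * volumeFactor g (n + 1) := by
  rw [volumeFactor, volumeFactor, ← zpow_one_add₀ two_ne_zero]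
  congr 1
  push_cast [Nat.cast_sub hg]; ring

theorem volumeFactor_split {g g₁ : ℕ} (hg : g₁ ≤ g) {m m' n : ℕ} (h : m + m' = n) :
    volumeFactor g₁ (m + 1) * volumeFactor (g - g₁) (m' + 1) = 4 * volumeFactor g (n + 1) := by
  rw [volumeFactor, volumeFactor, volumeFactor, ← zpow_add₀ two_ne_zero,
    show (4 : ℚ) = 2 ^ (2 : ℤ) by norm_num, ← zpow_add₀ two_ne_zero]
  congr 1
  push_cast [Nat.cast_sub hg, ← h]; ring

theorem volumeFactor_single (g n : ℕ) : volumeFactor g n = 2 * volumeFactor g (n + 1) := by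
  rw [volumeFactor, volumeFactor, ← zpow_one_add₀ two_ne_zero]
  congr 1
  push_cast; ring

theorem snd_comp_cons {n : ℕ} (a : EtaIndex) (κ : Fin n → EtaIndex) :
    (fun i => ((Fin.cons a κ : Fin (n + 1) → EtaIndex) i).2) =
      (Fin.cons a.2 fun i => (κ i).2 : Fin (n + 1) → ℕ) := by
  funext i
  refine Fin.cases ?_ (fun j => ?_) i <;> simp

theorem sum_subtuple_fst {n : ℕ} (κ : Fin n → EtaIndex) (I : Finset (Fin n)) :
    ∑ i, (subtuple κ I i).1 = ∑ i ∈ I, (κ i).1 :=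
  sum_subtuple (fun i => (κ i).1) I

theorem sum_subtuple_snd {n : ℕ} (κ : Fin n → EtaIndex) (I : Finset (Fin n)) :
    ∑ i, ((subtuple κ I i).2 : ℤ) = ∑ i ∈ I, ((κ i).2 : ℤ) :=
  sum_subtuple (fun i => ((κ i).2 : ℤ)) I

theorem snd_subtuple {n : ℕ} (κ : Fin n → EtaIndex) (I : Finset (Fin n)) :
    (fun i => (subtuple κ I i).2) = subtuple (fun i => (κ i).2) I := rfl

theorem HasVolumeTop.cons {g n : ℕ} {c₀ : (Fin (n + 1) → ℕ) → ZetaRing}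
    {c : (Fin (n + 1) → EtaIndex) → ZetaRing} (h : HasVolumeTop g (n + 1) c₀ c) (a : EtaIndex)
    (κ : Fin n → EtaIndex) :
    HasTopPart (6 * g - 6 + 2 * (n + 1) - 2 * (a.2 + ∑ i, ((κ i).2 : ℤ)))
      (MvPolynomial.C (evenInd (a.1 + ∑ i, (κ i).1) * volumeFactor g (n + 1)) *
        c₀ (Fin.cons a.2 fun i => (κ i).2)) (c (Fin.cons a κ)) := by
  have := h.top (Fin.cons a κ)
  rw [snd_comp_cons] at this
  simpa [Fin.sum_univ_succ] using this

theorem HasVolumeTop.cons_eq_zero {g n : ℕ} {c₀ : (Fin (n + 1) → ℕ) → ZetaRing}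
    {c : (Fin (n + 1) → EtaIndex) → ZetaRing} (h : HasVolumeTop g (n + 1) c₀ c) (a : EtaIndex)
    (κ : Fin n → EtaIndex) (hne : a.1 + ∑ i, (κ i).1 ≠ 0) : c (Fin.cons a κ) = 0 :=
  h.parity _ (by simpa [Fin.sum_univ_succ] using hne)

/-- The leading part of a quadratic term of the topological recursion, summed over the parities of
the two inner indices. -/
theorem hasTopPart_sum_pair {d d' : ℤ} {k l i : ℕ} (hd : d = 2 * (k + l + 2 - i) + d')
    (e : ZMod 2) {w : ZMod 2 → ZMod 2 → ℚ} {Y₀ : ZetaRing} {Y : EtaIndex → EtaIndex → ZetaRing}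
    (h : ∀ ε₁ ε₂, HasTopPart d' (MvPolynomial.C (w ε₁ ε₂) * Y₀) (Y (ε₁, k) (ε₂, l))) {r : ℚ}
    (hr : ∑ ε₁, ∑ ε₂, 2 * evenInd (e + ε₁ + ε₂) * (1 / 16) * w ε₁ ε₂ = r) :
    HasTopPart d (MvPolynomial.C r * (pairTop k l i * Y₀)) (∑ ε₁ : ZMod 2, ∑ ε₂ : ZMod 2,
      MvPolynomial.C (branchSum (e.val + ε₁.val + ε₂.val)) * pairCoeff (ε₁, k) (ε₂, l) i *
        Y (ε₁, k) (ε₂, l)) := by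
  rw [← hr]
  simp only [map_sum, Finset.sum_mul]
  refine HasTopPart.sum _ fun ε₁ _ => HasTopPart.sum _ fun ε₂ _ => ?_
  have h1 := ((hasTopPart_pairCoeff (ε₁, k) (ε₂, l) i).mul (h ε₁ ε₂)).C_mul
    (branchSum (e.val + ε₁.val + ε₂.val))
  rw [← mul_assoc (MvPolynomial.C _) (pairCoeff _ _ _)] at h1
  have h2 := h1.congr_degree hd.symm
  convert! h2 using 1
  rw [branchSum_eq]
  simp only [map_mul]
  ring

/-- The leading part of a term with `ω_{0,2}`, summed over the parity of the inner index. -/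
theorem hasTopPart_sum_single {d d' : ℤ} {k i j : ℕ} (hd : d = 2 * (k + 1 - i - j) + d')
    (e s : ZMod 2) {w : ZMod 2 → ℚ} {Y₀ : ZetaRing} {Y : EtaIndex → ZetaRing}
    (h : ∀ ε, HasTopPart d' (MvPolynomial.C (w ε) * Y₀) (Y (ε, k))) {r : ℚ}
    (hr : ∑ ε, 2 * evenInd (e + s + ε) * (1 / 8) * w ε = r) :
    HasTopPart d (MvPolynomial.C r * (singleTop k i j * Y₀)) (∑ ε : ZMod 2,
      MvPolynomial.C (branchSum (e.val + s.val + ε.val)) * singleCoeff (ε, k) i j * Y (ε, k)) := by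
  rw [← hr]
  simp only [map_sum, Finset.sum_mul]
  refine HasTopPart.sum _ fun ε _ => ?_
  have h1 := ((hasTopPart_singleCoeff (ε, k) i j).mul (h ε)).C_mul
    (branchSum (e.val + s.val + ε.val))
  rw [← mul_assoc (MvPolynomial.C _) (singleCoeff _ _ _)] at h1
  have h2 := h1.congr_degree hd.symm
  convert! h2 using 1
  rw [branchSum_eq]
  simp only [map_mul]
  ring

section step
variable {g n : ℕ} {c₀ : ∀ _g n : ℕ, (Fin n → ℕ) → ZetaRing}
  {c : ∀ _g n : ℕ, (Fin n → EtaIndex) → ZetaRing}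

theorem hasTopPart_genus (hs : 3 ≤ 2 * g + n) (h : ∀ g' n', IsStable g' n' →
      2 * g' + n' < 2 * g + (n + 1) → HasVolumeTop g' n' (c₀ g' n') (c g' n'))
    (hg : 0 < g) (a b : EtaIndex) (κ : Fin n → EtaIndex) :
    HasTopPart (6 * g - 8 + 2 * n - 2 * (a.2 + b.2 + ∑ i, ((κ i).2 : ℤ)))
      (MvPolynomial.C (evenInd (a.1 + (b.1 + ∑ i, (κ i).1)) * 2) * (MvPolynomial.C
        (volumeFactor g (n + 1)) * c₀ (g - 1) (n + 2) (Fin.cons a.2 (Fin.cons b.2 fun i => (κ i).2))))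
      (c (g - 1) (n + 2) (Fin.cons a (Fin.cons b κ))) := by
  have h1 := (h (g - 1) (n + 2) ⟨by omega, by omega⟩ (by omega)).cons a (Fin.cons b κ)
  rw [snd_comp_cons, volumeFactor_genus hg] at h1
  simp only [Fin.sum_univ_succ, Fin.cons_zero, Fin.cons_succ] at h1
  convert! h1.congr_degree ?_ using 1
  · simp only [map_mul]; ring
  · push_cast [Nat.cast_sub hg]; ring

theorem hasTopPart_split (h : ∀ g' n', IsStable g' n' →
      2 * g' + n' < 2 * g + (n + 1) → HasVolumeTop g' n' (c₀ g' n') (c g' n'))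
    {g₁ : Fin (g + 1)} {I : Finset (Fin n)} (hI : IsStableSplit g g₁.1 I)
    (a b : EtaIndex) (κ : Fin n → EtaIndex) :
    HasTopPart (6 * g - 8 + 2 * n - 2 * (a.2 + b.2 + ∑ i, ((κ i).2 : ℤ)))
      (MvPolynomial.C (evenInd (a.1 + ∑ i ∈ I, (κ i).1) * evenInd (b.1 + ∑ i ∈ Iᶜ, (κ i).1) * 4) *
        (MvPolynomial.C (volumeFactor g (n + 1)) *
        (c₀ g₁.1 (I.card + 1) (Fin.cons a.2 (subtuple (fun i => (κ i).2) I)) *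
          c₀ (g - g₁.1) (Iᶜ.card + 1) (Fin.cons b.2 (subtuple (fun i => (κ i).2) Iᶜ)))))
      (c g₁.1 (I.card + 1) (Fin.cons a (subtuple κ I)) *
        c (g - g₁.1) (Iᶜ.card + 1) (Fin.cons b (subtuple κ Iᶜ))) := by
  have hg : g₁.1 ≤ g := Nat.lt_succ_iff.1 g₁.2
  have hc := Finset.card_add_card_compl I
  rw [Fintype.card_fin] at hc
  obtain ⟨hI1, hI2⟩ := hI
  have h1 := (h g₁.1 (I.card + 1) ⟨by omega, by omega⟩ (by omega)).cons a (subtuple κ I)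
  have h2 := (h (g - g₁.1) (Iᶜ.card + 1) ⟨by omega, by omega⟩ (by omega)).cons b (subtuple κ Iᶜ)
  rw [sum_subtuple_fst, sum_subtuple_snd, snd_subtuple] at h1 h2
  have hc' : (I.card : ℤ) + Iᶜ.card = n := by exact_mod_cast hc
  convert! (h1.mul h2).congr_degree ?_ using 1
  · have := congrArg (MvPolynomial.C (σ := ℕ)) (volumeFactor_split hg hc)
    simp only [map_mul] at this ⊢
    linear_combination (-(MvPolynomial.C (evenInd (a.1 + ∑ i ∈ I, (κ i).1)) *
      MvPolynomial.C (evenInd (b.1 + ∑ i ∈ Iᶜ, (κ i).1)) *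
      (c₀ g₁.1 (I.card + 1) (Fin.cons a.2 (subtuple (fun i => (κ i).2) I)) *
      c₀ (g - g₁.1) (Iᶜ.card + 1) (Fin.cons b.2 (subtuple (fun i => (κ i).2) Iᶜ))))) * this
  · rw [← Finset.sum_add_sum_compl I (fun i => ((κ i).2 : ℤ)), Nat.cast_sub hg]
    linear_combination 2 * hc'

theorem hasTopPart_erase (hs : 3 ≤ 2 * g + n) (h : ∀ g' n', IsStable g' n' →
      2 * g' + n' < 2 * g + (n + 1) → HasVolumeTop g' n' (c₀ g' n') (c g' n'))
    (a : Fin n) (b : EtaIndex) (κ : Fin n → EtaIndex) :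
    HasTopPart (6 * g - 6 + 2 * n - 2 * (b.2 + ∑ i ∈ Finset.univ.erase a, ((κ i).2 : ℤ)))
      (MvPolynomial.C (evenInd (b.1 + ∑ i ∈ Finset.univ.erase a, (κ i).1) * 2) * (MvPolynomial.C
        (volumeFactor g (n + 1)) * c₀ g ((Finset.univ.erase a).card + 1)
          (Fin.cons b.2 (subtuple (fun i => (κ i).2) (Finset.univ.erase a)))))
      (c g ((Finset.univ.erase a).card + 1) (Fin.cons b (subtuple κ (Finset.univ.erase a)))) := by
  have hc : (Finset.univ.erase a).card + 1 = n := by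
    rw [Finset.card_erase_add_one (Finset.mem_univ a), Finset.card_univ, Fintype.card_fin]
  have h1 := (h g _ ⟨by omega, by omega⟩ (by omega)).cons b (subtuple κ (Finset.univ.erase a))
  have hf : volumeFactor g ((Finset.univ.erase a).card + 1) = 2 * volumeFactor g (n + 1) := by
    rw [hc, volumeFactor_single]
  have hc' : ((Finset.univ.erase a).card + 1 : ℤ) = n := by exact_mod_cast hc
  rw [sum_subtuple_fst, sum_subtuple_snd, hf, snd_subtuple] at h1
  convert! h1.congr_degree ?_ using 1
  · simp only [map_mul]; ring
  · linear_combination 2 * hc'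

theorem hasTopPart_sum_genus (hs : 3 ≤ 2 * g + n) (h : ∀ g' n', IsStable g' n' →
      2 * g' + n' < 2 * g + (n + 1) → HasVolumeTop g' n' (c₀ g' n') (c g' n'))
    (hg : 0 < g) (k l i : ℕ) (e : ZMod 2) (κ : Fin n → EtaIndex) {d : ℤ}
    (hd : d = 6 * g - 4 + 2 * n - 2 * (i + ∑ i, ((κ i).2 : ℤ))) :
    HasTopPart d (MvPolynomial.C (evenInd (e + ∑ i, (κ i).1) * volumeFactor g (n + 1)) *
      (MvPolynomial.C (1 / 2) * (pairTop k l i *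
        c₀ (g - 1) (n + 2) (Fin.cons k (Fin.cons l fun i => (κ i).2)))))
      (∑ ε₁ : ZMod 2, ∑ ε₂ : ZMod 2,
        MvPolynomial.C (branchSum (e.val + ε₁.val + ε₂.val)) * pairCoeff (ε₁, k) (ε₂, l) i *
        c (g - 1) (n + 2) (Fin.cons (ε₁, k) (Fin.cons (ε₂, l) κ))) := by
  have h0 := fun ε₁ ε₂ => hasTopPart_genus hs h hg (ε₁, k) (ε₂, l) κ
  dsimp only at h0
  have h1 := hasTopPart_sum_pair (d := d) (k := k) (l := l) (i := i)
    (d' := 6 * g - 8 + 2 * n - 2 * (k + l + ∑ i, ((κ i).2 : ℤ))) (by rw [hd]; ring) e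
    (w := fun ε₁ ε₂ => evenInd (ε₁ + (ε₂ + ∑ i, (κ i).1)) * 2)
    (Y := fun a b => c (g - 1) (n + 2) (Fin.cons a (Fin.cons b κ))) h0 (evenInd_genus e (∑ i, (κ i).1))
  have e1 : MvPolynomial.C (evenInd (e + ∑ i, (κ i).1) * volumeFactor g (n + 1)) *
      (MvPolynomial.C (1 / 2) * (pairTop k l i *
        c₀ (g - 1) (n + 2) (Fin.cons k (Fin.cons l fun i => (κ i).2)))) =
        MvPolynomial.C (evenInd (e + ∑ i, (κ i).1) * (1 / 2)) *
      (pairTop k l i * (MvPolynomial.C (volumeFactor g (n + 1)) *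
        c₀ (g - 1) (n + 2) (Fin.cons k (Fin.cons l fun i => (κ i).2)))) := by
    simp only [map_mul]; ring
  rw [e1]
  exact h1

theorem hasTopPart_sum_split (h : ∀ g' n', IsStable g' n' →
      2 * g' + n' < 2 * g + (n + 1) → HasVolumeTop g' n' (c₀ g' n') (c g' n'))
    {g₁ : Fin (g + 1)} {I : Finset (Fin n)} (hI : IsStableSplit g g₁.1 I)
    (k l i : ℕ) (e : ZMod 2) (κ : Fin n → EtaIndex) {d : ℤ}
    (hd : d = 6 * g - 4 + 2 * n - 2 * (i + ∑ i, ((κ i).2 : ℤ))) :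
    HasTopPart d (MvPolynomial.C (evenInd (e + ∑ i, (κ i).1) * volumeFactor g (n + 1)) *
      (MvPolynomial.C (1 / 2) * (pairTop k l i *
        (c₀ g₁.1 (I.card + 1) (Fin.cons k (subtuple (fun i => (κ i).2) I)) *
          c₀ (g - g₁.1) (Iᶜ.card + 1) (Fin.cons l (subtuple (fun i => (κ i).2) Iᶜ))))))
      (∑ ε₁ : ZMod 2, ∑ ε₂ : ZMod 2,
        MvPolynomial.C (branchSum (e.val + ε₁.val + ε₂.val)) * pairCoeff (ε₁, k) (ε₂, l) i *
        (c g₁.1 (I.card + 1) (Fin.cons (ε₁, k) (subtuple κ I)) *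
          c (g - g₁.1) (Iᶜ.card + 1) (Fin.cons (ε₂, l) (subtuple κ Iᶜ)))) := by
  have h0 := fun ε₁ ε₂ => hasTopPart_split h hI (ε₁, k) (ε₂, l) κ
  dsimp only at h0
  have h1 := hasTopPart_sum_pair (d := d) (k := k) (l := l) (i := i)
    (d' := 6 * g - 8 + 2 * n - 2 * (k + l + ∑ i, ((κ i).2 : ℤ))) (by rw [hd]; ring) e
    (w := fun ε₁ ε₂ => evenInd (ε₁ + ∑ i ∈ I, (κ i).1) * evenInd (ε₂ + ∑ i ∈ Iᶜ, (κ i).1) * 4)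
    (Y := fun a b => c g₁.1 (I.card + 1) (Fin.cons a (subtuple κ I)) *
      c (g - g₁.1) (Iᶜ.card + 1) (Fin.cons b (subtuple κ Iᶜ)))
    h0
    (evenInd_split e (∑ i ∈ I, (κ i).1) (∑ i ∈ Iᶜ, (κ i).1))
  rw [Finset.sum_add_sum_compl] at h1
  have e1 : MvPolynomial.C (evenInd (e + ∑ i, (κ i).1) * volumeFactor g (n + 1)) *
      (MvPolynomial.C (1 / 2) * (pairTop k l i *
        (c₀ g₁.1 (I.card + 1) (Fin.cons k (subtuple (fun i => (κ i).2) I)) *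
          c₀ (g - g₁.1) (Iᶜ.card + 1) (Fin.cons l (subtuple (fun i => (κ i).2) Iᶜ))))) =
      MvPolynomial.C (evenInd (e + ∑ i, (κ i).1) * (1 / 2)) *
      (pairTop k l i * (MvPolynomial.C (volumeFactor g (n + 1)) *
        (c₀ g₁.1 (I.card + 1) (Fin.cons k (subtuple (fun i => (κ i).2) I)) *
          c₀ (g - g₁.1) (Iᶜ.card + 1) (Fin.cons l (subtuple (fun i => (κ i).2) Iᶜ))))) := by
    simp only [map_mul]; ring
  rw [e1]
  exact h1

theorem hasTopPart_sum_erase (hs : 3 ≤ 2 * g + n) (h : ∀ g' n', IsStable g' n' →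
      2 * g' + n' < 2 * g + (n + 1) → HasVolumeTop g' n' (c₀ g' n') (c g' n'))
    (a : Fin n) (k i : ℕ) (e : ZMod 2) (κ : Fin n → EtaIndex) {d : ℤ}
    (hd : d = 6 * g - 4 + 2 * n - 2 * (i + ∑ i, ((κ i).2 : ℤ))) :
    HasTopPart d (MvPolynomial.C (evenInd (e + ∑ i, (κ i).1) * volumeFactor g (n + 1)) *
      (MvPolynomial.C (1 / 2) * (singleTop k i (κ a).2 *
        c₀ g ((Finset.univ.erase a).card + 1)
          (Fin.cons k (subtuple (fun i => (κ i).2) (Finset.univ.erase a))))))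
      (∑ ε : ZMod 2, MvPolynomial.C (branchSum (e.val + (κ a).1.val + ε.val)) *
        singleCoeff (ε, k) i (κ a).2 * c g ((Finset.univ.erase a).card + 1)
          (Fin.cons (ε, k) (subtuple κ (Finset.univ.erase a)))) := by
  have h0 := fun ε => hasTopPart_erase hs h a (ε, k) κ
  dsimp only at h0
  have h1 := hasTopPart_sum_single (d := d) (k := k) (i := i) (j := (κ a).2)
    (d' := 6 * g - 6 + 2 * n - 2 * (k + ∑ i ∈ Finset.univ.erase a, ((κ i).2 : ℤ)))
    (by rw [hd, ← Finset.add_sum_erase _ (fun i => ((κ i).2 : ℤ)) (Finset.mem_univ a)]; ring)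
    e (κ a).1 (w := fun ε => evenInd (ε + ∑ i ∈ Finset.univ.erase a, (κ i).1) * 2)
    (Y := fun b => c g ((Finset.univ.erase a).card + 1)
      (Fin.cons b (subtuple κ (Finset.univ.erase a))))
    h0
    (evenInd_single e (κ a).1 (∑ i ∈ Finset.univ.erase a, (κ i).1))
  rw [Finset.add_sum_erase _ (fun i => (κ i).1) (Finset.mem_univ a)] at h1
  have e1 : MvPolynomial.C (evenInd (e + ∑ i, (κ i).1) * volumeFactor g (n + 1)) *
      (MvPolynomial.C (1 / 2) * (singleTop k i (κ a).2 *
        c₀ g ((Finset.univ.erase a).card + 1)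
          (Fin.cons k (subtuple (fun i => (κ i).2) (Finset.univ.erase a))))) =
      MvPolynomial.C (evenInd (e + ∑ i, (κ i).1) * (1 / 2)) *
      (singleTop k i (κ a).2 * (MvPolynomial.C (volumeFactor g (n + 1)) *
        c₀ g ((Finset.univ.erase a).card + 1)
          (Fin.cons k (subtuple (fun i => (κ i).2) (Finset.univ.erase a))))) := by
    simp only [map_mul]; ring
  rw [e1]
  exact h1

theorem splitCoeff_eq_zero_of_parity (hs : 3 ≤ 2 * g + n) (h : ∀ g' n', IsStable g' n' →
      2 * g' + n' < 2 * g + (n + 1) → HasVolumeTop g' n' (c₀ g' n') (c g' n'))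
    (a b : EtaIndex) (κ : Fin n → EtaIndex) (hne : a.1 + b.1 + ∑ i, (κ i).1 ≠ 0) :
    splitCoeff c g n a b κ = 0 := by
  rw [splitCoeff, Finset.sum_eq_zero, add_zero]
  · split_ifs with hg
    · exact (h (g - 1) (n + 2) ⟨by omega, by omega⟩ (by omega)).cons_eq_zero _ _
        (by simpa [Fin.sum_univ_succ, add_assoc] using hne)
    · rfl
  · intro g₁ _
    refine Finset.sum_eq_zero fun I _ => ?_
    split_ifs with hI
    · have hg : g₁.1 ≤ g := Nat.lt_succ_iff.1 g₁.2
      have hc := Finset.card_add_card_compl I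
      rw [Fintype.card_fin] at hc
      obtain ⟨hI1, hI2⟩ := hI
      by_cases ha : a.1 + ∑ i ∈ I, (κ i).1 = 0
      · rw [(h (g - g₁.1) (Iᶜ.card + 1) ⟨by omega, by omega⟩ (by omega)).cons_eq_zero, mul_zero]
        rw [sum_subtuple_fst]
        intro hb
        apply hne
        rw [← Finset.sum_add_sum_compl I (fun i => (κ i).1), add_add_add_comm, ha, hb, add_zero]
      · rw [(h g₁.1 (I.card + 1) ⟨by omega, by omega⟩ (by omega)).cons_eq_zero, zero_mul]
        rwa [sum_subtuple_fst]
    · rfl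

/-- The two recursions agree in top degree. -/
theorem hasVolumeTop_step (K : ℕ) (hs : 3 ≤ 2 * g + n) (h : ∀ g' n', IsStable g' n' →
      2 * g' + n' < 2 * g + (n + 1) → HasVolumeTop g' n' (c₀ g' n') (c g' n')) :
    HasVolumeTop g (n + 1) (volumeStep c₀ g n K) (etaStep c g n K) := by
  constructor
  · intro κ
    obtain ⟨u, κ, rfl⟩ : ∃ u κ', κ = Fin.cons u κ' := ⟨_, _, (Fin.cons_self_tail κ).symm⟩
    rw [snd_comp_cons]
    simp only [volumeStep, etaStep, Fin.cons_zero, Fin.tail_cons, Fin.sum_univ_succ, Fin.cons_succ]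
    have hd : (6 * g - 6 + 2 * (n + 1 : ℕ) - 2 * (u.2 + ∑ i, ((κ i).2 : ℤ)) : ℤ) =
      6 * g - 4 + 2 * n - 2 * (u.2 + ∑ i, ((κ i).2 : ℤ)) := by push_cast; ring
    rw [hd]
    generalize hd' : (6 * g - 4 + 2 * n - 2 * (u.2 + ∑ i, ((κ i).2 : ℤ)) : ℤ) = d
    rw [mul_add]
    refine HasTopPart.add ?_ ?_
    · rw [sum_etaBox_sum_etaBox]
      simp only [Finset.mul_sum]
      refine HasTopPart.sum _ fun k _ => HasTopPart.sum _ fun l _ => ?_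
      simp only [splitCoeff, mul_add, Finset.sum_add_distrib]
      refine HasTopPart.add ?_ ?_
      · split_ifs with hg
        · exact hasTopPart_sum_genus hs h hg k l u.2 u.1 κ hd'.symm
        · simpa using HasTopPart.zero _
      · simp only [Finset.mul_sum]
        rw [sum_sum_sum_sum_comm (F := ZetaRing) (W := ZMod 2) (X := ZMod 2)]
        refine HasTopPart.sum _ fun g₁ _ => HasTopPart.sum _ fun I _ => ?_
        split_ifs with hI
        · exact hasTopPart_sum_split h hI k l u.2 u.1 κ hd'.symm
        · simpa using HasTopPart.zero _
    · simp only [sum_etaBox, Finset.mul_sum]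
      exact HasTopPart.sum _ fun a _ => HasTopPart.sum _ fun k _ =>
        hasTopPart_sum_erase hs h a k u.2 u.1 κ hd'.symm
  · intro κ hκ
    rw [Fin.sum_univ_succ] at hκ
    have h0 : ∀ x : ZMod 2, x + x = 0 := by decide
    rw [etaStep, Finset.sum_eq_zero, Finset.sum_eq_zero, add_zero]
    · intro a _
      refine Finset.sum_eq_zero fun b _ => ?_
      have hc : (Finset.univ.erase a).card + 1 = n := by
        rw [Finset.card_erase_add_one (Finset.mem_univ a), Finset.card_univ, Fintype.card_fin]
      by_cases hb : b.1 + ∑ i ∈ Finset.univ.erase a, (Fin.tail κ i).1 = 0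
      · rw [branchSum_eq, evenInd, if_neg, mul_zero, map_zero, zero_mul, zero_mul]
        intro h1
        apply hκ
        rw [← Finset.add_sum_erase _ _ (Finset.mem_univ a)]
        show (κ 0).1 + ((Fin.tail κ a).1 + ∑ i ∈ Finset.univ.erase a, (Fin.tail κ i).1) = 0
        linear_combination h1 + hb - h0 b.1
      · rw [(h g _ ⟨by omega, by omega⟩ (by omega)).cons_eq_zero, mul_zero]
        rwa [sum_subtuple_fst]
    · intro a _
      refine Finset.sum_eq_zero fun b _ => ?_
      -- odd total parity makes either the sum over the branch points or the lower coefficient vanish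
      by_cases hb : a.1 + b.1 + ∑ i, (Fin.tail κ i).1 = 0
      · rw [branchSum_eq, evenInd, if_neg, mul_zero, map_zero, zero_mul, zero_mul]
        intro h1
        apply hκ
        show (κ 0).1 + ∑ i, (Fin.tail κ i).1 = 0
        linear_combination h1 + hb - h0 a.1 - h0 b.1
      · rw [splitCoeff_eq_zero_of_parity hs h a b _ hb, mul_zero]

end step

/-! ### Expansions of volumes and correlation differentials -/

theorem multiSum_subset {ι A F : Type*} [CommRing F] (φ : ι → A → F) {B B' : Finset ι}
    (hB : B ⊆ B') {n : ℕ} {c : (Fin n → ι) → F} (hc : ∀ κ i, κ i ∉ B → c κ = 0) (z : Fin n → A) :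
    multiSum φ B c z = multiSum φ B' c z := by
  refine Finset.sum_subset (Fintype.piFinset_subset _ _ fun _ => hB) fun κ _ hκ => ?_
  rw [Fintype.mem_piFinset] at hκ
  push Not at hκ
  obtain ⟨i, hi⟩ := hκ
  rw [hc κ i hi, zero_mul]

theorem multiSum_fin_zero {ι A F : Type*} [CommRing F] (φ : ι → A → F) (B : Finset ι)
    (c : (Fin 0 → ι) → F) (z : Fin 0 → A) : multiSum φ B c z = c Fin.elim0 := by
  rw [multiSum, Finset.sum_eq_single Fin.elim0]
  · simp
  · intro κ _ h
    exact absurd (Subsingleton.elim _ _) h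
  · intro h
    exact absurd (Fintype.mem_piFinset.2 fun i => i.elim0) h

theorem volumeFactor_ne_zero (g n : ℕ) : volumeFactor g n ≠ 0 := zpow_ne_zero _ two_ne_zero

section vanishing
variable {g n : ℕ} {c₀ : (Fin n → ℕ) → ZetaRing} {c : (Fin n → EtaIndex) → ZetaRing}

/-- A coefficient whose degree would be negative vanishes, so the expansions are finite. -/
theorem HasVolumeTop.eq_zero (h : HasVolumeTop g n c₀ c) {κ : Fin n → EtaIndex}
    (hκ : 3 * g + n ≤ ∑ i, (κ i).2 + 2) : c κ = 0 := by
  refine ((h.top κ).eq_zero_of_neg ?_).2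
  have : (3 * g + n : ℤ) ≤ ∑ i, ((κ i).2 : ℤ) + 2 := by exact_mod_cast hκ
  omega

/-- The coefficients of the volume, as leading coefficients for parities `0`. -/
theorem HasVolumeTop.hasTopPart_zero (h : HasVolumeTop g n c₀ c) (k : Fin n → ℕ) :
    HasTopPart (6 * g - 6 + 2 * n - 2 * ∑ i, (k i : ℤ))
      (MvPolynomial.C (volumeFactor g n) * c₀ k) (c fun i => (0, k i)) := by
  simpa [evenInd] using h.top fun i => (0, k i)

theorem C_mul_eq_zero {r : ℚ} (hr : r ≠ 0) {x : ZetaRing} (h : MvPolynomial.C r * x = 0) :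
    x = 0 := by
  have := congrArg (MvPolynomial.C r⁻¹ * ·) h
  simpa [← mul_assoc, ← map_mul, inv_mul_cancel₀ hr] using this

theorem HasVolumeTop.volume_eq_zero (h : HasVolumeTop g n c₀ c) {k : Fin n → ℕ}
    (hk : 3 * g + n ≤ ∑ i, k i + 2) : c₀ k = 0 := by
  refine C_mul_eq_zero (volumeFactor_ne_zero g n) ((h.hasTopPart_zero k).eq_zero_of_neg ?_).1
  have : (3 * g + n : ℤ) ≤ ∑ i, (k i : ℤ) + 2 := by exact_mod_cast hk
  omega

end vanishing

/-- The coefficients `c₀` and `c` of the expansions of the volume and of the correlation differential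
of type `(g, n)`, uniformly in `q`. -/
structure HasExpansion (g n : ℕ) (c₀ : (Fin n → ℕ) → ZetaRing) (c : (Fin n → EtaIndex) → ZetaRing) :
    Prop where
  hasVolumeTop : HasVolumeTop g n c₀ c
  volume : ∀ q : ℝ, 0 < q → q < 1 → ∀ L, qVolume q g n L =
    multiSum evenPow (Finset.range (3 * (2 * g + n))) (fun k => zetaEval q (c₀ k)) L
  correlator : ∀ q : ℝ, 0 < q → q < 1 → ∀ z : Fin n → ℂ, (∀ i, z i ^ 2 ≠ 1) →
    okuyamaCorrelator q g n z =
      multiSum etaBasis (etaBox (3 * (2 * g + n))) (fun κ => zetaEvalC q (c κ)) z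

theorem mem_etaBox {K : ℕ} {x : EtaIndex} : x ∈ etaBox K ↔ x.2 < K := by
  simp [etaBox]

section enlarge
variable {g n : ℕ} {c₀ : (Fin n → ℕ) → ZetaRing} {c : (Fin n → EtaIndex) → ZetaRing} {q : ℝ}

theorem HasExpansion.volume_of_le (h : HasExpansion g n c₀ c) (hq : 0 < q) (hq1 : q < 1) {K : ℕ}
    (hK : 3 * (2 * g + n) ≤ K) (L : Fin n → ℝ) :
    qVolume q g n L = multiSum evenPow (Finset.range K) (fun k => zetaEval q (c₀ k)) L := by
  rw [h.volume q hq hq1 L]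
  refine multiSum_subset _ (Finset.range_mono hK) (fun k i hi => ?_) L
  rw [h.hasVolumeTop.volume_eq_zero, map_zero]
  rw [Finset.mem_range, not_lt] at hi
  have := Finset.single_le_sum (f := k) (fun _ _ => Nat.zero_le _) (Finset.mem_univ i)
  omega

theorem HasExpansion.correlator_of_le (h : HasExpansion g n c₀ c) (hq : 0 < q) (hq1 : q < 1) {K : ℕ}
    (hK : 3 * (2 * g + n) ≤ K) {z : Fin n → ℂ} (hz : ∀ i, z i ^ 2 ≠ 1) :
    okuyamaCorrelator q g n z = multiSum etaBasis (etaBox K) (fun κ => zetaEvalC q (c κ)) z := by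
  rw [h.correlator q hq hq1 z hz]
  refine multiSum_subset _ (fun x hx => ?_) (fun κ i hi => ?_) z
  · rw [mem_etaBox] at hx ⊢
    omega
  · rw [h.hasVolumeTop.eq_zero, map_zero]
    rw [mem_etaBox, not_lt] at hi
    have := Finset.single_le_sum (f := fun i => (κ i).2) (fun _ _ => Nat.zero_le _)
      (Finset.mem_univ i)
    omega

end enlarge

/-! ### Spheres with three boundary components -/

/-- The coefficients of `V_{0,3} = 1`. -/
noncomputable def sphereVolumeCoeff (k : Fin 3 → ℕ) : ZetaRing := if ∀ i, k i = 0 then 1 else 0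

/-- The coefficients of `ω_{0,3}`. -/
noncomputable def sphereEtaCoeff (κ : Fin 3 → EtaIndex) : ZetaRing :=
  if ∀ i, (κ i).2 = 0 then MvPolynomial.C (evenInd (∑ i, (κ i).1)) else 0

theorem sum_finset_fin_two {F : Type*} [AddCommMonoid F] (t : Finset (Fin 2) → F) :
    ∑ I : Finset (Fin 2), (if I = ∅ ∨ I = Finset.univ then 0 else t I) = t {0} + t {1} := by
  rw [show (Finset.univ : Finset (Finset (Fin 2))) = {∅, {0}, {1}, Finset.univ} by decide,
    Finset.sum_insert (by decide), Finset.sum_insert (by decide), Finset.sum_insert (by decide),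
    Finset.sum_singleton, if_pos (by decide), if_neg (by decide), if_neg (by decide),
    if_pos (by decide), zero_add, add_zero]

theorem branchSum_cast (m : ℕ) : (1 : ℂ) ^ m + (-1) ^ m = branchSum m := by
  rw [branchSum, one_pow]; push_cast; rfl

theorem okuyamaCorrelator_sphere {q : ℝ} (hq : 0 < q) (hq1 : q < 1) {z₁ : ℂ} {z : Fin 2 → ℂ}
    (hz₁ : z₁ ^ 2 ≠ 1) (hz : ∀ i, z i ^ 2 ≠ 1) :
    okuyamaCorrelator q 0 3 (Fin.cons z₁ z) = ∑ ε : ZMod 2, ∑ ε' : ZMod 2, ∑ ε'' : ZMod 2,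
      (branchSum (ε.val + ε'.val + ε''.val) : ℂ) * (1 / 2) *
        (etaBasis (ε, 0) z₁ * etaBasis (ε', 0) (z 0) * etaBasis (ε'', 0) (z 1)) := by
  have hres : ∀ α : ℂ, α ^ 2 = 1 → residueAt (fun p =>
      signedKernel q z₁ p * ((if _h : 0 < 0 then
        okuyamaCorrelator q (0 - 1) (2 + 2) (Fin.cons p (Fin.cons p⁻¹ z)) else 0) +
      ∑ g₁ : Fin (0 + 1), ∑ I : Finset (Fin 2),
        (if _h : (g₁.1 = 0 ∧ I = ∅) ∨ (g₁.1 = 0 ∧ I = Finset.univ) then 0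
        else okuyamaCorrelator q g₁.1 (I.card + 1) (Fin.cons p (subtuple z I)) *
          okuyamaCorrelator q (0 - g₁.1) (Iᶜ.card + 1) (Fin.cons p⁻¹ (subtuple z Iᶜ))))) α =
      ∑ ε : ZMod 2, ∑ ε' : ZMod 2, ∑ ε'' : ZMod 2, α ^ (ε.val + ε'.val + ε''.val) * (1 / 2) *
        (etaBasis (ε, 0) z₁ * etaBasis (ε', 0) (z 0) * etaBasis (ε'', 0) (z 1)) := by
    intro α hα
    refine IsResidue.residueAt_eq ?_
    convert! (isResidue_sphere hq hq1 hα hz₁ (hz 0) (hz 1)).add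
      (isResidue_sphere hq hq1 hα hz₁ (hz 1) (hz 0)) using 1
    · funext p
      rw [dif_neg (lt_irrefl 0), zero_add, Fin.sum_univ_one]
      simp only [Fin.val_zero, true_and, dite_eq_ite, Nat.sub_zero]
      rw [sum_finset_fin_two (fun I => okuyamaCorrelator q 0 (I.card + 1)
        (Fin.cons p (subtuple z I)) *
          okuyamaCorrelator q 0 (Iᶜ.card + 1) (Fin.cons p⁻¹ (subtuple z Iᶜ))),
        okuyamaCorrelator_zero_two q (a := 0) rfl, okuyamaCorrelator_zero_two q (a := 1) (by decide),
        okuyamaCorrelator_zero_two q (a := 1) rfl, okuyamaCorrelator_zero_two q (a := 0) (by decide)]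
      ring
    · simp only [sum_zmod_two, ZMod.val_zero, ZMod.val_one]
      ring
  rw [okuyamaCorrelator_eq_sum_residueAt le_rfl, Finset.sum_pair (by norm_num),
    hres 1 (by norm_num), hres (-1) (by norm_num)]
  simp only [← Finset.sum_add_distrib]
  refine Finset.sum_congr rfl fun ε _ => Finset.sum_congr rfl fun ε' _ =>
    Finset.sum_congr rfl fun ε'' _ => ?_
  rw [← branchSum_cast]
  ring

theorem hasExpansion_sphere : HasExpansion 0 3 sphereVolumeCoeff sphereEtaCoeff := by
  have hv : volumeFactor 0 3 = 1 := by norm_num [volumeFactor]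
  refine ⟨⟨fun κ => ?_, fun κ hκ => ?_⟩, fun q hq hq1 L => ?_, fun q hq hq1 z hz => ?_⟩
  · rw [hv, mul_one, sphereVolumeCoeff, sphereEtaCoeff]
    split_ifs with h
    · simp only [h, Nat.cast_zero, Finset.sum_const_zero, mul_one]
      have := (HasTopPart.of_mem one_mem_homogeneousPart).C_mul (evenInd (∑ i, (κ i).1))
      rw [mul_one] at this
      exact this.congr_degree (by norm_num)
    · rw [mul_zero]; exact HasTopPart.zero _
  · rw [sphereEtaCoeff, evenInd, if_neg hκ, map_zero, ite_self]
  · rw [qVolume, if_neg (by omega), if_pos ⟨rfl, rfl⟩]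
    rw [← multiSum_subset evenPow (B := Finset.range 1) (Finset.range_mono (by omega))]
    · obtain ⟨x, y, w, u, rfl⟩ : ∃ x y w, ∃ u : Fin 0 → ℝ,
          L = Fin.cons x (Fin.cons y (Fin.cons w u)) := ⟨L 0, L 1, L 2, Fin.elim0, by
        funext i; fin_cases i <;> rfl⟩
      simp only [multiSum_cons, Finset.range_one, Finset.sum_singleton, multiSum_fin_zero, evenPow]
      rw [sphereVolumeCoeff, if_pos]
      · simp
      · intro i; fin_cases i <;> rfl
    · intro κ i hi
      rw [sphereVolumeCoeff, if_neg, map_zero]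
      exact fun h => hi (by rw [h i]; simp)
  · rw [← multiSum_subset etaBasis (B := etaBox 1) (fun x hx => by
      rw [mem_etaBox] at hx ⊢; omega)]
    · obtain ⟨x, y, w, u, rfl⟩ : ∃ x y w, ∃ u : Fin 0 → ℂ,
          z = Fin.cons x (Fin.cons y (Fin.cons w u)) := ⟨z 0, z 1, z 2, Fin.elim0, by
        funext i; fin_cases i <;> rfl⟩
      rw [okuyamaCorrelator_sphere (z₁ := x) (z := Fin.cons y (Fin.cons w u)) hq hq1 (hz 0)
        fun i => hz i.succ]
      simp only [multiSum_cons, sum_etaBox, Finset.range_one, Finset.sum_singleton,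
        multiSum_fin_zero, Finset.mul_sum]
      refine Finset.sum_congr rfl fun ε _ => Finset.sum_congr rfl fun ε' _ =>
        Finset.sum_congr rfl fun ε'' _ => ?_
      rw [sphereEtaCoeff, if_pos, zetaEvalC_C, branchSum_eq]
      · simp only [Fin.sum_univ_succ, Fin.cons_zero, Fin.cons_succ, Fin.sum_univ_zero, add_zero]
        rw [← add_assoc]
        push_cast
        simp only [Fin.cons_zero, Fin.cons_one]
        ring
      · intro i; fin_cases i <;> rfl
    · intro κ i hi
      rw [sphereEtaCoeff, if_neg, map_zero]
      exact fun h => hi (by rw [mem_etaBox, h i]; exact one_pos)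

/-! ### Tori with one boundary component -/

/-- The coefficients of `V_{1,1}`. -/
noncomputable def torusVolumeCoeff (k : Fin 1 → ℕ) : ZetaRing :=
  if k 0 = 0 then MvPolynomial.C (1 / 2) * MvPolynomial.X 0
  else if k 0 = 1 then MvPolynomial.C (1 / 48) else 0

/-- The coefficients of `ω_{1,1}`. -/
noncomputable def torusEtaCoeff (κ : Fin 1 → EtaIndex) : ZetaRing :=
  MvPolynomial.C (branchSum (κ 0).1.val) * torusCoeff (κ 0).2

theorem branchSum_val (ε : ZMod 2) : branchSum ε.val = 2 * evenInd ε := by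
  have := branchSum_eq ε 0 0
  simpa using this

theorem okuyamaCorrelator_torus {q : ℝ} (hq : 0 < q) (hq1 : q < 1) {z : ℂ} (hz : z ^ 2 ≠ 1)
    {u : Fin 0 → ℂ} {K : ℕ} (hK : 1 < K) : okuyamaCorrelator q 1 1 (Fin.cons z u) =
      ∑ i ∈ Finset.range K, ∑ ε : ZMod 2, (branchSum ε.val : ℂ) * zetaEvalC q (torusCoeff i) *
        etaBasis (ε, i) z := by
  have hres : ∀ α : ℂ, α ^ 2 = 1 → residueAt (fun p =>
      signedKernel q z p * ((if _h : 0 < 1 then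
        okuyamaCorrelator q (1 - 1) (0 + 2) (Fin.cons p (Fin.cons p⁻¹ u)) else 0) +
      ∑ g₁ : Fin (1 + 1), ∑ I : Finset (Fin 0),
        (if _h : (g₁.1 = 0 ∧ I = ∅) ∨ (g₁.1 = 1 ∧ I = Finset.univ) then 0
        else okuyamaCorrelator q g₁.1 (I.card + 1) (Fin.cons p (subtuple u I)) *
          okuyamaCorrelator q (1 - g₁.1) (Iᶜ.card + 1) (Fin.cons p⁻¹ (subtuple u Iᶜ))))) α =
      ∑ i ∈ Finset.range K, ∑ ε : ZMod 2, α ^ ε.val * zetaEvalC q (torusCoeff i) *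
        etaBasis (ε, i) z := by
    intro α hα
    refine IsResidue.residueAt_eq ?_
    convert! isResidue_torus hq hq1 hα hz hK using 1
    funext p
    rw [dif_pos one_pos, Finset.sum_eq_zero, add_zero, okuyamaCorrelator, correlator,
      if_neg (by simp), if_pos ⟨rfl, rfl⟩]
    · rfl
    · intro g₁ _
      refine Finset.sum_eq_zero fun I _ => dif_pos ?_
      have : g₁.1 = 0 ∨ g₁.1 = 1 := by omega
      exact this.imp (fun h => ⟨h, Subsingleton.elim _ _⟩) fun h => ⟨h, Subsingleton.elim _ _⟩
  rw [okuyamaCorrelator_eq_sum_residueAt le_rfl, Finset.sum_pair (by norm_num),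
    hres 1 (by norm_num), hres (-1) (by norm_num)]
  simp only [← Finset.sum_add_distrib, ← add_mul, branchSum_cast]

theorem hasTopPart_torusCoeff_zero : HasTopPart 2 (MvPolynomial.C (1 / 4) * MvPolynomial.X 0)
    (torusCoeff 0) := by
  have h := (hasTopPart_zetaCoeff (PowerSeries.C (1 / 4) * sinhcInv ^ 2 *
    (PowerSeries.C (1 / 4) * sinhcInv ^ 2)) 1).C_mul (1 / ((2 * 0 + 1).factorial : ℚ))
  rw [torusCoeff, if_pos zero_le_one]
  convert! h using 1
  have e : completeSymm 1 = MvPolynomial.X 0 := by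
    rw [completeSymm_succ]
    simp [completeSymm]
  rw [← mul_assoc, ← map_mul, e]
  congr 2
  simp [constantCoeff_sinhcInv]

theorem hasTopPart_torusCoeff_one : HasTopPart 0 (MvPolynomial.C (1 / 96)) (torusCoeff 1) := by
  have h := (hasTopPart_zetaCoeff (PowerSeries.C (1 / 4) * sinhcInv ^ 2 *
    (PowerSeries.C (1 / 4) * sinhcInv ^ 2)) 0).C_mul (1 / ((2 * 1 + 1).factorial : ℚ))
  rw [torusCoeff, if_pos le_rfl]
  convert! h using 1
  rw [← mul_assoc, ← map_mul, completeSymm, mul_one]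
  congr 1
  simp [constantCoeff_sinhcInv, Nat.factorial]
  norm_num

theorem hasExpansion_torus : HasExpansion 1 1 torusVolumeCoeff torusEtaCoeff := by
  have hv : volumeFactor 1 1 = 1 := by norm_num [volumeFactor]
  refine ⟨⟨fun κ => ?_, fun κ hκ => ?_⟩, fun q hq hq1 L => ?_, fun q hq hq1 z hz => ?_⟩
  · rw [hv, mul_one, Fin.sum_univ_one, Fin.sum_univ_one, torusVolumeCoeff, torusEtaCoeff,
      branchSum_val]
    split_ifs with h h
    · rw [h]
      convert! (hasTopPart_torusCoeff_zero.C_mul (2 * evenInd (κ 0).1)).congr_degree ?_ using 1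
      · rw [← mul_assoc, ← mul_assoc, ← map_mul, ← map_mul]
        congr 2; ring
      · norm_num
    · rw [h]
      convert! (hasTopPart_torusCoeff_one.C_mul (2 * evenInd (κ 0).1)).congr_degree ?_ using 1
      · rw [← map_mul, ← map_mul]
        congr 1; ring
      · norm_num
    · rw [torusCoeff, if_neg (by omega), mul_zero, mul_zero]
      exact HasTopPart.zero _
  · rw [Fin.sum_univ_one] at hκ
    rw [torusEtaCoeff, branchSum_val, evenInd, if_neg hκ, mul_zero, map_zero, zero_mul]
  · obtain ⟨x, u, rfl⟩ : ∃ x, ∃ u : Fin 0 → ℝ, L = Fin.cons x u := ⟨L 0, Fin.elim0, by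
      funext i; fin_cases i; rfl⟩
    rw [qVolume, if_neg (by omega), if_neg (by omega), if_pos ⟨rfl, rfl⟩]
    simp only [multiSum_cons, multiSum_fin_zero, Finset.sum_range_succ, Finset.sum_range_zero,
      evenPow, torusVolumeCoeff, Fin.cons_zero]
    simp [zetaEval]
    ring
  · obtain ⟨x, u, rfl⟩ : ∃ x, ∃ u : Fin 0 → ℂ, z = Fin.cons x u := ⟨z 0, Fin.elim0, by
      funext i; fin_cases i; rfl⟩
    rw [okuyamaCorrelator_torus (z := x) hq hq1 (hz 0) (K := 3 * (2 * 1 + 1)) (by omega)]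
    simp only [multiSum_cons, multiSum_fin_zero, sum_etaBox]
    refine Finset.sum_congr rfl fun i _ => Finset.sum_congr rfl fun ε _ => ?_
    rw [torusEtaCoeff, map_mul, zetaEvalC_C]
    simp only [Fin.cons_zero]
    ring

/-! ### Existence of the expansions -/

/-- The bound on the indices of nonzero coefficients passes to the quadratic terms: `w` is the
exponent belonging to an index. -/
theorem splitCoeff_eq_zero {ι R : Type*} [CommRing R] {c : ∀ _g n : ℕ, (Fin n → ι) → R} {w : ι → ℕ}
    {g n : ℕ} (hs : 3 ≤ 2 * g + n) (h : ∀ g' n', IsStable g' n' → 2 * g' + n' < 2 * g + (n + 1) →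
      ∀ κ, 3 * g' + n' ≤ ∑ i, w (κ i) + 2 → c g' n' κ = 0) (a b : ι) (κ : Fin n → ι)
    (hab : 3 * g + n + 1 ≤ w a + w b + 2) : splitCoeff c g n a b κ = 0 := by
  rw [splitCoeff, Finset.sum_eq_zero, add_zero]
  · split_ifs with hg
    · refine h (g - 1) (n + 2) ⟨by omega, by omega⟩ (by omega) _ ?_
      rw [Fin.sum_univ_succ, Fin.sum_univ_succ]
      simp only [Fin.cons_zero, Fin.cons_succ]
      omega
    · rfl
  · intro g₁ _
    refine Finset.sum_eq_zero fun I _ => ?_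
    split_ifs with hI
    · have hg : g₁.1 ≤ g := Nat.lt_succ_iff.1 g₁.2
      have hc := Finset.card_add_card_compl I
      rw [Fintype.card_fin] at hc
      obtain ⟨hI1, hI2⟩ := hI
      by_cases ha : 3 * g₁.1 + (I.card + 1) ≤ w a + 2
      · rw [h g₁.1 (I.card + 1) ⟨by omega, by omega⟩ (by omega), zero_mul]
        rw [Fin.sum_univ_succ]
        simp only [Fin.cons_zero]
        omega
      · rw [h (g - g₁.1) (Iᶜ.card + 1) ⟨by omega, by omega⟩ (by omega), mul_zero]
        rw [Fin.sum_univ_succ]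
        simp only [Fin.cons_zero]
        omega
    · rfl

/-- By induction on `2g + n`; the recursions determine `c₀` and `c` without reference to `q`. -/
theorem exists_hasExpansion (g n : ℕ) (hgn : IsStable g n) : ∃ c₀ c, HasExpansion g n c₀ c := by
  induction hm : 2 * g + n using Nat.strong_induction_on generalizing g n with
  | _ m ih =>
    obtain ⟨n, rfl⟩ : ∃ n', n = n' + 1 := ⟨n - 1, by have := hgn.1; omega⟩
    by_cases h03 : g = 0 ∧ n = 2
    · obtain ⟨rfl, rfl⟩ := h03
      exact ⟨_, _, hasExpansion_sphere⟩
    by_cases h11 : g = 1 ∧ n = 0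
    · obtain ⟨rfl, rfl⟩ := h11
      exact ⟨_, _, hasExpansion_torus⟩
    have hs : 3 ≤ 2 * g + n := by
      have := hgn.2
      omega
    have ih' : ∀ g' n', ∃ c₀ c, IsStable g' n' → 2 * g' + n' < 2 * g + (n + 1) →
        HasExpansion g' n' c₀ c := fun g' n' => by
      by_cases h : IsStable g' n' ∧ 2 * g' + n' < 2 * g + (n + 1)
      · obtain ⟨c₀, c, hc⟩ := ih _ (by omega) g' n' h.1 rfl
        exact ⟨c₀, c, fun _ _ => hc⟩
      · exact ⟨0, 0, fun h1 h2 => absurd ⟨h1, h2⟩ h⟩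
    -- the coefficients have to be chosen before `q`, to be independent of it
    choose c₀ c hc using ih'
    have hcard : ∀ a : Fin n, (Finset.univ.erase a).card + 1 = n := fun a => by
      rw [Finset.card_erase_add_one (Finset.mem_univ a), Finset.card_univ, Fintype.card_fin]
    have hle : ∀ g' n', IsStable g' n' → 2 * g' + n' < 2 * g + (n + 1) →
        3 * (2 * g' + n') ≤ 3 * (2 * g + (n + 1)) := fun g' n' h1 h2 => by omega
    refine ⟨volumeStep c₀ g n (3 * (2 * g + (n + 1))), etaStep c g n (3 * (2 * g + (n + 1))),
      hasVolumeTop_step _ hs fun g' n' h1 h2 => (hc g' n' h1 h2).hasVolumeTop, ?_, ?_⟩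
    · intro q hq hq1
      refine qVolume_eq_multiSum_volumeStep hq hq1 hs ?_ ?_ ?_
      · exact fun g' n' h1 h2 z _ => (hc g' n' h1 h2).volume_of_le hq hq1 (hle g' n' h1 h2) z
      · exact fun k l κ hkl => splitCoeff_eq_zero (w := id) hs (fun g' n' h1 h2 κ hκ =>
          (hc g' n' h1 h2).hasVolumeTop.volume_eq_zero hκ) k l κ (by simp only [id]; omega)
      · intro a k κ hk
        have := hcard a
        refine (hc g _ ⟨by omega, by omega⟩ (by omega)).hasVolumeTop.volume_eq_zero ?_
        rw [Fin.sum_univ_succ]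
        simp only [Fin.cons_zero]
        omega
    · intro q hq hq1
      refine okuyamaCorrelator_eq_multiSum_etaStep hq hq1 hs ?_ ?_ ?_
      · exact fun g' n' h1 h2 z hz => (hc g' n' h1 h2).correlator_of_le hq hq1 (hle g' n' h1 h2) hz
      · exact fun k l κ hkl => splitCoeff_eq_zero (w := Prod.snd) hs (fun g' n' h1 h2 κ hκ =>
          (hc g' n' h1 h2).hasVolumeTop.eq_zero hκ) k l κ (by omega)
      · intro a k κ hk
        have := hcard a
        refine (hc g _ ⟨by omega, by omega⟩ (by omega)).hasVolumeTop.eq_zero ?_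
        rw [Fin.sum_univ_succ]
        simp only [Fin.cons_zero]
        omega

/-! ### Taylor coefficients at the origin -/

/-- The Taylor coefficients of the basis functions at the origin. -/
theorem hasJet_parityEta_zero (ε : ZMod 2) (m : ℕ) : HasJet (parityEta ε m)
    (PowerSeries.mk fun r => if ((r + 1 : ℕ) : ZMod 2) = ε then ((r + 1 : ℕ) : ℂ) ^ m else 0) := by
  induction m with
  | zero =>
    have e : parityEta ε 0 = fun z => (if ε = 0 then z else 1) * (1 + -1 * z ^ 2)⁻¹ :=
      funext fun z => by rw [parityEta_zero, div_eq_mul_inv]; congr 2; ring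
    have hb : (1 + PowerSeries.C (-1) * PowerSeries.X ^ 2) *
        PowerSeries.mk (fun r => if Even r then (1 : ℂ) else 0) = 1 := by
      ext r
      rw [add_mul, one_mul, mul_assoc, map_add, PowerSeries.coeff_C_mul,
        PowerSeries.coeff_X_pow_mul', PowerSeries.coeff_mk, PowerSeries.coeff_mk,
        PowerSeries.coeff_one]
      rcases r with _ | _ | r
      · simp
      · simp
      · simp [Nat.even_add]
        split_ifs <;> simp
    have h := (HasJet.one.add (HasJet.const_mul (-1) (HasJet.id.pow 2))).inv hb
    rw [e]
    rcases zmod_two_cases ε with rfl | rfl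
    · simp only [if_true]
      convert HasJet.id.mul h using 1
      ext r
      rcases r with _ | r
      · simp
      · rw [PowerSeries.coeff_succ_X_mul, PowerSeries.coeff_mk, PowerSeries.coeff_mk]
        simp only [ZMod.natCast_eq_zero_iff_even, Nat.even_add_one, not_not, pow_zero]
    · simp only [one_ne_zero, if_false, one_mul]
      convert h using 1
      ext r
      rw [PowerSeries.coeff_mk, PowerSeries.coeff_mk]
      simp [ZMod.natCast_eq_zero_iff_even]
  | succ m ih =>
    have e : parityEta ε (m + 1) = deriv (fun w => w * parityEta ε m w) :=
      funext (parityEta_succ ε m)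
    rw [e]
    convert (HasJet.id.mul ih).deriv using 1
    ext r
    rw [PowerSeries.coeff_derivative, PowerSeries.coeff_succ_X_mul, PowerSeries.coeff_mk,
      PowerSeries.coeff_mk]
    split_ifs
    · push_cast; ring
    · simp

/-- The iterated Taylor coefficient of a combination of products is the same combination of products
of Taylor coefficients. -/
theorem taylorCoeff_multiSum {ι : Type*} {φ : ι → ℂ → ℂ} {a : ι → PowerSeries ℂ} {U : Set ℂ}
    (hU : U ∈ 𝓝 (0 : ℂ)) (B : Finset ι) (hφ : ∀ b ∈ B, AnalyticAt ℂ (φ b) 0)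
    (ha : ∀ b ∈ B, HasJet (φ b) (a b)) {n : ℕ} {f : (Fin n → ℂ) → ℂ} {c : (Fin n → ι) → ℂ}
    (hf : ∀ z : Fin n → ℂ, (∀ i, z i ∈ U) → f z = multiSum φ B c z) (k : Fin n → ℕ) :
    taylorCoeff n f k = multiSum (fun b m => PowerSeries.coeff m (a b)) B c k := by
  induction n with
  | zero => rw [taylorCoeff, hf _ fun i => i.elim0, multiSum_fin_zero, multiSum_fin_zero]
  | succ n ih =>
    rw [taylorCoeff]
    set M : ι → ℂ := fun b =>
      multiSum (fun b m => PowerSeries.coeff m (a b)) B (fun κ => c (Fin.cons b κ)) (Fin.tail k)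
    have h : (fun t => taylorCoeff n (fun w => f (Fin.cons t w)) (Fin.tail k)) =ᶠ[𝓝 0]
        fun t => ∑ b ∈ B, M b * φ b t := by
      filter_upwards [hU] with t ht
      rw [ih (c := fun κ => ∑ b ∈ B, φ b t * c (Fin.cons b κ))]
      · rw [multiSum_sum]
        refine Finset.sum_congr rfl fun b _ => ?_
        rw [multiSum_mul_left, mul_comm]
      · intro z hz
        rw [hf _ (Fin.cases ht hz), multiSum_cons, multiSum_sum]
        exact Finset.sum_congr rfl fun b _ => by rw [multiSum_mul_left]
    have hJ : HasJet (fun t => ∑ b ∈ B, M b * φ b t) (∑ b ∈ B, PowerSeries.C (M b) * a b) :=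
      HasJet.sum B fun b hb => (ha b hb).const_mul _
    have hA : AnalyticAt ℂ (fun t => ∑ b ∈ B, M b * φ b t) 0 :=
      Finset.analyticAt_fun_sum B fun b hb => analyticAt_const.mul (hφ b hb)
    rw [h.iteratedDeriv_eq, hJ.iteratedDeriv_eq hA, map_sum]
    conv_rhs => rw [← Fin.cons_self_tail k, multiSum_cons]
    exact Finset.sum_congr rfl fun b _ => by rw [PowerSeries.coeff_C_mul, mul_comm]

/-- Of the basis indices, only those contribute whose parities are the prescribed ones. -/
theorem multiSum_etaBox_ite {A F : Type*} [CommRing F] (p : A → ZMod 2) (w : ℕ → A → F) (K : ℕ)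
    {n : ℕ} (c : (Fin n → EtaIndex) → F) (z : Fin n → A) :
    multiSum (fun κ x => if p x = κ.1 then w κ.2 x else 0) (etaBox K) c z =
      multiSum w (Finset.range K) (fun k => c fun i => (p (z i), k i)) z := by
  induction n with
  | zero =>
    rw [multiSum_fin_zero, multiSum_fin_zero]
    exact congrArg c (Subsingleton.elim _ _)
  | succ n ih =>
    rw [← Fin.cons_self_tail z, multiSum_cons, multiSum_cons, sum_etaBox]
    refine Finset.sum_congr rfl fun k _ => ?_
    simp only [ite_mul, zero_mul, Finset.sum_ite_eq, Finset.mem_univ, if_true, ih]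
    congr 2
    funext κ
    congr 1
    funext i
    cases i using Fin.cases <;> rfl

/-- The discrete volume is a polynomial in the `bᵢ²` on each parity class: the coefficient of `z^(b-1)`
in the basis function of index `(ε, k)` is `b^(2k+1)` or `0`, and one factor `b` is divided out. -/
theorem HasExpansion.discreteVolume_eq {g n : ℕ} {c₀ : (Fin n → ℕ) → ZetaRing}
    {c : (Fin n → EtaIndex) → ZetaRing} (h : HasExpansion g n c₀ c) {q : ℝ} (hq : 0 < q)
    (hq1 : q < 1) {b : Fin n → ℕ} (hb : ∀ i, 0 < b i) :
    discreteVolume q g n b = ((multiSum evenPow (Finset.range (3 * (2 * g + n)))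
      (fun k => zetaEval q (c fun i => ((b i : ZMod 2), k i))) (fun i => (b i : ℝ)) : ℝ) : ℂ) := by
  have h0 : (0 : ℂ) ^ 2 ≠ 1 := by norm_num
  have hb' : ∀ i, b i - 1 + 1 = b i := fun i => Nat.sub_add_cancel (hb i)
  have h1 := taylorCoeff_multiSum (φ := etaBasis) (isOpen_sq_ne_one.mem_nhds h0)
    (etaBox (3 * (2 * g + n)))
    (fun κ _ => analyticAt_parityEta κ.1 (2 * κ.2 + 1) h0)
    (fun κ _ => hasJet_parityEta_zero κ.1 (2 * κ.2 + 1)) (h.correlator q hq hq1) (fun i => b i - 1)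
  simp only [PowerSeries.coeff_mk] at h1
  rw [discreteVolume, h1, multiSum_etaBox_ite (fun m : ℕ => ((m + 1 : ℕ) : ZMod 2))
    (fun k m => ((m + 1 : ℕ) : ℂ) ^ (2 * k + 1)), multiSum, multiSum, Finset.sum_div,
    Complex.ofReal_sum]
  refine Finset.sum_congr rfl fun k _ => ?_
  have hne : ∏ i, (b i : ℂ) ≠ 0 :=
    Finset.prod_ne_zero_iff.2 fun i _ => Nat.cast_ne_zero.2 (hb i).ne'
  simp only [hb', pow_succ _ (2 * k _), Finset.prod_mul_distrib, evenPow, zetaEvalC_apply]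
  push_cast
  field_simp

/-! ### Polynomials in the lengths and the `q`-zeta values -/

/-- The polynomial `∑ d_k ∏ (bᵢ²)^(kᵢ)`, the sum running over the tuples `k` with entries less than
`K`. -/
noncomputable def lengthPoly {n : ℕ} (K : ℕ) (d : (Fin n → ℕ) → ZetaRing) : ZetaPoly n :=
  ∑ k ∈ Fintype.piFinset fun _ : Fin n => Finset.range K,
    MvPolynomial.rename Sum.inr (d k) *
      MvPolynomial.monomial (∑ i, Finsupp.single (Sum.inl i) (k i)) 1

theorem value_lengthPoly {n : ℕ} (K : ℕ) (d : (Fin n → ℕ) → ZetaRing) (q : ℝ) (b : Fin n → ℝ) :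
    (lengthPoly K d).value q b =
      multiSum evenPow (Finset.range K) (fun k => zetaEval q (d k)) b := by
  rw [lengthPoly, ZetaPoly.value, map_sum, multiSum]
  refine Finset.sum_congr rfl fun k _ => ?_
  rw [map_mul, MvPolynomial.aeval_rename, MvPolynomial.monomial_sum_one, map_prod]
  refine congrArg₂ _ rfl (Finset.prod_congr rfl fun i _ => ?_)
  rw [← MvPolynomial.X_pow_eq_monomial, map_pow, MvPolynomial.aeval_X, Sum.elim_inl, evenPow,
    pow_mul]

/-- The degree of a monomial of `lengthPoly`, from the two kinds of variables. -/
theorem exists_of_mem_support_lengthPoly {n : ℕ} {K : ℕ} {d : (Fin n → ℕ) → ZetaRing}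
    {m : Fin n ⊕ ℕ →₀ ℕ} (hm : m ∈ (lengthPoly K d).support) : ∃ k, ∃ m' ∈ (d k).support,
      (Finsupp.weight (zetaDegree n) m : ℤ) = zetaWeight m' + 2 * ∑ i, (k i : ℤ) := by
  obtain ⟨k, -, hk⟩ := Finset.mem_biUnion.1 (MvPolynomial.support_sum hm)
  classical
  obtain ⟨a, ha, b, hb, rfl⟩ := Finset.mem_add.1 (MvPolynomial.support_mul _ _ hk)
  rw [MvPolynomial.support_rename_of_injective Sum.inr_injective, Finset.mem_image] at ha
  obtain ⟨m', hm', rfl⟩ := ha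
  have hb := Finset.mem_singleton.1 (MvPolynomial.support_monomial_subset hb)
  subst hb
  refine ⟨k, m', hm', ?_⟩
  have h1 : Finsupp.weight (zetaDegree n) (m'.mapDomain Sum.inr) =
      Finsupp.weight (fun k => 2 * k + 2) m' := by
    rw [Finsupp.weight_apply, Finsupp.weight_apply, Finsupp.sum_mapDomain_index] <;>
      simp [zetaDegree, add_mul]
  rw [map_add, map_sum, h1, zetaWeight, Finset.mul_sum]
  push_cast
  congr 1
  refine Finset.sum_congr rfl fun i _ => ?_
  rw [Finsupp.weight_apply, Finsupp.sum_single_index] <;> simp [zetaDegree, mul_comm]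

/-- The coefficients of the volume are homogeneous, since they are leading parts up to a nonzero
factor. -/
theorem HasVolumeTop.volume_mem {g n : ℕ} {c₀ : (Fin n → ℕ) → ZetaRing}
    {c : (Fin n → EtaIndex) → ZetaRing} (h : HasVolumeTop g n c₀ c) (k : Fin n → ℕ) :
    c₀ k ∈ homogeneousPart (6 * g - 6 + 2 * n - 2 * ∑ i, (k i : ℤ)) := by
  have := C_mul_mem_restrictSupport (volumeFactor g n)⁻¹ (h.hasTopPart_zero k).1
  rwa [← mul_assoc, ← map_mul, inv_mul_cancel₀ (volumeFactor_ne_zero g n), map_one, one_mul] at this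

theorem isWeightedHomogeneous_lengthPoly {n D K : ℕ} {d : (Fin n → ℕ) → ZetaRing}
    (hd : ∀ k, d k ∈ homogeneousPart (D - 2 * ∑ i, (k i : ℤ))) :
    MvPolynomial.IsWeightedHomogeneous (zetaDegree n) (lengthPoly K d) D := by
  intro m hm
  obtain ⟨k, m', hm', e⟩ := exists_of_mem_support_lengthPoly (MvPolynomial.mem_support_iff.2 hm)
  have : zetaWeight m' = D - 2 * ∑ i, (k i : ℤ) := hd k hm'
  omega

theorem degreeLT_lengthPoly {n D K : ℕ} {d : (Fin n → ℕ) → ZetaRing}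
    (hd : ∀ k, d k ∈ lowerPart (D - 2 * ∑ i, (k i : ℤ))) : (lengthPoly K d).DegreeLT D := by
  intro m hm
  obtain ⟨k, m', hm', e⟩ := exists_of_mem_support_lengthPoly hm
  have : zetaWeight m' < D - 2 * ∑ i, (k i : ℤ) := hd k hm'
  omega

theorem theorem1p3 (g n : ℕ) (hn : 1 ≤ n) (h₁ : (g, n) ≠ (0, 1)) (h₂ : (g, n) ≠ (0, 2)) :
    ∃ (T : ZetaPoly n) (R : (Fin n → ZMod 2) → ZetaPoly n),
      MvPolynomial.IsWeightedHomogeneous (zetaDegree n) T (6 * g + 2 * n - 6) ∧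
      (∀ ε, (R ε).DegreeLT (6 * g + 2 * n - 6)) ∧
      ∀ q : ℝ, 0 < q → q < 1 →
        (∀ L : Fin n → ℝ, qVolume q g n L = T.value q L) ∧
        ∀ b : Fin n → ℕ, (∀ i, 0 < b i) →
          (Even (∑ i, b i) →
            discreteVolume q g n b =
              (((2 : ℝ) ^ (3 - 2 * (g : ℤ) - (n : ℤ)) * qVolume q g n (fun i => (b i : ℝ)) +
                (R fun i => (b i : ZMod 2)).value q (fun i => (b i : ℝ)) : ℝ) : ℂ)) ∧
          (Odd (∑ i, b i) → discreteVolume q g n b = 0) := by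
  have hs : IsStable g n := by
    refine ⟨hn, ?_⟩
    simp only [ne_eq, Prod.mk.injEq, not_and] at h₁ h₂
    by_contra hlt
    have hg : g = 0 := by omega
    have := h₁ hg
    have := h₂ hg
    omega
  obtain ⟨c₀, c, h⟩ := exists_hasExpansion g n hs
  -- the natural number subtraction does not truncate, as `3 ≤ 2 * g + n`
  have hD : ((6 * g + 2 * n - 6 : ℕ) : ℤ) = 6 * g - 6 + 2 * n := by
    have := hs.2
    omega
  refine ⟨lengthPoly (3 * (2 * g + n)) c₀, fun ε => lengthPoly (3 * (2 * g + n)) fun k =>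
    if ∑ i, ε i = 0 then c (fun i => (ε i, k i)) - MvPolynomial.C (volumeFactor g n) * c₀ k else 0,
    isWeightedHomogeneous_lengthPoly fun k => hD ▸ h.hasVolumeTop.volume_mem k,
    fun ε => degreeLT_lengthPoly fun k => ?_, fun q hq hq1 => ⟨fun L => ?_, fun b hb => ⟨?_, ?_⟩⟩⟩
  · split_ifs with hε
    · have := (h.hasVolumeTop.top fun i => (ε i, k i)).2
      rw [hε, evenInd, if_pos rfl, one_mul] at this
      rwa [hD]
    · exact Submodule.zero_mem _
  · rw [value_lengthPoly, h.volume q hq hq1]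
  · intro hev
    have hε : ∑ i, (b i : ZMod 2) = 0 := by
      rw [← Nat.cast_sum]
      exact ZMod.natCast_eq_zero_iff_even.2 hev
    have hv : (2 : ℝ) ^ (3 - 2 * (g : ℤ) - (n : ℤ)) = (volumeFactor g n : ℝ) := by
      rw [volumeFactor]; push_cast; rfl
    rw [h.discreteVolume_eq hq hq1 hb, value_lengthPoly, h.volume q hq hq1, hv,
      ← multiSum_mul_left, ← multiSum_add]
    simp only [if_pos hε, map_sub, zetaEval_C_mul, add_sub_cancel]
  · intro hodd
    have hε : ∑ i, (b i : ZMod 2) ≠ 0 := by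
      rw [← Nat.cast_sum, ne_eq, ZMod.natCast_eq_zero_iff_even]
      exact Nat.not_even_iff_odd.2 hodd
    rw [h.discreteVolume_eq hq hq1 hb]
    have h0 : ∀ k : Fin n → ℕ, c (fun i => ((b i : ZMod 2), k i)) = 0 := fun k =>
      h.hasVolumeTop.parity (fun i => ((b i : ZMod 2), k i)) hε
    simp only [h0, map_zero]
    rw [multiSum_zero, Complex.ofReal_zero]
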